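/- Let $d\ge 1$ and $M,K,\zeta>0$. Write $|\cdot|$ for the Euclidean norm. A function on $\mathbb Z^d$ is called $\mathbb Z^d$-symmetric if it is unchanged when a component of $x$ is multiplied by $-1$ and when the components of $x$ are permuted. For $f:\mathbb Z^d\to\mathbb R$ and $\mu\in\mathbb R^d$ let $f^{(\mu)}(x)=f(x)e^{\mu\cdot x}$, and for summable $f$ let $\hat f(k)=\sum_{x\in\mathbb Z^d} f(x)e^{-ik\cdot x}$. Put $p_1=2$ and $p_d=\frac{d}{d-2+\min\{\zeta,2\}}$ for $d\ge2$. Let $\mathcal Q_{M,K,\zeta}$ be the set of pairs $(Q,g)$ of functions $\mathbb Z^d\to\mathbb R$ such that - $\|Q\|_1\le M$ and $\|\,|y|^{2+\zeta}Q(y)\|_1\le M$; - $\mathrm{Re}[\hat Q(0)-\hat Q(k)]\ge K|k|^2$ for all $k\in[-\pi,\pi]^d$; - $\|g\|_1\le M$, $\|\,|y|^{\zeta}g(y)\|_1\le M$ and $\|\,|y|^2g(y)\|_{\min\{p_d,2\}}\le M$; - if $d\ge4$, then also $\|\,|y|^{d-1}Q(y)\|_{\min\{d/3,2\}}\le M$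 and $\|\,|y|^{d-1}g(y)\|_2\le M$, where $\|\cdot\|_p$ is the $\ell^p(\mathbb Z^d)$ norm. Let $S:\mathbb Z^d\to[0,\infty)$ be $\mathbb Z^d$-symmetric, and let $\Omega=\{\mu\in\mathbb R^d:\sum_{x}S^{(\mu)}(x)<\infty\}$. Assume that $\Omega$ is open, that $0\in\Omega$, and that $\mu_1e_1\notin\Omega$ for some $\mu_1>0$, where $e_1$ is the first standard basis vector. Assume that $S=g+J*S$ with $\mathbb Z^d$-symmetric functions $J,g\in L^1(\mathbb Z^d)$ such that, for every $\mu\in\overline\Omega$, $(J^{(\mu)},g^{(\mu)})\in\mathcal Q_{M,K,\zeta}$ and $\hat g^{(\mu)}(0)>0$. Assume in addition that $\hat g^{(\mu)}(0)\ge 1/M$ for all $\mu\in\partial\Omega$. Define $$m_S=\sup\{t\ge0: te_1\in\Omega\},\qquad |x|_S=\frac{1}{m_S}\max_{\mu\in\overline\Omega}\mu\cdot x\qquad(x\in\mathbb R^d).$$ (i) If $d>2$, there are constants $R,c,C>0$ depending only on $d,M,K,\zeta$ such that, for all $x\in\mathbb Z^d$ with $|x|_S\ge R$, $$c\,\frac{\max\{1,m_S|x|_S\}^{(d-3)/2}}{|x|_S^{d-2}}e^{-m_S|x|_S}\le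 S(x)\le C\,\frac{\max\{1,m_S|x|_S\}^{(d-3)/2}}{|x|_S^{d-2}}e^{-m_S|x|_S}.$$ (ii) If $d\le2$, then for every $s_0>0$ there are constants $R,c,C>0$ depending only on $d,M,K,\zeta,s_0$ such that, for all $x\in\mathbb Z^d$ with $|x|_S\ge\max\{R,s_0/m_S\}$, $$\frac{c}{m_S^{(3-d)/2}|x|_S^{(d-1)/2}}e^{-m_S|x|_S}\le S(x)\le \frac{C}{m_S^{(3-d)/2}|x|_S^{(d-1)/2}}e^{-m_S|x|_S}.$$ -/

import Mathlib

open MeasureTheory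
open scoped ENNReal

noncomputable section

/-- The integer lattice `ℤ^d`. -/
abbrev ZSpace (d : ℕ) : Type := Fin d → ℤ

/-- `ℝ^d` with the Euclidean norm and inner product. -/
abbrev RSpace (d : ℕ) : Type := EuclideanSpace ℝ (Fin d)

/-- The inclusion of `ℤ^d` into `ℝ^d`. -/
def latticeVec {d : ℕ} (x : ZSpace d) : RSpace d :=
  WithLp.toLp 2 (fun i => (x i : ℝ))

/-- `ℤ^d`-symmetry: invariance under a change of sign of a component and under permutations
of the components. -/
def LatticeSymmetric {d : ℕ} (f : ZSpace d → ℝ) : Prop :=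
  (∀ (x : ZSpace d) (i : Fin d), f (Function.update x i (-(x i))) = f x) ∧
    ∀ (x : ZSpace d) (σ : Equiv.Perm (Fin d)), f (fun i => x (σ i)) = f x

/-- The exponential tilt `f^{(μ)}(x) = f(x) e^{μ·x}`. -/
def tilt {d : ℕ} (μ : RSpace d) (f : ZSpace d → ℝ) (x : ZSpace d) : ℝ :=
  f x * Real.exp (inner ℝ μ (latticeVec x))

/-- The Fourier transform `∑_x f(x) e^{-i k·x}`; it is used only for summable `f`. -/
def latticeFourier {d : ℕ} (f : ZSpace d → ℝ) (k : RSpace d) : ℂ :=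
  ∑' x : ZSpace d,
    (f x : ℂ) * Complex.exp (-(Complex.I * ((inner ℝ k (latticeVec x) : ℝ) : ℂ)))

/-- The convolution `(f * h)(x) = ∑_y f(x - y) h(y)`; it is used only for summable functions. -/
def latticeConv {d : ℕ} (f h : ZSpace d → ℝ) (x : ZSpace d) : ℝ :=
  ∑' y : ZSpace d, f (x - y) * h y

/-- The `ℓ^p` norm on `ℤ^d`, with values in `[0, ∞]`, for a real exponent `p`. -/
def latticeNorm {d : ℕ} (f : ZSpace d → ℝ) (p : ℝ) : ℝ≥0∞ :=
  eLpNorm f (ENNReal.ofReal p) Measure.count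

/-- The tilted susceptibility `χ^{(μ)} = ∑_x S(x) e^{μ·x}` of a non-negative function `S`,
with values in `[0, ∞]`. -/
def tiltedSusceptibility {d : ℕ} (S : ZSpace d → ℝ) (μ : RSpace d) : ℝ≥0∞ :=
  ∑' x : ZSpace d, ENNReal.ofReal (tilt μ S x)

/-- The set `Ω = {μ ∈ ℝ^d : χ^{(μ)} < ∞}`. -/
def omegaSet {d : ℕ} (S : ZSpace d → ℝ) : Set (RSpace d) :=
  {μ | tiltedSusceptibility S μ < ∞}

/-- The first standard basis vector, scaled by `t`. -/
def scaledE1 {d : ℕ} [NeZero d] (t : ℝ) : RSpace d :=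
  EuclideanSpace.single (0 : Fin d) t

/-- The mass `m_S = sup {t ≥ 0 : χ^{(t e₁)} < ∞}`. -/
def mass {d : ℕ} [NeZero d] (S : ZSpace d → ℝ) : ℝ :=
  sSup {t : ℝ | 0 ≤ t ∧ tiltedSusceptibility S (scaledE1 t) < ∞}

/-- The norm `|x|_S = (max_{μ ∈ closure Ω} μ·x) / m_S`, that is `(μ_x · x) / m_S` for any
maximiser `μ_x` of `μ ↦ μ·x` over the closure of `Ω` (see `normS_eq_of_isMaxOn`). -/
def normS {d : ℕ} [NeZero d] (S : ZSpace d → ℝ) (x : RSpace d) : ℝ :=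
  sSup ((fun μ : RSpace d => inner ℝ μ x) '' closure (omegaSet S)) / mass S

theorem normS_eq_of_isMaxOn {d : ℕ} [NeZero d] (S : ZSpace d → ℝ) (x μ : RSpace d)
    (hμ : μ ∈ closure (omegaSet S))
    (hmax : ∀ ν ∈ closure (omegaSet S), inner ℝ ν x ≤ inner ℝ μ x) :
    normS S x = inner ℝ μ x / mass S := by
  have h : IsGreatest ((fun ν : RSpace d => (inner ℝ ν x : ℝ)) '' closure (omegaSet S))
      (inner ℝ μ x) := by
    refine ⟨⟨μ, hμ, rfl⟩, ?_⟩
    rintro _ ⟨ν, hν, rfl⟩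
    exact hmax ν hν
  unfold normS
  rw [h.csSup_eq]

/-- The standing assumption on `S`: it is a non-negative `ℤ^d`-symmetric function, `Ω` is open
and contains `0`, and `Ω` omits some positive multiple of `e₁`. -/
structure DecayAssumption {d : ℕ} [NeZero d] (S : ZSpace d → ℝ) : Prop where
  nonneg : ∀ x, 0 ≤ S x
  symmetric : LatticeSymmetric S
  isOpen : IsOpen (omegaSet S)
  zero_mem : (0 : RSpace d) ∈ omegaSet S
  exists_notMem : ∃ t : ℝ, 0 < t ∧ scaledE1 t ∉ omegaSet S

/-- The exponent `p_d`: it is `2` if `d = 1`, and `d / (d - 2 + min ζ 2)` if `d ≥ 2`. -/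
def pExp (d : ℕ) (ζ : ℝ) : ℝ :=
  if d = 1 then 2 else (d : ℝ) / ((d : ℝ) - 2 + min ζ 2)

/-- The class of pairs `(Q, g)` of functions on `ℤ^d` that satisfy moment bounds with constant
`M` and the infrared bound with constant `K`. The torus is represented by `[-π, π]^d`. -/
structure MomentClass {d : ℕ} (M K ζ : ℝ) (Q g : ZSpace d → ℝ) : Prop where
  Q_norm : latticeNorm Q 1 ≤ ENNReal.ofReal M
  Q_moment : latticeNorm (fun y => ‖latticeVec y‖ ^ (2 + ζ) * Q y) 1 ≤ ENNReal.ofReal M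
  infrared : ∀ k : RSpace d, (∀ i, |k i| ≤ Real.pi) →
    K * ‖k‖ ^ 2 ≤ (latticeFourier Q 0 - latticeFourier Q k).re
  g_norm : latticeNorm g 1 ≤ ENNReal.ofReal M
  g_moment : latticeNorm (fun y => ‖latticeVec y‖ ^ ζ * g y) 1 ≤ ENNReal.ofReal M
  g_second : latticeNorm (fun y => ‖latticeVec y‖ ^ 2 * g y) (min (pExp d ζ) 2)
    ≤ ENNReal.ofReal M
  Q_high : 4 ≤ d →
    latticeNorm (fun y => ‖latticeVec y‖ ^ (d - 1) * Q y) (min ((d : ℝ) / 3) 2)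
      ≤ ENNReal.ofReal M
  g_high : 4 ≤ d →
    latticeNorm (fun y => ‖latticeVec y‖ ^ (d - 1) * g y) 2 ≤ ENNReal.ofReal M

/-- The standing assumption on the generalised Ornstein–Zernike equation `S = g + J * S`. -/
structure OZAssumption {d : ℕ} (M K ζ : ℝ) (S J g : ZSpace d → ℝ) : Prop where
  J_symmetric : LatticeSymmetric J
  g_symmetric : LatticeSymmetric g
  J_summable : Summable J
  g_summable : Summable g
  equation : ∀ x, S x = g x + latticeConv J S x
  tilts_mem : ∀ μ ∈ closure (omegaSet S), MomentClass M K ζ (tilt μ J) (tilt μ g)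
  g_pos : ∀ μ ∈ closure (omegaSet S), 0 < (latticeFourier (tilt μ g) 0).re

/-- All hypotheses of the crossover estimate: the two standing assumptions, and the lower bound
`1 / M` on the total mass of the tilt of `g` for every `μ` on the boundary of `Ω`. -/
structure CrossoverHypotheses {d : ℕ} [NeZero d] (M K ζ : ℝ) (S J g : ZSpace d → ℝ) : Prop where
  decay : DecayAssumption S
  oz : OZAssumption M K ζ S J g
  g_lower : ∀ μ ∈ frontier (omegaSet S), M⁻¹ ≤ (latticeFourier (tilt μ g) 0).re

end

noncomputable section

/-! ### Fourier analysis on the lattice -/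

/-! At a frontier point μ of Ω the tilted equation is critical: the tilt Q of J by μ has total mass
1 (`tsum_tilt_frontier`). The Fourier transform of the tilt of S is then formally ĝ(k)/(Q̂(0) -
Q̂(k)) = ∫₀^∞ ĝ(k) exp(-t(Q̂(0) - Q̂(k))) dt, with g tilted as well. Hence S(x) e^{μ·x} is the time
integral of `sourceKernel` (`mul_exp_eq_integral`). This is proved along the ray sμ, s ↑ 1, from
inside Ω, where the mass defect 1 - ∑ J^{(sμ)} > 0 acts as a killing rate. The integrand resembles
the law at x of a continuous-time walk with drift b = ∑ y Q(y). However, Q may be signed, so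
positivity of the kernel is not available and the bounds come from Fourier integrals and ℓ^p norms.

Choice of the tilt. Take μ to be a maximiser of μ·x over the closure of Ω, so that e^{-μ·x} is
exactly e^{-m_S|x|_S}. The function F(μ) = ∑ J^{(μ)} is constant on the frontier and has gradient b,
so b is normal to the frontier at μ, and x is a non-negative multiple of b
(`inner_nonpos_of_inner_drift_neg`, `norm_sub_smul_of_inner`). Symmetry of J and the infrared bound
along the segment from -μ to μ make |b| comparable to |μ|, hence to m_S (`inner_drift_ge`,
`norm_drift_le`). Thus |x - tb| = | |x| - t|b| |, and only a wave of speed β = |b| seen at distance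
X = |x| remains (`exists_diffusiveWave`).

Two kernel estimates, uniform in the class, are needed. The upper bound is t^{-d/2}(1 + |x -
tb|/√t)^{-a} for t ≥ 1, with a = max(2, d-1) (`heatKernel_bounds`, `sourceKernel_bound`). The jumps
of Q are cut at length √t: the short-range part has an exponentially decaying kernel by a small
extra tilt, while the long-range part, multiplied by t, has bounded ℓ¹ norm, so its convolution
exponential converges uniformly. The lower bound is a local central limit theorem with a relative
gain t^{-η/2} in the error (`re_sourceKernel_ge`).

Integration in time. If βX is bounded below, the mass sits near T = X/β in a window of width √T/β,
which gives T^{(3-d)/2}/X. If βX ≤ 1 and d > 2, times of order X² dominate and give X^{2-d}. For the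
lower bound, both the central limit error and the possible negative part are at most ε times a
profile with decay order a - 1/2, once X is large (`DiffusiveWave.pointwise_lower`); that profile
has an integral of the same order, so a small ε leaves the main term. Both regimes together give the
crossover formula. -/

/-- The character `e^{i k·x}`. -/
def chr {d : ℕ} (k : RSpace d) (x : ZSpace d) : ℂ :=
  Complex.exp (Complex.I * ((inner ℝ k (latticeVec x) : ℝ) : ℂ))

/-- The fundamental box `[-π, π]^d` of the torus. -/
def torusBox (d : ℕ) : Set (RSpace d) := {k | ∀ i, |k i| ≤ Real.pi}

/-- The inverse Fourier transform over the torus. -/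
def invFourier {d : ℕ} (F : RSpace d → ℂ) (x : ZSpace d) : ℂ :=
  ((2 * Real.pi : ℝ) : ℂ)⁻¹ ^ d * ∫ k in torusBox d, F k * chr k x

theorem inner_latticeVec {d : ℕ} (k : RSpace d) (x : ZSpace d) :
    inner ℝ k (latticeVec x) = ∑ i, k i * (x i : ℝ) := by
  simp [latticeVec, PiLp.inner_apply, mul_comm]

@[simp] theorem latticeVec_apply {d : ℕ} (x : ZSpace d) (i : Fin d) :
    latticeVec x i = (x i : ℝ) := rfl

@[simp] theorem latticeVec_zero {d : ℕ} : latticeVec (0 : ZSpace d) = 0 := by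
  ext i; simp

theorem latticeVec_add {d : ℕ} (x y : ZSpace d) :
    latticeVec (x + y) = latticeVec x + latticeVec y := by
  ext i; simp

theorem latticeVec_sub {d : ℕ} (x y : ZSpace d) :
    latticeVec (x - y) = latticeVec x - latticeVec y := by
  ext i; simp

theorem latticeVec_neg {d : ℕ} (x : ZSpace d) :
    latticeVec (-x) = -latticeVec x := by
  ext i; simp

theorem one_le_norm_latticeVec {d : ℕ} {x : ZSpace d} (hx : x ≠ 0) : 1 ≤ ‖latticeVec x‖ := by
  obtain ⟨i, hi⟩ := Function.ne_iff.mp hx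
  have h1 : |(x i : ℝ)| ≤ ‖latticeVec x‖ := by
    simpa using PiLp.norm_apply_le (latticeVec x) i
  have h2 : (1 : ℝ) ≤ |(x i : ℝ)| := by
    exact_mod_cast Int.one_le_abs hi
  linarith

@[simp] theorem norm_chr {d : ℕ} (k : RSpace d) (x : ZSpace d) : ‖chr k x‖ = 1 := by
  rw [chr, mul_comm]; exact Complex.norm_exp_ofReal_mul_I _

@[simp] theorem chr_zero_left {d : ℕ} (x : ZSpace d) : chr 0 x = 1 := by simp [chr]

theorem chr_add {d : ℕ} (k : RSpace d) (x y : ZSpace d) :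
    chr k (x + y) = chr k x * chr k y := by
  rw [chr, chr, chr, ← Complex.exp_add, latticeVec_add, inner_add_right]
  push_cast; ring_nf

theorem chr_sub {d : ℕ} (k : RSpace d) (x y : ZSpace d) :
    chr k (x - y) = chr k x * chr k (-y) := by
  rw [sub_eq_add_neg, chr_add]

theorem chr_neg_right {d : ℕ} (k : RSpace d) (x : ZSpace d) :
    chr k (-x) = Complex.exp (-(Complex.I * ((inner ℝ k (latticeVec x) : ℝ) : ℂ))) := by
  rw [chr, latticeVec_neg, inner_neg_right]; push_cast; ring_nf

theorem continuous_chr {d : ℕ} (x : ZSpace d) : Continuous fun k : RSpace d => chr k x := by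
  unfold chr; fun_prop

theorem latticeFourier_eq {d : ℕ} (f : ZSpace d → ℝ) (k : RSpace d) :
    latticeFourier f k = ∑' x, (f x : ℂ) * chr k (-x) := by
  simp only [latticeFourier, chr_neg_right]

theorem summable_fourier {d : ℕ} {f : ZSpace d → ℝ} (hf : Summable f) (k : RSpace d) :
    Summable fun x => (f x : ℂ) * chr k (-x) := by
  apply Summable.of_norm
  simpa using hf.abs

theorem hasSum_fourier {d : ℕ} {f : ZSpace d → ℝ} (hf : Summable f) (k : RSpace d) :
    HasSum (fun x => (f x : ℂ) * chr k (-x)) (latticeFourier f k) := by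
  rw [latticeFourier_eq]; exact (summable_fourier hf k).hasSum

theorem latticeFourier_zero {d : ℕ} (f : ZSpace d → ℝ) :
    latticeFourier f 0 = ((∑' x, f x : ℝ) : ℂ) := by
  rw [latticeFourier_eq, Complex.ofReal_tsum]; simp

theorem continuous_latticeFourier {d : ℕ} {f : ZSpace d → ℝ} (hf : Summable f) :
    Continuous (latticeFourier f) := by
  have h : latticeFourier f = fun k => ∑' x, (f x : ℂ) * chr k (-x) :=
    funext (latticeFourier_eq f)
  rw [h]
  exact continuous_tsum (fun x => continuous_const.mul (continuous_chr _)) hf.abs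
    (fun x k => by simp)

theorem norm_latticeFourier_le {d : ℕ} {f : ZSpace d → ℝ} (hf : Summable f) (k : RSpace d) :
    ‖latticeFourier f k‖ ≤ ∑' x, |f x| := by
  rw [latticeFourier_eq]
  refine tsum_of_norm_bounded hf.abs.hasSum (fun x => ?_)
  simp

theorem isCompact_torusBox (d : ℕ) : IsCompact (torusBox d) := by
  have h : torusBox d = (EuclideanSpace.equiv (Fin d) ℝ) ⁻¹'
      (Set.pi Set.univ fun _ => Set.Icc (-Real.pi) Real.pi) := by
    ext k
    simp only [torusBox, Set.mem_ofPred_eq, abs_le, Set.mem_preimage, Set.mem_pi, Set.mem_univ,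
      true_imp_iff, Set.mem_Icc]
    rfl
  rw [h]
  exact (EuclideanSpace.equiv (Fin d) ℝ).toHomeomorph.isCompact_preimage.mpr
    (isCompact_univ_pi fun _ => isCompact_Icc)

theorem measurableSet_torusBox (d : ℕ) : MeasurableSet (torusBox d) :=
  (isCompact_torusBox d).isClosed.measurableSet

theorem volume_torusBox_lt_top (d : ℕ) : volume (torusBox d) < ∞ :=
  (isCompact_torusBox d).measure_lt_top

theorem integrableOn_torusBox {d : ℕ} {F : RSpace d → ℂ} (hF : Continuous F) :
    IntegrableOn F (torusBox d) :=
  hF.continuousOn.integrableOn_compact (isCompact_torusBox d)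

theorem integral_exp_int_mul (n : ℤ) :
    ∫ u in Set.Icc (-Real.pi) Real.pi, Complex.exp (Complex.I * ((u * n : ℝ) : ℂ))
      = if n = 0 then ((2 * Real.pi : ℝ) : ℂ) else 0 := by
  rw [integral_Icc_eq_integral_Ioc, ← intervalIntegral.integral_of_le (by linarith [Real.pi_pos])]
  split_ifs with h
  · subst h; simp; ring
  · have hc : Complex.I * (n : ℂ) ≠ 0 := by simp [h]
    have := integral_exp_mul_complex (a := -Real.pi) (b := Real.pi) hc
    have e : ∀ u : ℝ, Complex.exp (Complex.I * ((u * n : ℝ) : ℂ))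
        = Complex.exp (Complex.I * (n : ℂ) * u) := by intro u; push_cast; ring_nf
    simp_rw [e, this]
    have h2 : Complex.exp (Complex.I * n * (Real.pi : ℝ))
        = Complex.exp (Complex.I * n * ((-Real.pi : ℝ) : ℂ)) := by
      rw [Complex.exp_eq_exp_iff_exists_int]
      exact ⟨n, by push_cast; ring⟩
    rw [h2]; simp

theorem integral_chr {d : ℕ} (x : ZSpace d) :
    ∫ k in torusBox d, chr k x = if x = 0 then ((2 * Real.pi : ℝ) : ℂ) ^ d else 0 := by
  have h1 : ∫ k in torusBox d, chr k x
      = ∫ v : Fin d → ℝ, ∏ i, (Set.Icc (-Real.pi) Real.pi).indicator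
          (fun u : ℝ => Complex.exp (Complex.I * ((u * (x i : ℤ) : ℝ) : ℂ))) (v i) := by
    rw [← integral_indicator (measurableSet_torusBox d),
      ← (PiLp.volume_preserving_toLp (Fin d)).integral_comp
      (MeasurableEquiv.toLp 2 _).measurableEmbedding]
    congr 1; ext v
    by_cases hv : WithLp.toLp 2 v ∈ torusBox d
    · rw [Set.indicator_of_mem hv]
      have hv' : ∀ i, v i ∈ Set.Icc (-Real.pi) Real.pi := fun i => abs_le.mp (hv i)
      rw [Finset.prod_congr rfl fun i _ => Set.indicator_of_mem (hv' i) _]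
      rw [← Complex.exp_sum, chr, inner_latticeVec, ← Finset.mul_sum]
      push_cast; rfl
    · rw [Set.indicator_of_notMem hv]
      simp only [torusBox, Set.mem_ofPred_eq, not_forall] at hv
      obtain ⟨i, hi⟩ := hv
      symm
      apply Finset.prod_eq_zero (Finset.mem_univ i)
      apply Set.indicator_of_notMem
      rwa [Set.mem_Icc, ← abs_le]
  rw [h1, integral_fintype_prod_volume_eq_prod
    (fun i => (Set.Icc (-Real.pi) Real.pi).indicator
          (fun u : ℝ => Complex.exp (Complex.I * ((u * (x i : ℤ) : ℝ) : ℂ))))]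
  simp_rw [integral_indicator measurableSet_Icc, integral_exp_int_mul]
  split_ifs with h
  · subst h; simp
  · obtain ⟨i, hi⟩ := Function.ne_iff.mp h
    apply Finset.prod_eq_zero (Finset.mem_univ i)
    rw [if_neg]; simpa using hi

theorem norm_invFourier_le_of_le {d : ℕ} {F : RSpace d → ℂ} {G : RSpace d → ℝ}
    (hG : IntegrableOn G (torusBox d)) (h : ∀ k ∈ torusBox d, ‖F k‖ ≤ G k) (x : ZSpace d) :
    ‖invFourier F x‖ ≤ (2 * Real.pi)⁻¹ ^ d * ∫ k in torusBox d, G k := by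
  unfold invFourier
  rw [norm_mul, norm_pow, norm_inv, Complex.norm_real, Real.norm_of_nonneg (by positivity)]
  gcongr
  refine norm_integral_le_of_norm_le hG ?_
  rw [ae_restrict_iff' (measurableSet_torusBox d)]
  exact Filter.Eventually.of_forall fun k hk => by simpa using h k hk

theorem hasSum_invFourier {d : ℕ} {ι : Type*} [Countable ι] {F : ι → RSpace d → ℂ}
    {B : ι → ℝ} (hB : Summable B) (hF : ∀ i, Continuous (F i)) {G : RSpace d → ℂ}
    (hb : ∀ i, ∀ k ∈ torusBox d, ‖F i k‖ ≤ B i)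
    (hs : ∀ k ∈ torusBox d, HasSum (fun i => F i k) (G k)) (x : ZSpace d) :
    HasSum (fun i => invFourier (F i) x) (invFourier G x) := by
  unfold invFourier
  apply HasSum.mul_left
  have hbox : ∀ᵐ k ∂(volume.restrict (torusBox d)), k ∈ torusBox d :=
    ae_restrict_mem (measurableSet_torusBox d)
  have : IsFiniteMeasure (volume.restrict (torusBox d)) :=
    ⟨by simpa using volume_torusBox_lt_top d⟩
  refine hasSum_integral_of_dominated_convergence (fun i _ => B i) (fun i => ?_) (fun i => ?_)
    ?_ ?_ ?_
  · exact ((hF i).mul (continuous_chr x)).aestronglyMeasurable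
  · filter_upwards [hbox] with k hk
    simpa using hb i k hk
  · exact Filter.Eventually.of_forall fun _ => hB
  · exact integrable_const _
  · filter_upwards [hbox] with k hk
    exact (hs k hk).mul_right _

theorem exists_bound_torusBox {d : ℕ} {F : RSpace d → ℂ} (hF : Continuous F) :
    ∃ C, 0 ≤ C ∧ ∀ k ∈ torusBox d, ‖F k‖ ≤ C := by
  obtain ⟨C, hC⟩ := (isCompact_torusBox d).exists_bound_of_continuousOn hF.continuousOn
  exact ⟨max C 0, le_max_right _ _, fun k hk => (hC k hk).trans (le_max_left _ _)⟩

/-- Multiplication by a Fourier transform becomes convolution. -/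
theorem hasSum_invFourier_mul {d : ℕ} {f : ZSpace d → ℝ} (hf : Summable f) {F : RSpace d → ℂ}
    (hF : Continuous F) (x : ZSpace d) :
    HasSum (fun y => (f y : ℂ) * invFourier F (x - y))
      (invFourier (fun k => latticeFourier f k * F k) x) := by
  obtain ⟨C, hC0, hC⟩ := exists_bound_torusBox hF
  have := hasSum_invFourier (F := fun y k => (f y : ℂ) * chr k (-y) * F k)
    (G := fun k => latticeFourier f k * F k) (B := fun y => |f y| * C) (hf.abs.mul_right C)
    (fun y => (continuous_const.mul (continuous_chr _)).mul hF)
    (fun y k hk => by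
      rw [norm_mul, norm_mul]; simp only [Complex.norm_real, Real.norm_eq_abs, norm_chr, mul_one]
      gcongr; exact hC k hk)
    (fun k _ => (hasSum_fourier hf k).mul_right _) x
  convert this using 2 with y
  unfold invFourier
  rw [mul_left_comm, ← integral_const_mul]
  congr 2; ext k; rw [chr_sub]; ring

theorem invFourier_one {d : ℕ} (x : ZSpace d) :
    invFourier (fun _ => 1) x = if x = 0 then 1 else 0 := by
  unfold invFourier
  simp only [one_mul]
  rw [integral_chr]
  split_ifs
  · rw [← mul_pow, inv_mul_cancel₀, one_pow]
    exact_mod_cast (by positivity : (2 * Real.pi) ≠ 0)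
  · simp

/-- The constant 1 is the transform of the delta function at 0, so inversion is the convolution rule
applied to that constant. -/
theorem invFourier_latticeFourier {d : ℕ} {f : ZSpace d → ℝ} (hf : Summable f) (x : ZSpace d) :
    invFourier (latticeFourier f) x = f x := by
  have h := hasSum_invFourier_mul hf (F := fun _ => 1) continuous_const x
  simp only [mul_one, invFourier_one] at h
  rw [← h.tsum_eq, tsum_eq_single x]
  · simp
  · intro y hy
    rw [if_neg]
    · simp
    · intro h0; exact hy (sub_eq_zero.mp h0).symm

/-! ### Sums over the lattice and Gaussian integrals -/

theorem hasSum_exp_neg_abs_int {δ : ℝ} (hδ : 0 < δ) :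
    HasSum (fun n : ℤ => Real.exp (-δ * |(n : ℝ)|))
      ((1 - Real.exp (-δ))⁻¹ + Real.exp (-δ) * (1 - Real.exp (-δ))⁻¹) := by
  have hq : Real.exp (-δ) < 1 := by rw [Real.exp_lt_one_iff]; linarith
  have hg := hasSum_geometric_of_lt_one (Real.exp_pos (-δ)).le hq
  apply HasSum.of_nat_of_neg_add_one
  · have e : ∀ n : ℕ, Real.exp (-δ * |(((n : ℤ)) : ℝ)|) = Real.exp (-δ) ^ n := fun n => by
      rw [← Real.exp_nat_mul]; congr 1; simp; ring
    simp only [e]; exact hg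
  · have e : ∀ n : ℕ, Real.exp (-δ * |((-((n : ℤ) + 1) : ℤ) : ℝ)|)
        = Real.exp (-δ) * Real.exp (-δ) ^ n := fun n => by
      rw [← Real.exp_nat_mul, ← Real.exp_add]; congr 1
      have : |((-((n : ℤ) + 1) : ℤ) : ℝ)| = n + 1 := by
        push_cast
        rw [abs_neg, abs_of_nonneg (by positivity)]
      rw [this]; ring
    simp only [e]; exact hg.mul_left _

/-- Replacing the centre by its integer part costs a factor e^δ and reduces to a two-sided geometric
series. The term δ⁻¹ is the width of the exponential; the bound is uniform in the centre. -/
theorem sum_exp_neg_abs_sub_le {δ : ℝ} (hδ : 0 < δ) (c : ℝ) (s : Finset ℤ) :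
    ∑ n ∈ s, Real.exp (-δ * |(n : ℝ) - c|) ≤ 2 * Real.exp δ * (1 + δ⁻¹) := by
  have hS := hasSum_exp_neg_abs_int hδ
  have hS' : HasSum (fun n : ℤ => Real.exp (-δ * |((n - ⌊c⌋ : ℤ) : ℝ)|))
      ((1 - Real.exp (-δ))⁻¹ + Real.exp (-δ) * (1 - Real.exp (-δ))⁻¹) :=
    (Equiv.subRight ⌊c⌋).hasSum_iff.mpr hS
  have h1 : ∀ n : ℤ, Real.exp (-δ * |(n : ℝ) - c|)
      ≤ Real.exp δ * Real.exp (-δ * |((n - ⌊c⌋ : ℤ) : ℝ)|) := by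
    intro n
    rw [← Real.exp_add, Real.exp_le_exp]
    have h2 : |((n - ⌊c⌋ : ℤ) : ℝ)| ≤ |(n : ℝ) - c| + 1 := by
      have : ((n - ⌊c⌋ : ℤ) : ℝ) = ((n : ℝ) - c) + (c - ⌊c⌋) := by push_cast; ring
      rw [this]
      refine (abs_add_le _ _).trans ?_
      gcongr
      rw [abs_le]
      constructor <;> linarith [Int.floor_le c, Int.lt_floor_add_one c]
    nlinarith
  have hpos : 0 < 1 - Real.exp (-δ) := by
    have : Real.exp (-δ) < 1 := by rw [Real.exp_lt_one_iff]; linarith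
    linarith
  have h3 : (1 - Real.exp (-δ))⁻¹ ≤ 1 + δ⁻¹ := by
    rw [inv_le_comm₀ hpos (by positivity)]
    have h4 : Real.exp (-δ) ≤ (1 + δ)⁻¹ := by
      rw [Real.exp_neg]
      gcongr
      linarith [Real.add_one_le_exp δ]
    have h5 : (1 + δ⁻¹)⁻¹ = 1 - (1 + δ)⁻¹ := by field_simp; ring
    linarith
  have h6 : Real.exp (-δ) ≤ 1 := by linarith
  calc ∑ n ∈ s, Real.exp (-δ * |(n : ℝ) - c|)
      ≤ ∑ n ∈ s, Real.exp δ * Real.exp (-δ * |((n - ⌊c⌋ : ℤ) : ℝ)|) :=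
        Finset.sum_le_sum fun n _ => h1 n
    _ ≤ Real.exp δ * ((1 - Real.exp (-δ))⁻¹ + Real.exp (-δ) * (1 - Real.exp (-δ))⁻¹) :=
        sum_le_hasSum _ (fun _ _ => by positivity) (hS'.mul_left _)
    _ ≤ Real.exp δ * ((1 + δ⁻¹) + 1 * (1 + δ⁻¹)) := by gcongr
    _ = _ := by ring

theorem norm_le_sum_abs {d : ℕ} (v : RSpace d) : ‖v‖ ≤ ∑ i, |v i| := by
  rw [EuclideanSpace.norm_eq, Real.sqrt_le_left (Finset.sum_nonneg fun _ _ => abs_nonneg _)]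
  simp only [Real.norm_eq_abs]
  exact Finset.sum_sq_le_sq_sum_of_nonneg fun _ _ => abs_nonneg _

theorem abs_apply_le_norm {d : ℕ} (v : RSpace d) (i : Fin d) : |v i| ≤ ‖v‖ := by
  simpa using PiLp.norm_apply_le v i

theorem sum_abs_le {d : ℕ} (v : RSpace d) : ∑ i, |v i| ≤ d * ‖v‖ := by
  refine (Finset.sum_le_sum fun i _ => abs_apply_le_norm v i).trans ?_
  simp

theorem lattice_exp_sum (d : ℕ) {ε : ℝ} (hε : 0 < ε) :
    ∃ C, 0 < C ∧ ∀ r : ℝ, 1 ≤ r → ∀ c : RSpace d, ∀ s : Finset (ZSpace d),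
      ∑ x ∈ s, Real.exp (-ε * ‖latticeVec x - c‖ / r) ≤ C * r ^ d := by
  classical
  -- The sum of the coordinates' absolute values is at most d times the norm, so this rate allows
  -- comparison with a product over coordinates. The `+ 1` avoids a division by zero when `d = 0`.
  set ε' := ε / (d + 1) with hε'
  have hε'0 : 0 < ε' := by positivity
  refine ⟨(2 * Real.exp ε' * (1 + ε'⁻¹)) ^ d, by positivity, fun r hr c s => ?_⟩
  have hr0 : 0 < r := by linarith
  have h1 : ∀ x : ZSpace d, Real.exp (-ε * ‖latticeVec x - c‖ / r)
      ≤ ∏ i, Real.exp (-(ε' / r) * |(x i : ℝ) - c i|) := by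
    intro x
    rw [← Real.exp_sum, Real.exp_le_exp, ← Finset.mul_sum]
    have h2 := sum_abs_le (latticeVec x - c)
    simp only [PiLp.sub_apply, latticeVec_apply] at h2
    have h3 : ε' * ∑ i, |(x i : ℝ) - c i| ≤ ε * ‖latticeVec x - c‖ := by
      have : ε' * ∑ i, |(x i : ℝ) - c i| ≤ ε' * ((d + 1) * ‖latticeVec x - c‖) := by
        gcongr; nlinarith [norm_nonneg (latticeVec x - c)]
      refine this.trans (le_of_eq ?_)
      rw [hε']; field_simp
    have h4 := div_le_div_of_nonneg_right h3 hr0.le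
    have e1 : -ε * ‖latticeVec x - c‖ / r = -(ε * ‖latticeVec x - c‖ / r) := by ring
    have e2 : -(ε' / r) * ∑ i, |(x i : ℝ) - c i| = -(ε' * (∑ i, |(x i : ℝ) - c i|) / r) := by ring
    rw [e1, e2]; linarith
  let T : Fin d → Finset ℤ := fun i => s.image fun x => x i
  have hsub : s ⊆ Fintype.piFinset T := by
    intro x hx
    rw [Fintype.mem_piFinset]
    intro i
    exact Finset.mem_image_of_mem (fun x : ZSpace d => x i) hx
  calc ∑ x ∈ s, Real.exp (-ε * ‖latticeVec x - c‖ / r)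
      ≤ ∑ x ∈ s, ∏ i, Real.exp (-(ε' / r) * |(x i : ℝ) - c i|) :=
        Finset.sum_le_sum fun x _ => h1 x
    _ ≤ ∑ x ∈ Fintype.piFinset T, ∏ i, Real.exp (-(ε' / r) * |(x i : ℝ) - c i|) :=
        Finset.sum_le_sum_of_subset_of_nonneg hsub
          (fun _ _ _ => Finset.prod_nonneg fun _ _ => (Real.exp_pos _).le)
    _ = ∏ i, ∑ n ∈ T i, Real.exp (-(ε' / r) * |(n : ℝ) - c i|) :=
        (Finset.prod_univ_sum T (fun i n => Real.exp (-(ε' / r) * |(n : ℝ) - c i|))).symm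
    _ ≤ ∏ _i : Fin d, (2 * Real.exp ε' * (1 + ε'⁻¹) * r) := by
        refine Finset.prod_le_prod (fun i _ => Finset.sum_nonneg fun _ _ => (Real.exp_pos _).le)
          (fun i _ => (sum_exp_neg_abs_sub_le (by positivity) _ _).trans ?_)
        have a1 : Real.exp (ε' / r) ≤ Real.exp ε' :=
          Real.exp_le_exp.mpr (div_le_self hε'0.le hr)
        have a2 : 1 + (ε' / r)⁻¹ ≤ (1 + ε'⁻¹) * r := by
          rw [inv_div, div_eq_mul_inv, add_mul]
          linarith [mul_comm r ε'⁻¹]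
        calc 2 * Real.exp (ε' / r) * (1 + (ε' / r)⁻¹)
            ≤ 2 * Real.exp ε' * ((1 + ε'⁻¹) * r) := by gcongr
          _ = _ := by ring
    _ = _ := by simp [mul_pow]

/-- Bound of a power by an exponential. -/
theorem pow_mul_exp_neg_le (n : ℕ) {ε y : ℝ} (hε : 0 < ε) (hy : 0 ≤ y) :
    y ^ n * Real.exp (-(ε * y)) ≤ (n.factorial : ℝ) / ε ^ n := by
  have h := Real.pow_div_factorial_le_exp (ε * y) (by positivity) n
  rw [Real.exp_neg, ← div_eq_mul_inv, div_le_div_iff₀ (Real.exp_pos _) (by positivity)]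
  rw [div_le_iff₀ (by positivity), mul_pow] at h
  nlinarith

theorem one_add_pow_mul_exp_neg_sq_le (n : ℕ) {K : ℝ} (hK : 0 < K) :
    ∃ C, 0 < C ∧ ∀ y : ℝ, 0 ≤ y →
      (1 + y) ^ n * Real.exp (-(K * y ^ 2)) ≤ C * Real.exp (-(K / 2 * y ^ 2)) := by
  refine ⟨(n.factorial : ℝ) / K ^ n * Real.exp (K + K / 2 * 1) * Real.exp K, by positivity,
    fun y hy => ?_⟩
  have h1 := pow_mul_exp_neg_le n hK (show (0 : ℝ) ≤ 1 + y by linarith)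
  have h2 : (1 + y) ^ n * Real.exp (-(K * y ^ 2))
      = (1 + y) ^ n * Real.exp (-(K * (1 + y))) * Real.exp (K * (1 + y) - K * y ^ 2) := by
    rw [mul_assoc, ← Real.exp_add]; congr 2; ring
  rw [h2]
  have h3 : Real.exp (K * (1 + y) - K * y ^ 2)
      ≤ Real.exp (K + K / 2 * 1) * Real.exp K * Real.exp (-(K / 2 * y ^ 2)) := by
    rw [← Real.exp_add, ← Real.exp_add, Real.exp_le_exp]
    nlinarith [sq_nonneg (y - 1), mul_nonneg hK.le (sq_nonneg (y - 1))]
  calc _ ≤ (n.factorial : ℝ) / K ^ n *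
        (Real.exp (K + K / 2 * 1) * Real.exp K * Real.exp (-(K / 2 * y ^ 2))) := by gcongr
    _ = _ := by ring

theorem integrable_exp_neg_mul_sq_norm {d : ℕ} {b : ℝ} (hb : 0 < b) :
    Integrable fun v : RSpace d => Real.exp (-(b * ‖v‖ ^ 2)) := by
  have := (GaussianFourier.integrable_cexp_neg_mul_sq_norm_add (V := RSpace d) (b := (b : ℂ))
    (by simpa using hb) 0 0).re
  refine this.congr (Filter.Eventually.of_forall fun v => ?_)
  have : (-(b : ℂ) * (‖v‖ : ℂ) ^ 2 + 0 * (inner ℝ (0 : RSpace d) v : ℝ))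
      = ((-(b * ‖v‖ ^ 2) : ℝ) : ℂ) := by push_cast; ring
  simp only [this]
  exact Complex.exp_ofReal_re _

/-- The substitution u = √τ k removes τ from the integrand, and its Jacobian is τ^{-d/2}. The case n
= 0 serves the upper bound, n = 3 the error in the local central limit theorem. -/
theorem gaussian_moment_scaling (d n : ℕ) {K : ℝ} (hK : 0 < K) :
    ∃ C, 0 < C ∧ ∀ τ : ℝ, 0 < τ →
      Integrable (fun k : RSpace d => (1 + √τ * ‖k‖) ^ n * Real.exp (-(τ * K * ‖k‖ ^ 2))) ∧
      ∫ k : RSpace d, (1 + √τ * ‖k‖) ^ n * Real.exp (-(τ * K * ‖k‖ ^ 2))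
        ≤ C * τ ^ (-(d : ℝ) / 2) := by
  obtain ⟨C, hC0, hC⟩ := one_add_pow_mul_exp_neg_sq_le n hK
  have hint : Integrable fun k : RSpace d => (1 + ‖k‖) ^ n * Real.exp (-(K * ‖k‖ ^ 2)) := by
    refine ((integrable_exp_neg_mul_sq_norm (d := d) (half_pos hK)).const_mul C).mono'
      (by fun_prop) (Filter.Eventually.of_forall fun k => ?_)
    rw [Real.norm_of_nonneg (by positivity)]
    exact hC _ (norm_nonneg _)
  refine ⟨(∫ k : RSpace d, (1 + ‖k‖) ^ n * Real.exp (-(K * ‖k‖ ^ 2))) + 1,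
    add_pos_of_nonneg_of_pos (integral_nonneg fun _ => by positivity) one_pos, fun τ hτ => ?_⟩
  have hs : 0 < √τ := Real.sqrt_pos.mpr hτ
  have e : (fun k : RSpace d => (1 + √τ * ‖k‖) ^ n * Real.exp (-(τ * K * ‖k‖ ^ 2)))
      = fun k => (fun u : RSpace d => (1 + ‖u‖) ^ n * Real.exp (-(K * ‖u‖ ^ 2))) (√τ • k) := by
    ext k
    simp only [norm_smul, Real.norm_of_nonneg hs.le, mul_pow, Real.sq_sqrt hτ.le]
    ring_nf
  rw [e]
  refine ⟨hint.comp_smul hs.ne', ?_⟩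
  rw [Measure.integral_comp_smul volume
    (fun u : RSpace d => (1 + ‖u‖) ^ n * Real.exp (-(K * ‖u‖ ^ 2))) √τ]
  simp only [finrank_euclideanSpace, Fintype.card_fin, smul_eq_mul]
  rw [abs_of_nonneg (by positivity)]
  have : (√τ ^ d)⁻¹ = τ ^ (-(d : ℝ) / 2) := by
    rw [Real.sqrt_eq_rpow, ← Real.rpow_natCast, ← Real.rpow_mul hτ.le, ← Real.rpow_neg hτ.le]
    congr 1; ring
  rw [this, mul_comm]
  gcongr
  linarith

theorem norm_sq_le_of_mem_torusBox {d : ℕ} {k : RSpace d} (hk : k ∈ torusBox d) :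
    ‖k‖ ^ 2 ≤ Real.pi ^ 2 * d := by
  rw [EuclideanSpace.norm_sq_eq]
  have : ∀ i ∈ Finset.univ, ‖k i‖ ^ 2 ≤ Real.pi ^ 2 := fun i _ => by
    have := hk i
    rw [Real.norm_eq_abs]; gcongr
  refine (Finset.sum_le_sum this).trans (le_of_eq ?_)
  simp [mul_comm]

/-- On the box, a Gaussian with a small time is comparable to one with time at least one. -/
theorem exp_neg_le_on_torusBox {d : ℕ} {K t : ℝ} (hK : 0 < K) (ht : 0 < t) {k : RSpace d}
    (hk : k ∈ torusBox d) :
    Real.exp (-(t * K * ‖k‖ ^ 2))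
      ≤ Real.exp (K * (Real.pi ^ 2 * d)) * Real.exp (-(max t 1 * K * ‖k‖ ^ 2)) := by
  rw [← Real.exp_add, Real.exp_le_exp]
  have h := norm_sq_le_of_mem_torusBox hk
  have h0 : 0 ≤ K * (Real.pi ^ 2 * d) := by positivity
  rcases le_total t 1 with h1 | h1
  · rw [max_eq_right h1]
    nlinarith [mul_le_mul_of_nonneg_left h hK.le, mul_nonneg (mul_nonneg ht.le hK.le)
      (sq_nonneg ‖k‖)]
  · rw [max_eq_left h1]; linarith

/-- Pairing of a function in `ℓ^p` with a bounded summable function. -/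
theorem tsum_mul_le_pairing {ι : Type*} {f u : ι → ℝ} {p N A L : ℝ} (hp : 1 ≤ p)
    (hN : 0 ≤ N) (hA : 0 ≤ A)
    (hf0 : ∀ i, 0 ≤ f i) (hu0 : ∀ i, 0 ≤ u i) (hf : Summable fun i => f i ^ p)
    (hfN : ∑' i, f i ^ p ≤ N ^ p) (huA : ∀ i, u i ≤ A) (hu : Summable u) (huL : ∑' i, u i ≤ L) :
    Summable (fun i => f i * u i) ∧
      ∑' i, f i * u i ≤ N * (A ^ (1 / p) * L ^ (1 - 1 / p)) := by
  have hL : 0 ≤ L := (tsum_nonneg hu0).trans huL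
  rcases hp.eq_or_lt with rfl | hp
  · simp only [Real.rpow_one] at hf hfN
    have hs : Summable fun i => f i * u i :=
      Summable.of_nonneg_of_le (fun i => mul_nonneg (hf0 i) (hu0 i))
        (fun i => mul_le_mul_of_nonneg_left (huA i) (hf0 i)) (hf.mul_right A)
    refine ⟨hs, ?_⟩
    calc ∑' i, f i * u i ≤ ∑' i, f i * A :=
          hs.tsum_le_tsum (fun i => mul_le_mul_of_nonneg_left (huA i) (hf0 i)) (hf.mul_right A)
      _ = (∑' i, f i) * A := tsum_mul_right
      _ ≤ N * A := by gcongr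
      _ = _ := by simp
  · have hpq := Real.HolderConjugate.conjExponent hp
    set q := p.conjExponent
    have hq1 : 1 < q := hpq.symm.lt
    have hq0 : 0 < q := by linarith
    -- Interpolation between ℓ^∞ and ℓ¹: the ℓ^q norm of `u` is controlled by its sup bound `A` and
    -- its sum `L`, and Hölder's inequality then finishes.
    have e1 : ∀ i, u i ^ q ≤ A ^ (q - 1) * u i := by
      intro i
      have : u i ^ q = u i ^ (q - 1) * u i := by
        rcases (hu0 i).eq_or_lt with h | h
        · rw [← h, Real.zero_rpow hq0.ne', mul_zero]
        · rw [← Real.rpow_add_one h.ne', sub_add_cancel]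
      rw [this]
      exact mul_le_mul_of_nonneg_right
        (Real.rpow_le_rpow (hu0 i) (huA i) (by linarith)) (hu0 i)
    have hsq : Summable fun i => u i ^ q :=
      Summable.of_nonneg_of_le (fun i => Real.rpow_nonneg (hu0 i) _) e1 (hu.mul_left _)
    obtain ⟨h1, h2⟩ := Real.summable_and_inner_le_Lp_mul_Lq_tsum_of_nonneg hpq hf0 hu0 hf hsq
    refine ⟨h1, h2.trans ?_⟩
    have h3 : (∑' i, f i ^ p) ^ (1 / p) ≤ N := by
      calc (∑' i, f i ^ p) ^ (1 / p) ≤ (N ^ p) ^ (1 / p) := by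
            gcongr
            exact tsum_nonneg fun i => Real.rpow_nonneg (hf0 i) _
        _ = N := by rw [← Real.rpow_mul hN, mul_one_div_cancel (by linarith), Real.rpow_one]
    have h4 : (∑' i, u i ^ q) ^ (1 / q) ≤ A ^ (1 / p) * L ^ (1 - 1 / p) := by
      have e2 : ∑' i, u i ^ q ≤ A ^ (q - 1) * L := by
        calc ∑' i, u i ^ q ≤ ∑' i, A ^ (q - 1) * u i := hsq.tsum_le_tsum e1 (hu.mul_left _)
          _ = A ^ (q - 1) * ∑' i, u i := tsum_mul_left
          _ ≤ _ := by gcongr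
      have e3 : 1 / q = 1 - 1 / p := by
        have := hpq.inv_add_inv_eq_one
        rw [one_div, one_div]; linarith
      calc (∑' i, u i ^ q) ^ (1 / q) ≤ (A ^ (q - 1) * L) ^ (1 / q) := by
            gcongr
            exact tsum_nonneg fun i => Real.rpow_nonneg (hu0 i) _
        _ = A ^ ((q - 1) * (1 / q)) * L ^ (1 / q) := by
            rw [Real.mul_rpow (by positivity) hL, ← Real.rpow_mul hA]
        _ = _ := by
            rw [← e3]; congr 2
            have : 1 / p = 1 - 1 / q := by linarith
            rw [this]; field_simp
    exact mul_le_mul h3 h4 (Real.rpow_nonneg (tsum_nonneg fun i => Real.rpow_nonneg (hu0 i) _) _) hN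

/-! ### The continuous-time kernel generated by a summable function -/

/-- The drift `∑_y y Q(y)`. -/
def drift {d : ℕ} (Q : ZSpace d → ℝ) : RSpace d := ∑' y, Q y • latticeVec y

/-- The kernel whose Fourier transform is `exp(-t(Q̂(0) - Q̂(k)))`. -/
def heatKernel {d : ℕ} (Q : ZSpace d → ℝ) (t : ℝ) (x : ZSpace d) : ℂ :=
  invFourier (fun k => Complex.exp (t * (latticeFourier Q k - latticeFourier Q 0))) x

theorem continuous_heat {d : ℕ} {Q : ZSpace d → ℝ} (hQ : Summable Q) (t : ℝ) :
    Continuous fun k => Complex.exp (t * (latticeFourier Q k - latticeFourier Q 0)) := by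
  have := continuous_latticeFourier hQ
  fun_prop

theorem chr_neg_re {d : ℕ} (k : RSpace d) (y : ZSpace d) :
    (chr k (-y)).re = Real.cos (inner ℝ k (latticeVec y)) := by
  rw [chr, latticeVec_neg, inner_neg_right, mul_comm, Complex.exp_ofReal_mul_I_re, Real.cos_neg]

theorem hasSum_re_fourier_sub {d : ℕ} {Q : ZSpace d → ℝ} (hQ : Summable Q) (k : RSpace d) :
    HasSum (fun y => Q y * (1 - Real.cos (inner ℝ k (latticeVec y))))
      (latticeFourier Q 0 - latticeFourier Q k).re := by
  have h := Complex.hasSum_re ((hasSum_fourier hQ 0).sub (hasSum_fourier hQ k))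
  convert h using 2 with y
  rw [← mul_sub, Complex.re_ofReal_mul, Complex.sub_re, chr_neg_re, chr_neg_re]
  simp

theorem hasSum_of_eq {ι E : Type*} [AddCommMonoid E] [TopologicalSpace E] {f g : ι → E} {a b : E}
    (h : HasSum f a) (hfg : ∀ i, g i = f i) (hab : b = a) : HasSum g b := by
  rw [hab, funext hfg]; exact h

theorem invFourier_const_mul {d : ℕ} (c : ℂ) (F : RSpace d → ℂ) (x : ZSpace d) :
    invFourier (fun k => c * F k) x = c * invFourier F x := by
  unfold invFourier
  simp only [mul_assoc]
  rw [integral_const_mul]; ring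

/-- Expanding only in powers of Q̂ writes the kernel as a series of convolution powers of Q. In this
form the effect of an exponential tilt can be read off termwise, with no shift of integration
contour. -/
theorem hasSum_heatKernel {d : ℕ} {Q : ZSpace d → ℝ} (hQ : Summable Q) (t : ℝ) (x : ZSpace d) :
    HasSum (fun n : ℕ => Complex.exp (-(t * latticeFourier Q 0)) * ((t : ℂ) ^ n / n.factorial) *
      invFourier (fun k => latticeFourier Q k ^ n) x) (heatKernel Q t x) := by
  set N := ∑' y, |Q y|
  have hcont := continuous_latticeFourier hQ
  have := hasSum_invFourier
    (F := fun (n : ℕ) k => Complex.exp (-(t * latticeFourier Q 0)) *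
      ((t : ℂ) ^ n / n.factorial) * latticeFourier Q k ^ n)
    (G := fun k => Complex.exp (t * (latticeFourier Q k - latticeFourier Q 0)))
    (B := fun n => ‖Complex.exp (-(t * latticeFourier Q 0))‖ * ((|t| * N) ^ n / n.factorial))
    ((Real.summable_pow_div_factorial _).mul_left _)
    (fun n => by fun_prop)
    (fun n k _ => by
      rw [norm_mul, norm_mul, norm_div, norm_pow, norm_pow]
      simp only [Complex.norm_real, Real.norm_eq_abs, Complex.norm_natCast]
      rw [mul_assoc]
      gcongr
      rw [mul_pow, div_mul_eq_mul_div]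
      gcongr
      exact norm_latticeFourier_le hQ k)
    (fun k _ => by
      have h := (NormedSpace.expSeries_div_hasSum_exp ((t : ℂ) * latticeFourier Q k)).mul_left
        (Complex.exp (-(t * latticeFourier Q 0)))
      rw [← Complex.exp_eq_exp_ℂ, ← Complex.exp_add] at h
      exact hasSum_of_eq h (fun n => by rw [mul_pow]; ring) (by ring_nf)) x
  exact hasSum_of_eq this (fun n => (invFourier_const_mul _ _ _).symm) rfl

theorem hasSum_invFourier_pow_succ {d : ℕ} {Q : ZSpace d → ℝ} (hQ : Summable Q) (n : ℕ)
    (x : ZSpace d) :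
    HasSum (fun y => (Q y : ℂ) * invFourier (fun k => latticeFourier Q k ^ n) (x - y))
      (invFourier (fun k => latticeFourier Q k ^ (n + 1)) x) := by
  have hcont := continuous_latticeFourier hQ
  have := hasSum_invFourier_mul hQ (F := fun k => latticeFourier Q k ^ n) (by fun_prop) x
  simpa only [pow_succ'] using this

theorem invFourier_pow_tilt {d : ℕ} {Q : ZSpace d → ℝ} (l : RSpace d) (hQ : Summable Q)
    (hQl : Summable (tilt l Q)) (n : ℕ) (x : ZSpace d) :
    invFourier (fun k => latticeFourier (tilt l Q) k ^ n) x
      = invFourier (fun k => latticeFourier Q k ^ n) x * Real.exp (inner ℝ l (latticeVec x)) := by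
  induction n generalizing x with
  | zero =>
    simp only [pow_zero, invFourier_one]
    split_ifs with h
    · subst h; simp
    · simp
  | succ n ih =>
    rw [← (hasSum_invFourier_pow_succ hQl n x).tsum_eq,
      ← (hasSum_invFourier_pow_succ hQ n x).tsum_eq, ← tsum_mul_right]
    congr 1; ext y
    rw [ih, tilt, latticeVec_sub, inner_sub_right, Real.exp_sub]
    have := (Real.exp_pos (inner ℝ l (latticeVec y))).ne'
    push_cast
    field_simp

/-- Multiplication by e^{l·x} is a homomorphism for convolution, so it acts on each convolution
power of Q separately. The exponential prefactor accounts for the change of total mass in the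
normalisation. -/
theorem heatKernel_tilt {d : ℕ} {Q : ZSpace d → ℝ} (l : RSpace d) (hQ : Summable Q)
    (hQl : Summable (tilt l Q)) (t : ℝ) (x : ZSpace d) :
    heatKernel Q t x * Real.exp (inner ℝ l (latticeVec x))
      = Complex.exp (t * (latticeFourier (tilt l Q) 0 - latticeFourier Q 0))
        * heatKernel (tilt l Q) t x := by
  have h1 := (hasSum_heatKernel hQ t x).mul_right
    ((Real.exp (inner ℝ l (latticeVec x)) : ℝ) : ℂ)
  have h2 := (hasSum_heatKernel hQl t x).mul_left
    (Complex.exp (t * (latticeFourier (tilt l Q) 0 - latticeFourier Q 0)))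
  refine h1.unique ?_
  convert h2 using 2 with n
  rw [invFourier_pow_tilt l hQ hQl]
  have : Complex.exp (-(t * latticeFourier Q 0))
      = Complex.exp (t * (latticeFourier (tilt l Q) 0 - latticeFourier Q 0))
        * Complex.exp (-(t * latticeFourier (tilt l Q) 0)) := by
    rw [← Complex.exp_add]; ring_nf
  rw [this]; ring

theorem norm_heat {d : ℕ} (Q : ZSpace d → ℝ) (t : ℝ) (k : RSpace d) :
    ‖Complex.exp (t * (latticeFourier Q k - latticeFourier Q 0))‖
      = Real.exp (-(t * (latticeFourier Q 0 - latticeFourier Q k).re)) := by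
  rw [Complex.norm_exp, Complex.re_ofReal_mul]
  congr 1
  simp only [Complex.sub_re]; ring

/-- The infrared bound is required only up to an additive error D after multiplication by t, because
it will be applied to truncated and tilted generators, for which the exact bound fails. -/
theorem norm_heatKernel_le (d : ℕ) {K : ℝ} (hK : 0 < K) :
    ∃ C, 0 < C ∧ ∀ (D t : ℝ) (Q : ZSpace d → ℝ), 0 < t →
      (∀ k ∈ torusBox d, t * K * ‖k‖ ^ 2 - D
        ≤ t * (latticeFourier Q 0 - latticeFourier Q k).re) →
      ∀ x, ‖heatKernel Q t x‖ ≤ C * Real.exp D * max t 1 ^ (-(d : ℝ) / 2) := by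
  obtain ⟨C, hC0, hC⟩ := gaussian_moment_scaling d 0 hK
  refine ⟨(2 * Real.pi)⁻¹ ^ d * (Real.exp (K * (Real.pi ^ 2 * d)) * C), by positivity,
    fun D t Q ht h x => ?_⟩
  set τ := max t 1
  have hτ : 0 < τ := lt_max_of_lt_right one_pos
  obtain ⟨hi, hle⟩ := hC τ hτ
  simp only [pow_zero, one_mul] at hi hle
  have hi' : Integrable fun k : RSpace d => Real.exp D * Real.exp (K * (Real.pi ^ 2 * d)) *
      Real.exp (-(τ * K * ‖k‖ ^ 2)) := hi.const_mul _
  refine (norm_invFourier_le_of_le (G := fun k => Real.exp D * Real.exp (K * (Real.pi ^ 2 * d)) *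
      Real.exp (-(τ * K * ‖k‖ ^ 2))) hi'.integrableOn (fun k hk => ?_) x).trans ?_
  · rw [norm_heat, mul_assoc]
    calc _ ≤ Real.exp D * Real.exp (-(t * K * ‖k‖ ^ 2)) := by
          rw [← Real.exp_add, Real.exp_le_exp]; linarith [h k hk]
      _ ≤ _ := by gcongr; exact exp_neg_le_on_torusBox hK ht hk
  · calc _ ≤ (2 * Real.pi)⁻¹ ^ d * ∫ k : RSpace d, Real.exp D *
          Real.exp (K * (Real.pi ^ 2 * d)) * Real.exp (-(τ * K * ‖k‖ ^ 2)) := by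
          refine mul_le_mul_of_nonneg_left ?_ (by positivity)
          exact setIntegral_le_integral hi' (Filter.Eventually.of_forall fun k => by positivity)
      _ ≤ (2 * Real.pi)⁻¹ ^ d * (Real.exp D * Real.exp (K * (Real.pi ^ 2 * d))
          * (C * τ ^ (-(d : ℝ) / 2))) := by
          rw [integral_const_mul]; gcongr
      _ = _ := by ring

theorem inner_drift {d : ℕ} {Q : ZSpace d → ℝ}
    (hQ : Summable fun y => ‖latticeVec y‖ * |Q y|) (l : RSpace d) :
    HasSum (fun y => Q y * inner ℝ l (latticeVec y)) (inner ℝ l (drift Q)) := by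
  have h : Summable fun y => Q y • latticeVec y := by
    apply Summable.of_norm
    simpa [norm_smul, mul_comm] using hQ
  have := h.hasSum.mapL (innerSL ℝ l)
  simpa [drift, inner_smul_right] using this

theorem norm_mul_abs_le_sq {d : ℕ} (Q : ZSpace d → ℝ) (y : ZSpace d) :
    ‖latticeVec y‖ * |Q y| ≤ ‖latticeVec y‖ ^ 2 * |Q y| := by
  gcongr
  by_cases h : y = 0
  · subst h; simp
  · have := one_le_norm_latticeVec h
    nlinarith

theorem summable_norm_mul {d : ℕ} {Q : ZSpace d → ℝ}
    (hQ : Summable fun y => ‖latticeVec y‖ ^ 2 * |Q y|) :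
    Summable fun y => ‖latticeVec y‖ * |Q y| :=
  Summable.of_nonneg_of_le (fun y => by positivity) (norm_mul_abs_le_sq Q) hQ

/-- Exponential decay of the kernel generated by a function of range `√(max t 1)`. -/
theorem norm_heatKernel_le_exp (d : ℕ) {M K D : ℝ} (hM : 0 < M) (hK : 0 < K) :
    ∃ C ε, 0 < C ∧ 0 < ε ∧ ∀ (t : ℝ) (Q : ZSpace d → ℝ), 0 < t → Summable Q →
      Summable (fun y => ‖latticeVec y‖ ^ 2 * |Q y|) →
      ∑' y, ‖latticeVec y‖ ^ 2 * |Q y| ≤ M →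
      (∀ y, Q y ≠ 0 → ‖latticeVec y‖ ≤ √(max t 1)) →
      (∀ k ∈ torusBox d, t * K * ‖k‖ ^ 2 - D
        ≤ t * (latticeFourier Q 0 - latticeFourier Q k).re) →
      ∀ x, ‖heatKernel Q t x‖ ≤ C * max t 1 ^ (-(d : ℝ) / 2)
        * Real.exp (-ε * ‖latticeVec x - t • drift Q‖ / √(max t 1)) := by
  obtain ⟨C, hC0, hC⟩ := norm_heatKernel_le d (half_pos hK)
  -- `ε ≤ 1` permits the Taylor bounds for the exponential, and `ε * M ≤ K / 2` means that the extra
  -- tilt costs at most half of the infrared constant.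
  set ε := min 1 (K / (2 * M)) with hε
  have hε0 : 0 < ε := lt_min one_pos (by positivity)
  have hε1 : ε ≤ 1 := min_le_left _ _
  have hεM : ε * M ≤ K / 2 := by
    calc ε * M ≤ K / (2 * M) * M := by gcongr; exact min_le_right _ _
      _ = _ := by field_simp
  refine ⟨C * Real.exp D * Real.exp M, ε, by positivity, hε0,
    fun t Q ht hQ hQ2 hQM hsupp hre x => ?_⟩
  set τ := max t 1 with hτdef
  have hτ : 0 < τ := lt_max_of_lt_right one_pos
  have htτ : t ≤ τ := le_max_left _ _
  have hs : 0 < √τ := Real.sqrt_pos.mpr hτ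
  set z := latticeVec x - t • drift Q with hz
  -- A tilt of length ε/√τ in the direction of `z` gains the factor exp(-ε‖z‖/√τ), while l·y stays
  -- within [-ε, ε] on the support of Q. For `z = 0`, division by zero makes `l` vanish, as desired.
  set l : RSpace d := (ε / (√τ * ‖z‖)) • z with hl
  have hlz : inner ℝ l z = ε * ‖z‖ / √τ := by
    rw [hl, real_inner_smul_left, real_inner_self_eq_norm_sq]
    rcases eq_or_ne ‖z‖ 0 with h | h
    · simp [h]
    · field_simp
  have hln : ‖l‖ ≤ ε / √τ := by
    rw [hl, norm_smul, Real.norm_of_nonneg (by positivity)]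
    rcases eq_or_ne ‖z‖ 0 with h | h
    · simp [h]; positivity
    · rw [div_mul_eq_mul_div, mul_comm √τ, mul_div_mul_comm, mul_comm, ]
      apply le_of_eq; field_simp
  have hu : ∀ y, Q y ≠ 0 → |inner ℝ l (latticeVec y)| ≤ ε := by
    intro y hy
    calc |inner ℝ l (latticeVec y)| ≤ ‖l‖ * ‖latticeVec y‖ := abs_real_inner_le_norm _ _
      _ ≤ ε / √τ * √τ := by gcongr; exact hsupp y hy
      _ = ε := by field_simp
  have hu2 : ∀ y, (inner ℝ l (latticeVec y)) ^ 2 ≤ ε ^ 2 / τ * ‖latticeVec y‖ ^ 2 := by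
    intro y
    rw [← sq_abs]
    calc |inner ℝ l (latticeVec y)| ^ 2 ≤ (‖l‖ * ‖latticeVec y‖) ^ 2 := by
          gcongr; exact abs_real_inner_le_norm _ _
      _ ≤ (ε / √τ * ‖latticeVec y‖) ^ 2 := by gcongr
      _ = _ := by rw [mul_pow, div_pow, Real.sq_sqrt hτ.le]
  have hQl : Summable (tilt l Q) := by
    refine Summable.of_norm_bounded (hQ.abs.mul_right (Real.exp ε)) fun y => ?_
    rw [tilt, norm_mul, Real.norm_eq_abs, Real.norm_of_nonneg (Real.exp_pos _).le]
    by_cases hy : Q y = 0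
    · simp [hy]
    · gcongr
      exact (le_abs_self _).trans (hu y hy)
  have hS1 := summable_norm_mul hQ2
  -- the total mass of the tilted function
  have hmass : t * (∑' y, tilt l Q y - ∑' y, Q y) ≤ inner ℝ l (t • drift Q) + M := by
    have h1 : HasSum (fun y => tilt l Q y - Q y - Q y * inner ℝ l (latticeVec y))
        (∑' y, tilt l Q y - ∑' y, Q y - inner ℝ l (drift Q)) :=
      (hQl.hasSum.sub hQ.hasSum).sub (inner_drift hS1 l)
    have h2 : ∑' y, tilt l Q y - ∑' y, Q y - inner ℝ l (drift Q) ≤ ε ^ 2 / τ * M := by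
      refine (hasSum_le (fun y => ?_) h1 (hQ2.mul_left (ε ^ 2 / τ)).hasSum).trans ?_
      · by_cases hy : Q y = 0
        · simp [hy, tilt]
        · have h3 := Real.abs_exp_sub_one_sub_id_le ((hu y hy).trans hε1)
          calc tilt l Q y - Q y - Q y * inner ℝ l (latticeVec y)
              = Q y * (Real.exp (inner ℝ l (latticeVec y)) - 1 - inner ℝ l (latticeVec y)) := by
                rw [tilt]; ring
            _ ≤ |Q y| * |Real.exp (inner ℝ l (latticeVec y)) - 1 - inner ℝ l (latticeVec y)| := by
                rw [← abs_mul]; exact le_abs_self _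
            _ ≤ |Q y| * (ε ^ 2 / τ * ‖latticeVec y‖ ^ 2) := by
                gcongr; exact h3.trans (hu2 y)
            _ = _ := by ring
      · rw [tsum_mul_left]; gcongr
    have h4 : t * (ε ^ 2 / τ * M) ≤ M := by
      have h5 : t / τ ≤ 1 := (div_le_one hτ).mpr htτ
      have h6 : ε ^ 2 ≤ 1 := by nlinarith
      calc t * (ε ^ 2 / τ * M) = (t / τ) * ε ^ 2 * M := by ring
        _ ≤ 1 * 1 * M := by gcongr
        _ = M := by ring
    rw [real_inner_smul_right]
    nlinarith [mul_le_mul_of_nonneg_left h2 ht.le]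
  -- The real part of the symbol changes by ∑ Q(y)(1 - e^{l·y})(1 - cos(k·y)). The two factors are
  -- at most 2ε and ‖k‖²‖y‖²/2, so the change is at most ε M ‖k‖².
  have hre' : ∀ k ∈ torusBox d, t * (K / 2) * ‖k‖ ^ 2 - D
      ≤ t * (latticeFourier (tilt l Q) 0 - latticeFourier (tilt l Q) k).re := by
    intro k hk
    have h1 := (hasSum_re_fourier_sub hQ k).sub (hasSum_re_fourier_sub hQl k)
    have h2 : (latticeFourier Q 0 - latticeFourier Q k).re
        - (latticeFourier (tilt l Q) 0 - latticeFourier (tilt l Q) k).re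
        ≤ ε * ‖k‖ ^ 2 * M := by
      refine (hasSum_le (fun y => ?_) h1 (hQ2.mul_left (ε * ‖k‖ ^ 2)).hasSum).trans ?_
      · by_cases hy : Q y = 0
        · simp [hy, tilt]
        · have h3 : |1 - Real.exp (inner ℝ l (latticeVec y))| ≤ 2 * ε := by
            rw [abs_sub_comm]
            exact (Real.abs_exp_sub_one_le ((hu y hy).trans hε1)).trans
              (by linarith [hu y hy])
          have h4 : 1 - Real.cos (inner ℝ k (latticeVec y)) ≤ ‖k‖ ^ 2 * ‖latticeVec y‖ ^ 2 / 2 := by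
            have h5 := Real.one_sub_sq_div_two_le_cos (x := inner ℝ k (latticeVec y))
            have h6 : (inner ℝ k (latticeVec y)) ^ 2 ≤ (‖k‖ * ‖latticeVec y‖) ^ 2 := by
              rw [← sq_abs]; gcongr; exact abs_real_inner_le_norm _ _
            nlinarith
          have h7 : 0 ≤ 1 - Real.cos (inner ℝ k (latticeVec y)) := by
            linarith [Real.cos_le_one (inner ℝ k (latticeVec y))]
          calc _ = Q y * (1 - Real.exp (inner ℝ l (latticeVec y)))
                * (1 - Real.cos (inner ℝ k (latticeVec y))) := by rw [tilt]; ring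
            _ ≤ |Q y| * |1 - Real.exp (inner ℝ l (latticeVec y))|
                * (1 - Real.cos (inner ℝ k (latticeVec y))) := by
                rw [← abs_mul]; gcongr; exact le_abs_self _
            _ ≤ |Q y| * (2 * ε) * (‖k‖ ^ 2 * ‖latticeVec y‖ ^ 2 / 2) := by gcongr
            _ = _ := by ring
      · rw [tsum_mul_left]; gcongr
    have h8 : ε * ‖k‖ ^ 2 * M ≤ K / 2 * ‖k‖ ^ 2 := by nlinarith [sq_nonneg ‖k‖]
    nlinarith [hre k hk, mul_le_mul_of_nonneg_left (h2.trans h8) ht.le]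
  have hmain := hC D t (tilt l Q) ht hre' x
  have heq := congrArg norm (heatKernel_tilt l hQ hQl t x)
  rw [norm_mul, norm_mul, Complex.norm_real, Real.norm_of_nonneg (Real.exp_pos _).le,
    latticeFourier_zero, latticeFourier_zero, ← Complex.ofReal_sub, ← Complex.ofReal_mul,
    Complex.norm_exp_ofReal] at heq
  have hsplit : ‖heatKernel Q t x‖ = Real.exp (t * (∑' y, tilt l Q y - ∑' y, Q y)
      - inner ℝ l (latticeVec x)) * ‖heatKernel (tilt l Q) t x‖ := by
    rw [Real.exp_sub, div_mul_eq_mul_div, ← heq, mul_div_cancel_right₀ _ (Real.exp_pos _).ne']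
  rw [hsplit]
  have hexp : t * (∑' y, tilt l Q y - ∑' y, Q y) - inner ℝ l (latticeVec x)
      ≤ M + -ε * ‖z‖ / √τ := by
    have : inner ℝ l (latticeVec x) = ε * ‖z‖ / √τ + inner ℝ l (t • drift Q) := by
      rw [← hlz, hz, inner_sub_right]; ring
    rw [this]
    have e : -ε * ‖z‖ / √τ = -(ε * ‖z‖ / √τ) := by ring
    rw [e]; linarith
  calc _ ≤ Real.exp (M + -ε * ‖z‖ / √τ) * (C * Real.exp D * τ ^ (-(d : ℝ) / 2)) := by
        gcongr
    _ = _ := by rw [Real.exp_add]; ring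

/-! ### Uniform decay of the kernel -/

/-- Quantitative assumptions on the generator of a kernel: summability, `2 + η` moments, an
`ℓ^p` bound for the moment of order `a`, and the infrared bound. -/
structure KernelClass {d : ℕ} (M K η p : ℝ) (a : ℕ) (Q : ZSpace d → ℝ) : Prop where
  summable : Summable Q
  norm_le : ∑' y, |Q y| ≤ M
  summable_moment : Summable fun y => ‖latticeVec y‖ ^ (2 + η) * |Q y|
  moment_le : ∑' y, ‖latticeVec y‖ ^ (2 + η) * |Q y| ≤ M
  summable_high : Summable fun y => (‖latticeVec y‖ ^ a * |Q y|) ^ p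
  high_le : ∑' y, (‖latticeVec y‖ ^ a * |Q y|) ^ p ≤ M ^ p
  infrared : ∀ k ∈ torusBox d, K * ‖k‖ ^ 2 ≤ (latticeFourier Q 0 - latticeFourier Q k).re

theorem norm_pow_le_rpow {d : ℕ} {η : ℝ} (hη : 0 < η) (y : ZSpace d) :
    ‖latticeVec y‖ ^ 2 ≤ ‖latticeVec y‖ ^ (2 + η) := by
  by_cases h : y = 0
  · subst h; simp [Real.zero_rpow (show (2 + η) ≠ 0 by positivity)]
  · rw [← Real.rpow_natCast]
    exact Real.rpow_le_rpow_of_exponent_le (one_le_norm_latticeVec h) (by push_cast; linarith)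

theorem KernelClass.summable_sq {d : ℕ} {M K η p : ℝ} {a : ℕ} {Q : ZSpace d → ℝ}
    (h : KernelClass M K η p a Q) (hη : 0 < η) :
    Summable fun y => ‖latticeVec y‖ ^ 2 * |Q y| :=
  Summable.of_nonneg_of_le (fun y => by positivity)
    (fun y => mul_le_mul_of_nonneg_right (norm_pow_le_rpow hη y) (abs_nonneg _)) h.summable_moment

theorem KernelClass.sq_le {d : ℕ} {M K η p : ℝ} {a : ℕ} {Q : ZSpace d → ℝ}
    (h : KernelClass M K η p a Q) (hη : 0 < η) :
    ∑' y, ‖latticeVec y‖ ^ 2 * |Q y| ≤ M :=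
  ((h.summable_sq hη).tsum_le_tsum
    (fun y => mul_le_mul_of_nonneg_right (norm_pow_le_rpow hη y) (abs_nonneg _))
    h.summable_moment).trans h.moment_le

theorem tsum_le_of_finset_le {ι : Type*} {u : ι → ℝ} {L : ℝ} (hu : ∀ i, 0 ≤ u i)
    (h : ∀ s : Finset ι, ∑ i ∈ s, u i ≤ L) : Summable u ∧ ∑' i, u i ≤ L :=
  ⟨summable_of_sum_le hu h, Real.tsum_le_of_sum_le hu h⟩

/-- Pairing of a function in `ℓ^p` with a reflected translate. -/
theorem tsum_mul_shift_le {d : ℕ} {f : ZSpace d → ℝ} {u : ZSpace d → ℂ} {p N A L : ℝ} (hp : 1 ≤ p)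
    (hN : 0 ≤ N) (hA : 0 ≤ A) (hf0 : ∀ y, 0 ≤ f y) (hf : Summable fun y => f y ^ p)
    (hfN : ∑' y, f y ^ p ≤ N ^ p) (huA : ∀ y, ‖u y‖ ≤ A)
    (huL : ∀ s : Finset (ZSpace d), ∑ y ∈ s, ‖u y‖ ≤ L) (x : ZSpace d) :
    Summable (fun y => f y * ‖u (x - y)‖) ∧
      ∑' y, f y * ‖u (x - y)‖ ≤ N * (A ^ (1 / p) * L ^ (1 - 1 / p)) := by
  obtain ⟨h1, h2⟩ := tsum_le_of_finset_le (fun i => norm_nonneg _) huL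
  have h3 : Summable fun y => ‖u (x - y)‖ := (Equiv.subLeft x).summable_iff.mpr h1
  have h4 : ∑' y, ‖u (x - y)‖ = ∑' y, ‖u y‖ := (Equiv.subLeft x).tsum_eq (fun y => ‖u y‖)
  exact tsum_mul_le_pairing hp hN hA hf0 (fun _ => norm_nonneg _) hf hfN (fun _ => huA _) h3
    (h4.le.trans h2)

theorem add_pow_le_two_pow {x y : ℝ} (hx : 0 ≤ x) (hy : 0 ≤ y) (a : ℕ) :
    (x + y) ^ a ≤ 2 ^ a * (x ^ a + y ^ a) := by
  refine (add_pow_le hx hy a).trans ?_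
  gcongr
  · norm_num
  · exact Nat.sub_le _ _

/-- One convolution step for three simultaneous bounds: sup norm, ℓ¹ norm and weighted sup norm. The
weight at x is split between the jump y and the remaining displacement x - y - c; the first share is
handled by pairing the ℓ^p moment of `H` with the sup and ℓ¹ bounds of `u`. -/
theorem conv_bounds {d : ℕ} {H : ZSpace d → ℝ} {u v : ZSpace d → ℂ} {c : RSpace d} {a : ℕ}
    {p D N A L W : ℝ} (hp : 1 ≤ p) (hN : 0 ≤ N) (hA : 0 ≤ A) (hL : 0 ≤ L) (hW0 : 0 ≤ W)
    (hH : Summable H) (hHD : ∑' y, |H y| ≤ D)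
    (hHp : Summable fun y => (‖latticeVec y‖ ^ a * |H y|) ^ p)
    (hHN : ∑' y, (‖latticeVec y‖ ^ a * |H y|) ^ p ≤ N ^ p)
    (hv : ∀ x, HasSum (fun y => (H y : ℂ) * u (x - y)) (v x))
    (huA : ∀ x, ‖u x‖ ≤ A) (huL : ∀ s : Finset (ZSpace d), ∑ x ∈ s, ‖u x‖ ≤ L)
    (hW : ∀ x, ‖latticeVec x - c‖ ^ a * ‖u x‖ ≤ W) :
    (∀ x, ‖v x‖ ≤ D * A) ∧ (∀ s : Finset (ZSpace d), ∑ x ∈ s, ‖v x‖ ≤ D * L) ∧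
      ∀ x, ‖latticeVec x - c‖ ^ a * ‖v x‖
        ≤ 2 ^ a * (D * W + N * (A ^ (1 / p) * L ^ (1 - 1 / p))) := by
  have hs : ∀ x, Summable fun y => |H y| * ‖u (x - y)‖ := fun x =>
    Summable.of_nonneg_of_le (fun y => by positivity)
      (fun y => mul_le_mul_of_nonneg_left (huA _) (abs_nonneg _)) (hH.abs.mul_right A)
  have hvn : ∀ x, ‖v x‖ ≤ ∑' y, |H y| * ‖u (x - y)‖ := fun x => by
    rw [← (hv x).tsum_eq]
    refine tsum_of_norm_bounded (hs x).hasSum fun y => ?_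
    rw [norm_mul, Complex.norm_real, Real.norm_eq_abs]
  refine ⟨fun x => ?_, fun s => ?_, fun x => ?_⟩
  · calc ‖v x‖ ≤ _ := hvn x
      _ ≤ ∑' y, |H y| * A := (hs x).tsum_le_tsum
          (fun y => mul_le_mul_of_nonneg_left (huA _) (abs_nonneg _)) (hH.abs.mul_right A)
      _ = (∑' y, |H y|) * A := tsum_mul_right
      _ ≤ D * A := by gcongr
  · calc ∑ x ∈ s, ‖v x‖ ≤ ∑ x ∈ s, ∑' y, |H y| * ‖u (x - y)‖ :=
          Finset.sum_le_sum fun x _ => hvn x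
      _ = ∑' y, ∑ x ∈ s, |H y| * ‖u (x - y)‖ :=
          (Summable.tsum_finsetSum fun x _ => hs x).symm
      _ ≤ ∑' y, |H y| * L := by
          have hle : ∀ y, ∑ x ∈ s, |H y| * ‖u (x - y)‖ ≤ |H y| * L := fun y => by
            rw [← Finset.mul_sum]
            gcongr
            have := huL (s.map (Equiv.subRight y).toEmbedding)
            simpa using this
          exact (summable_sum fun x _ => hs x).tsum_le_tsum hle (hH.abs.mul_right L)
      _ = (∑' y, |H y|) * L := tsum_mul_right
      _ ≤ D * L := by gcongr
  · obtain ⟨h1, h2⟩ := tsum_mul_shift_le hp hN hA (fun y => by positivity) hHp hHN huA huL x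
    have hle : ∀ y, ‖latticeVec x - c‖ ^ a * (|H y| * ‖u (x - y)‖)
        ≤ 2 ^ a * (|H y| * W + ‖latticeVec y‖ ^ a * |H y| * ‖u (x - y)‖) := fun y => by
      have e1 : ‖latticeVec x - c‖ ≤ ‖latticeVec y‖ + ‖latticeVec (x - y) - c‖ := by
        have : latticeVec x - c = latticeVec y + (latticeVec (x - y) - c) := by
          rw [latticeVec_sub]; abel
        rw [this]; exact norm_add_le _ _
      have e2 : ‖latticeVec x - c‖ ^ a
          ≤ 2 ^ a * (‖latticeVec y‖ ^ a + ‖latticeVec (x - y) - c‖ ^ a) :=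
        (pow_le_pow_left₀ (norm_nonneg _) e1 a).trans
          (add_pow_le_two_pow (norm_nonneg _) (norm_nonneg _) a)
      calc _ ≤ 2 ^ a * (‖latticeVec y‖ ^ a + ‖latticeVec (x - y) - c‖ ^ a)
            * (|H y| * ‖u (x - y)‖) := by gcongr
        _ = 2 ^ a * (|H y| * (‖latticeVec (x - y) - c‖ ^ a * ‖u (x - y)‖)
            + ‖latticeVec y‖ ^ a * |H y| * ‖u (x - y)‖) := by ring
        _ ≤ _ := by gcongr; exact hW _
    calc ‖latticeVec x - c‖ ^ a * ‖v x‖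
        ≤ ‖latticeVec x - c‖ ^ a * ∑' y, |H y| * ‖u (x - y)‖ := by gcongr; exact hvn x
      _ = ∑' y, ‖latticeVec x - c‖ ^ a * (|H y| * ‖u (x - y)‖) := tsum_mul_left.symm
      _ ≤ ∑' y, 2 ^ a * (|H y| * W + ‖latticeVec y‖ ^ a * |H y| * ‖u (x - y)‖) :=
          ((hs x).mul_left _).tsum_le_tsum hle (((hH.abs.mul_right W).add h1).mul_left _)
      _ = 2 ^ a * ((∑' y, |H y|) * W + ∑' y, ‖latticeVec y‖ ^ a * |H y| * ‖u (x - y)‖) := by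
          rw [tsum_mul_left, (hH.abs.mul_right W).tsum_add h1, tsum_mul_right]
      _ ≤ _ := by gcongr

theorem rpow_split {D A L : ℝ} (hD : 0 < D) (hA : 0 ≤ A) (hL : 0 ≤ L) (q : ℝ) :
    (D * A) ^ q * (D * L) ^ (1 - q) = D * (A ^ q * L ^ (1 - q)) := by
  rw [Real.mul_rpow hD.le hA, Real.mul_rpow hD.le hL]
  have : D = D ^ q * D ^ (1 - q) := by rw [← Real.rpow_add hD]; simp
  calc D ^ q * A ^ q * (D ^ (1 - q) * L ^ (1 - q))
      = (D ^ q * D ^ (1 - q)) * (A ^ q * L ^ (1 - q)) := by ring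
    _ = _ := by rw [← this]

/-- Bounds on a convolution exponential `∑_j H^{*j} * u_0 / j!`. -/
theorem exp_conv_bounds {d : ℕ} {H : ZSpace d → ℝ} {u : ℕ → ZSpace d → ℂ} {v : ZSpace d → ℂ}
    {c : RSpace d} {a : ℕ} {p D N A L W : ℝ} (hp : 1 ≤ p) (hD : 1 ≤ D) (hN : 0 ≤ N) (hA : 0 ≤ A)
    (hL : 0 ≤ L) (hW0 : 0 ≤ W)
    (hH : Summable H) (hHD : ∑' y, |H y| ≤ D)
    (hHp : Summable fun y => (‖latticeVec y‖ ^ a * |H y|) ^ p)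
    (hHN : ∑' y, (‖latticeVec y‖ ^ a * |H y|) ^ p ≤ N ^ p)
    (hu : ∀ j x, HasSum (fun y => (H y : ℂ) * u j (x - y)) (u (j + 1) x))
    (huA : ∀ x, ‖u 0 x‖ ≤ A) (huL : ∀ s : Finset (ZSpace d), ∑ x ∈ s, ‖u 0 x‖ ≤ L)
    (hW : ∀ x, ‖latticeVec x - c‖ ^ a * ‖u 0 x‖ ≤ W)
    (hv : ∀ x, HasSum (fun j : ℕ => u j x / (j.factorial : ℂ)) (v x)) :
    (∀ x, ‖v x‖ ≤ Real.exp D * A) ∧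
    (∀ s : Finset (ZSpace d), ∑ x ∈ s, ‖v x‖ ≤ Real.exp D * L) ∧
      ∀ x, ‖latticeVec x - c‖ ^ a * ‖v x‖ ≤ Real.exp (2 ^ (a + 1) * D) *
        (W + N * (A ^ (1 / p) * L ^ (1 - 1 / p))) := by
  set P := N * (A ^ (1 / p) * L ^ (1 - 1 / p)) with hP
  have hP0 : 0 ≤ P := by positivity
  -- Each convolution multiplies the weighted bound by `2 ^ a * D` and adds one copy of the pairing
  -- term `P`, whence `j * P`. Later `j ≤ 2 ^ j` absorbs this factor into the exponential series.
  have key : ∀ j, (∀ x, ‖u j x‖ ≤ D ^ j * A) ∧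
      (∀ s : Finset (ZSpace d), ∑ x ∈ s, ‖u j x‖ ≤ D ^ j * L) ∧
      ∀ x, ‖latticeVec x - c‖ ^ a * ‖u j x‖ ≤ (2 ^ a * D) ^ j * (W + j * P) := by
    intro j
    induction j with
    | zero => simpa using ⟨huA, huL, hW⟩
    | succ j ih =>
      obtain ⟨h1, h2, h3⟩ := ih
      obtain ⟨g1, g2, g3⟩ := conv_bounds hp hN (by positivity) (by positivity)
        (by positivity) hH hHD hHp hHN (hu j) h1 h2 h3
      refine ⟨fun x => (g1 x).trans (le_of_eq (by ring)),
        fun s => (g2 s).trans (le_of_eq (by ring)), fun x => (g3 x).trans ?_⟩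
      rw [rpow_split (by positivity) hA hL, mul_left_comm N, ← hP]
      have e : D ^ j * P ≤ D * (2 ^ a * D) ^ j * P := by
        have : D ^ j ≤ (2 ^ a * D) ^ j := by
          gcongr
          have : (1 : ℝ) ≤ 2 ^ a := one_le_pow₀ (by norm_num)
          nlinarith
        gcongr
        nlinarith [show 0 ≤ D ^ j by positivity, show 0 ≤ (2 ^ a * D) ^ j by positivity]
      calc 2 ^ a * (D * ((2 ^ a * D) ^ j * (W + j * P)) + D ^ j * P)
          ≤ 2 ^ a * (D * ((2 ^ a * D) ^ j * (W + j * P)) + D * (2 ^ a * D) ^ j * P) := by gcongr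
        _ = _ := by push_cast; ring
  have hexp : HasSum (fun j : ℕ => D ^ j / j.factorial) (Real.exp D) := by
    rw [Real.exp_eq_exp_ℝ]; exact NormedSpace.expSeries_div_hasSum_exp D
  have hnorm : ∀ j x, ‖u j x / (j.factorial : ℂ)‖ = ‖u j x‖ / j.factorial := fun j x => by
    rw [norm_div, Complex.norm_natCast]
  have hb : ∀ j x, ‖u j x‖ / j.factorial ≤ D ^ j / j.factorial * A := fun j x => by
    rw [div_mul_eq_mul_div]; gcongr; exact (key j).1 x
  have hsum : ∀ x, Summable fun j : ℕ => ‖u j x‖ / j.factorial := fun x =>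
    Summable.of_nonneg_of_le (fun j => by positivity) (fun j => hb j x)
      (hexp.summable.mul_right A)
  have hvn : ∀ x, ‖v x‖ ≤ ∑' j : ℕ, ‖u j x‖ / j.factorial := fun x => by
    rw [← (hv x).tsum_eq]
    exact tsum_of_norm_bounded (hsum x).hasSum fun j => (hnorm j x).le
  refine ⟨fun x => ?_, fun s => ?_, fun x => ?_⟩
  · rw [← (hv x).tsum_eq]
    exact tsum_of_norm_bounded (hexp.mul_right A) fun j => by rw [hnorm]; exact hb j x
  · calc ∑ x ∈ s, ‖v x‖ ≤ ∑ x ∈ s, ∑' j : ℕ, ‖u j x‖ / j.factorial :=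
          Finset.sum_le_sum fun x _ => hvn x
      _ = ∑' j : ℕ, ∑ x ∈ s, ‖u j x‖ / j.factorial :=
          (Summable.tsum_finsetSum fun x _ => hsum x).symm
      _ ≤ ∑' j : ℕ, D ^ j / j.factorial * L := by
          refine (summable_sum fun x _ => hsum x).tsum_le_tsum (fun j => ?_)
            (hexp.summable.mul_right L)
          rw [← Finset.sum_div, div_mul_eq_mul_div]
          gcongr
          exact (key j).2.1 s
      _ = _ := by rw [tsum_mul_right, hexp.tsum_eq]
  · have hexp2 : HasSum (fun j : ℕ => (2 ^ (a + 1) * D) ^ j / j.factorial)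
        (Real.exp (2 ^ (a + 1) * D)) := by
      rw [Real.exp_eq_exp_ℝ]; exact NormedSpace.expSeries_div_hasSum_exp _
    calc _ ≤ ‖latticeVec x - c‖ ^ a * ∑' j : ℕ, ‖u j x‖ / j.factorial := by
          gcongr; exact hvn x
      _ = ∑' j : ℕ, ‖latticeVec x - c‖ ^ a * (‖u j x‖ / j.factorial) := tsum_mul_left.symm
      _ ≤ ∑' j : ℕ, (2 ^ (a + 1) * D) ^ j / j.factorial * (W + P) := by
          refine ((hsum x).mul_left _).tsum_le_tsum (fun j => ?_) (hexp2.summable.mul_right _)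
          rw [mul_div_assoc', div_mul_eq_mul_div]
          refine div_le_div_of_nonneg_right ?_ (by positivity)
          refine ((key j).2.2 x).trans ?_
          have hj : (j : ℝ) ≤ 2 ^ j := by exact_mod_cast Nat.lt_two_pow_self.le
          have h1 : (1 : ℝ) ≤ 2 ^ j := one_le_pow₀ (by norm_num)
          calc (2 ^ a * D) ^ j * (W + j * P) ≤ (2 ^ a * D) ^ j * (2 ^ j * W + 2 ^ j * P) := by
                gcongr; nlinarith
            _ = _ := by rw [pow_succ, mul_right_comm, mul_pow _ (2 : ℝ) j]; ring
      _ = _ := by rw [tsum_mul_right, hexp2.tsum_eq]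

theorem latticeFourier_sub {d : ℕ} {f g : ZSpace d → ℝ} (hf : Summable f) (hg : Summable g)
    (k : RSpace d) :
    latticeFourier (fun y => f y - g y) k = latticeFourier f k - latticeFourier g k := by
  rw [latticeFourier_eq]
  refine HasSum.tsum_eq ?_
  exact hasSum_of_eq ((hasSum_fourier hf k).sub (hasSum_fourier hg k))
    (fun y => by push_cast; ring) rfl

theorem latticeFourier_const_mul {d : ℕ} {f : ZSpace d → ℝ} (hf : Summable f) (c : ℝ)
    (k : RSpace d) : latticeFourier (fun y => c * f y) k = c * latticeFourier f k := by
  rw [latticeFourier_eq]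
  refine HasSum.tsum_eq ?_
  exact hasSum_of_eq ((hasSum_fourier hf k).mul_left (c : ℂ)) (fun y => by push_cast; ring) rfl

theorem norm_drift_sub_le {d : ℕ} {Q q : ZSpace d → ℝ} {B : ℝ}
    (hQ : Summable fun y => ‖latticeVec y‖ * |Q y|)
    (hq : Summable fun y => ‖latticeVec y‖ * |q y|)
    (h : Summable fun y => ‖latticeVec y‖ * |Q y - q y|)
    (hB : ∑' y, ‖latticeVec y‖ * |Q y - q y| ≤ B) : ‖drift Q - drift q‖ ≤ B := by
  have s1 : Summable fun y => Q y • latticeVec y := by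
    apply Summable.of_norm; simpa [norm_smul, mul_comm] using hQ
  have s2 : Summable fun y => q y • latticeVec y := by
    apply Summable.of_norm; simpa [norm_smul, mul_comm] using hq
  rw [drift, drift, ← s1.tsum_sub s2]
  refine (tsum_of_norm_bounded h.hasSum fun y => ?_).trans hB
  rw [← sub_smul, norm_smul, Real.norm_eq_abs, mul_comm]

theorem sqrt_pow_eq_rpow {τ : ℝ} (hτ : 0 ≤ τ) (n : ℕ) : √τ ^ n = τ ^ ((n : ℝ) / 2) := by
  rw [Real.sqrt_eq_rpow, ← Real.rpow_natCast, ← Real.rpow_mul hτ]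
  congr 1; ring

/-- Uniform decay of the kernel generated by a function in `KernelClass`. -/
theorem heatKernel_bounds (d : ℕ) {M K η p : ℝ} {a : ℕ} (hM : 0 < M) (hK : 0 < K) (hη : 0 < η)
    (hp : 1 ≤ p) (hpa : 2 ≤ a - d + d / p) :
    ∃ C, 0 < C ∧ ∀ Q : ZSpace d → ℝ, KernelClass M K η p a Q → ∀ t : ℝ, 0 < t →
      (∀ x, ‖heatKernel Q t x‖ ≤ C * max t 1 ^ (-(d : ℝ) / 2)) ∧
      (∀ s : Finset (ZSpace d), ∑ x ∈ s, ‖heatKernel Q t x‖ ≤ C) ∧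
      ∀ x, ‖latticeVec x - t • drift Q‖ ^ a * ‖heatKernel Q t x‖
        ≤ C * max t 1 ^ (((a : ℝ) - d) / 2) := by
  obtain ⟨C₁, ε, hC₁, hε, h1⟩ := norm_heatKernel_le_exp d (M := M) (D := 2 * M) hM hK
  obtain ⟨C₂, hC₂, h2⟩ := lattice_exp_sum d hε
  set D := 1 + M with hD
  set L := C₁ * C₂ with hL
  set W₁ := C₁ * ((a.factorial : ℝ) / ε ^ a) with hW₁
  set P₁ := M * (C₁ ^ (1 / p) * L ^ (1 - 1 / p)) with hP₁
  have hP₁0 : 0 ≤ P₁ := by positivity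
  set E := Real.exp D * Real.exp (2 ^ (a + 1) * D) with hE
  have hE0 : 0 < E := by positivity
  refine ⟨Real.exp D * (Real.exp D * C₁) + Real.exp D * (Real.exp D * L)
      + 2 ^ a * (E * (W₁ + P₁) + M ^ a * (Real.exp D * (Real.exp D * C₁))), by positivity,
    fun Q hQ t ht => ?_⟩
  have hQ2 := hQ.summable_sq hη
  have hQ2M := hQ.sq_le hη
  set τ := max t 1 with hτdef
  have hτ : 0 < τ := lt_max_of_lt_right one_pos
  have hτ1 : 1 ≤ τ := le_max_right _ _
  have htτ : t ≤ τ := le_max_left _ _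
  have hs : 0 < √τ := Real.sqrt_pos.mpr hτ
  have hs1 : 1 ≤ √τ := Real.one_le_sqrt.mpr hτ1
  classical
  -- Truncation at the diffusive length. By Chebyshev with the second moment, the tail `H` has ℓ¹
  -- norm at most M/τ, so `t * H` has ℓ¹ norm at most M for every t.
  set q : ZSpace d → ℝ := fun y => if ‖latticeVec y‖ ≤ √τ then Q y else 0 with hq
  set H : ZSpace d → ℝ := fun y => Q y - q y with hH
  have hqQ : ∀ y, |q y| ≤ |Q y| := fun y => by
    simp only [hq]; split_ifs <;> simp
  have hHQ : ∀ y, |H y| ≤ |Q y| := fun y => by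
    simp only [hH, hq]; split_ifs <;> simp
  have hqs : Summable q := Summable.of_norm_bounded hQ.summable.abs hqQ
  have hHs : Summable H := hQ.summable.sub hqs
  have hq2 : Summable fun y => ‖latticeVec y‖ ^ 2 * |q y| :=
    Summable.of_nonneg_of_le (fun y => by positivity)
      (fun y => mul_le_mul_of_nonneg_left (hqQ y) (by positivity)) hQ2
  have hH2 : Summable fun y => ‖latticeVec y‖ ^ 2 * |H y| :=
    Summable.of_nonneg_of_le (fun y => by positivity)
      (fun y => mul_le_mul_of_nonneg_left (hHQ y) (by positivity)) hQ2
  have hH2M : ∑' y, ‖latticeVec y‖ ^ 2 * |H y| ≤ M :=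
    (hH2.tsum_le_tsum (fun y => mul_le_mul_of_nonneg_left (hHQ y) (by positivity)) hQ2).trans hQ2M
  have hq2M : ∑' y, ‖latticeVec y‖ ^ 2 * |q y| ≤ M :=
    (hq2.tsum_le_tsum (fun y => mul_le_mul_of_nonneg_left (hqQ y) (by positivity)) hQ2).trans hQ2M
  have hHsupp : ∀ y, H y ≠ 0 → √τ ≤ ‖latticeVec y‖ := fun y hy => by
    by_contra hcon
    exact hy (by simp only [hH, hq]; rw [if_pos (not_le.mp hcon).le, sub_self])
  have hτH : τ * ∑' y, |H y| ≤ M := by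
    rw [← tsum_mul_left]
    refine ((hHs.abs.mul_left τ).tsum_le_tsum (fun y => ?_) hH2).trans hH2M
    by_cases hy : H y = 0
    · simp [hy]
    · gcongr
      calc τ = √τ ^ 2 := (Real.sq_sqrt hτ.le).symm
        _ ≤ _ := by gcongr; exact hHsupp y hy
  have hH0 : 0 ≤ ∑' y, |H y| := tsum_nonneg fun y => abs_nonneg _
  have htH : t * ∑' y, |H y| ≤ M := (mul_le_mul_of_nonneg_right htτ hH0).trans hτH
  have hfou : ∀ k, latticeFourier Q k = latticeFourier q k + latticeFourier H k := fun k => by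
    rw [latticeFourier_sub hQ.summable hqs]; ring
  -- the truncated kernel
  have hre : ∀ k ∈ torusBox d, t * K * ‖k‖ ^ 2 - 2 * M
      ≤ t * (latticeFourier q 0 - latticeFourier q k).re := fun k hk => by
    have e1 := hQ.infrared k hk
    have e2 : (latticeFourier Q 0 - latticeFourier Q k).re
        = (latticeFourier q 0 - latticeFourier q k).re
          + (latticeFourier H 0 - latticeFourier H k).re := by
      rw [hfou, hfou]; simp only [Complex.sub_re, Complex.add_re]; ring
    have e3 : (latticeFourier H 0 - latticeFourier H k).re ≤ 2 * ∑' y, |H y| := by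
      calc _ ≤ ‖latticeFourier H 0 - latticeFourier H k‖ := Complex.re_le_norm _
        _ ≤ ‖latticeFourier H 0‖ + ‖latticeFourier H k‖ := norm_sub_le _ _
        _ ≤ _ := by linarith [norm_latticeFourier_le hHs 0, norm_latticeFourier_le hHs k]
    nlinarith
  set c := t • drift q with hc
  have hk0 := h1 t q ht hqs hq2 hq2M (fun y hy => by
    by_contra hcon
    exact hy (by simp only [hq]; rw [if_neg hcon])) hre
  set A := C₁ * τ ^ (-(d : ℝ) / 2) with hA
  have hA0 : 0 ≤ A := by positivity
  have hkA : ∀ x, ‖heatKernel q t x‖ ≤ A := fun x => (hk0 x).trans (by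
    refine mul_le_of_le_one_right hA0 (Real.exp_le_one_iff.mpr ?_)
    rw [neg_mul, neg_div]
    exact neg_nonpos.mpr (by positivity))
  have hkL : ∀ s : Finset (ZSpace d), ∑ x ∈ s, ‖heatKernel q t x‖ ≤ L := fun s => by
    calc _ ≤ ∑ x ∈ s, A * Real.exp (-ε * ‖latticeVec x - c‖ / √τ) :=
          Finset.sum_le_sum fun x _ => hk0 x
      _ ≤ A * (C₂ * √τ ^ d) := by
          rw [← Finset.mul_sum]; gcongr; exact h2 _ hs1 c s
      _ = C₁ * C₂ * (τ ^ (-(d : ℝ) / 2) * τ ^ ((d : ℝ) / 2)) := by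
          rw [sqrt_pow_eq_rpow hτ.le]; ring
      _ = L := by rw [← Real.rpow_add hτ]; ring_nf; simp [hL]
  have hkW : ∀ x, ‖latticeVec x - c‖ ^ a * ‖heatKernel q t x‖
      ≤ W₁ * τ ^ (((a : ℝ) - d) / 2) := fun x => by
    set y := ‖latticeVec x - c‖ / √τ with hy
    have hy0 : 0 ≤ y := by positivity
    have e0 : ‖latticeVec x - c‖ = y * √τ := by rw [hy]; field_simp
    have e1 : ‖latticeVec x - c‖ ^ a = y ^ a * √τ ^ a := by rw [e0, mul_pow]
    have e2 : -ε * ‖latticeVec x - c‖ / √τ = -(ε * y) := by rw [hy]; ring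
    have e3 : τ ^ (((a : ℝ) - d) / 2) = √τ ^ a * τ ^ (-(d : ℝ) / 2) := by
      rw [sqrt_pow_eq_rpow hτ.le, ← Real.rpow_add hτ]; congr 1; ring
    calc _ ≤ ‖latticeVec x - c‖ ^ a * (A * Real.exp (-ε * ‖latticeVec x - c‖ / √τ)) := by
          gcongr; exact hk0 x
      _ = A * √τ ^ a * (y ^ a * Real.exp (-(ε * y))) := by rw [e1, e2]; ring
      _ ≤ A * √τ ^ a * ((a.factorial : ℝ) / ε ^ a) := by
          gcongr; exact pow_mul_exp_neg_le a hε hy0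
      _ = _ := by rw [e3]; ring
  -- the exponential of the tail
  set Ht : ZSpace d → ℝ := fun y => t * H y with hHt
  have hHts : Summable Ht := hHs.mul_left t
  have hHtabs : ∀ y, |Ht y| = t * |H y| := fun y => by rw [hHt, abs_mul, abs_of_pos ht]
  have hHtM : ∑' y, |Ht y| ≤ M := by
    simp only [hHtabs]; rw [tsum_mul_left]; exact htH
  have hpow : ∀ y, (‖latticeVec y‖ ^ a * |Ht y|) ^ p
      ≤ t ^ p * (‖latticeVec y‖ ^ a * |Q y|) ^ p := fun y => by
    rw [← Real.mul_rpow ht.le (by positivity), hHtabs, mul_left_comm]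
    refine Real.rpow_le_rpow (by positivity) ?_ (by linarith)
    exact mul_le_mul_of_nonneg_left
      (mul_le_mul_of_nonneg_left (hHQ y) (by positivity)) ht.le
  have hHp : Summable fun y => (‖latticeVec y‖ ^ a * |Ht y|) ^ p :=
    Summable.of_nonneg_of_le (fun y => by positivity) hpow (hQ.summable_high.mul_left _)
  have hHN : ∑' y, (‖latticeVec y‖ ^ a * |Ht y|) ^ p ≤ (t * M) ^ p := by
    refine (hHp.tsum_le_tsum hpow (hQ.summable_high.mul_left _)).trans ?_
    rw [tsum_mul_left, Real.mul_rpow ht.le hM.le]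
    gcongr
    exact hQ.high_le
  have hcq := continuous_heat hqs t
  have hcH := continuous_latticeFourier hHts
  have hfHt : ∀ k, latticeFourier Ht k = t * latticeFourier H k :=
    fun k => latticeFourier_const_mul hHs t k
  set u : ℕ → ZSpace d → ℂ := fun j => invFourier fun k =>
    latticeFourier Ht k ^ j * Complex.exp (t * (latticeFourier q k - latticeFourier q 0)) with hu
  set v : ZSpace d → ℂ := fun x => Complex.exp (latticeFourier Ht 0) * heatKernel Q t x with hv
  have hu0 : u 0 = heatKernel q t := by
    simp only [hu, pow_zero, one_mul]; rfl
  have hus : ∀ j x, HasSum (fun y => (Ht y : ℂ) * u j (x - y)) (u (j + 1) x) := fun j x => by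
    have := hasSum_invFourier_mul hHts (F := fun k => latticeFourier Ht k ^ j *
      Complex.exp (t * (latticeFourier q k - latticeFourier q 0))) (by fun_prop) x
    refine hasSum_of_eq this (fun y => rfl) ?_
    simp only [hu, pow_succ']; congr 1; ext k; ring
  have hvs : ∀ x, HasSum (fun j : ℕ => u j x / (j.factorial : ℂ)) (v x) := fun x => by
    obtain ⟨Cb, hCb0, hCb⟩ := exists_bound_torusBox hcq
    have := hasSum_invFourier
      (F := fun (j : ℕ) k => (j.factorial : ℂ)⁻¹ * (latticeFourier Ht k ^ j *
        Complex.exp (t * (latticeFourier q k - latticeFourier q 0))))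
      (G := fun k => Complex.exp (latticeFourier Ht 0) *
        Complex.exp (t * (latticeFourier Q k - latticeFourier Q 0)))
      (B := fun j => M ^ j / j.factorial * Cb)
      ((Real.summable_pow_div_factorial M).mul_right _)
      (fun j => by fun_prop)
      (fun j k hk => by
        rw [norm_mul, norm_mul, norm_inv, norm_pow, Complex.norm_natCast, ← mul_assoc]
        gcongr
        · rw [inv_mul_eq_div]
          gcongr
          exact (norm_latticeFourier_le hHts k).trans hHtM
        · exact hCb k hk)
      (fun k _ => by
        have h := (NormedSpace.expSeries_div_hasSum_exp (latticeFourier Ht k)).mul_right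
          (Complex.exp (t * (latticeFourier q k - latticeFourier q 0)))
        rw [← Complex.exp_eq_exp_ℂ, ← Complex.exp_add] at h
        refine hasSum_of_eq h (fun j => by ring) ?_
        rw [← Complex.exp_add, hfou, hfou, hfHt, hfHt]
        ring_nf) x
    refine hasSum_of_eq this (fun j => ?_) ?_
    · rw [invFourier_const_mul]; simp only [hu]; ring
    · rw [invFourier_const_mul]; rfl
  obtain ⟨r1, r2, r3⟩ := exp_conv_bounds (c := c) (a := a) (L := L)
    (W := W₁ * τ ^ (((a : ℝ) - d) / 2)) hp
    (show (1 : ℝ) ≤ D by linarith) (by positivity : 0 ≤ t * M) hA0 (by positivity) (by positivity)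
    hHts (hHtM.trans (by linarith)) hHp hHN hus (fun x => by rw [hu0]; exact hkA x)
    (fun s => by rw [hu0]; exact hkL s) (fun x => by rw [hu0]; exact hkW x) hvs
  have hkv : ∀ x, ‖heatKernel Q t x‖ ≤ Real.exp D * ‖v x‖ := fun x => by
    have e1 : heatKernel Q t x = Complex.exp (-latticeFourier Ht 0) * v x := by
      simp only [hv]; rw [← mul_assoc, ← Complex.exp_add]; simp
    rw [e1, norm_mul, Complex.norm_exp]
    gcongr
    calc (-latticeFourier Ht 0).re ≤ ‖-latticeFourier Ht 0‖ := Complex.re_le_norm _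
      _ ≤ M := by rw [norm_neg]; exact (norm_latticeFourier_le hHts 0).trans hHtM
      _ ≤ D := by linarith
  -- Here the relation between `a`, `p` and `d` is used: A^{1/p} supplies τ^{-d/(2p)}, and 1 -
  -- d/(2p) ≤ (a - d)/2 is exactly `hpa`.
  have hPP : t * M * (A ^ (1 / p) * L ^ (1 - 1 / p)) ≤ P₁ * τ ^ (((a : ℝ) - d) / 2) := by
    have e1 : A ^ (1 / p) = C₁ ^ (1 / p) * τ ^ (-(d : ℝ) / 2 * (1 / p)) := by
      rw [hA, Real.mul_rpow hC₁.le (by positivity), ← Real.rpow_mul hτ.le]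
    have e2 : t * τ ^ (-(d : ℝ) / 2 * (1 / p)) ≤ τ ^ (((a : ℝ) - d) / 2) := by
      calc t * τ ^ (-(d : ℝ) / 2 * (1 / p)) ≤ τ * τ ^ (-(d : ℝ) / 2 * (1 / p)) := by gcongr
        _ = τ ^ (1 + -(d : ℝ) / 2 * (1 / p)) := by rw [Real.rpow_add hτ, Real.rpow_one]
        _ ≤ _ := Real.rpow_le_rpow_of_exponent_le hτ1 (by
            have : -(d : ℝ) / 2 * (1 / p) = -(d / p) / 2 := by ring
            rw [this]; linarith)
    calc _ = P₁ * (t * τ ^ (-(d : ℝ) / 2 * (1 / p))) := by rw [e1, hP₁]; ring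
      _ ≤ _ := by gcongr
  have hbA : ∀ x, ‖heatKernel Q t x‖
      ≤ Real.exp D * (Real.exp D * C₁) * τ ^ (-(d : ℝ) / 2) := fun x => by
    calc _ ≤ Real.exp D * ‖v x‖ := hkv x
      _ ≤ Real.exp D * (Real.exp D * A) := by gcongr; exact r1 x
      _ = _ := by rw [hA]; ring
  -- Truncation moves the centre only by a diffusive length: on the tail ‖y‖ ≤ ‖y‖²/√τ, so the
  -- drifts differ by at most M/√τ.
  have hshift : ‖c - t • drift Q‖ ≤ M * √τ := by
    rw [hc, ← smul_sub, norm_smul, Real.norm_of_nonneg ht.le, norm_sub_rev]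
    have hle : ∀ y, ‖latticeVec y‖ * |Q y - q y| ≤ (√τ)⁻¹ * (‖latticeVec y‖ ^ 2 * |H y|) :=
      fun y => by
        by_cases hy : H y = 0
        · simp only [hH] at hy
          rw [hy, abs_zero, mul_zero]; positivity
        · have := hHsupp y hy
          rw [inv_mul_eq_div, le_div_iff₀ hs]
          calc _ = ‖latticeVec y‖ * √τ * |H y| := by ring
            _ ≤ ‖latticeVec y‖ * ‖latticeVec y‖ * |H y| := by gcongr
            _ = _ := by ring
    have hsm : Summable fun y => ‖latticeVec y‖ * |Q y - q y| :=
      Summable.of_nonneg_of_le (fun y => by positivity) hle (hH2.mul_left _)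
    have := norm_drift_sub_le (summable_norm_mul hQ2) (summable_norm_mul hq2) hsm
      (B := (√τ)⁻¹ * M) ((hsm.tsum_le_tsum hle (hH2.mul_left _)).trans (by
        rw [tsum_mul_left]; gcongr))
    calc t * ‖drift Q - drift q‖ ≤ τ * ((√τ)⁻¹ * M) := by gcongr
      _ = (√τ * √τ) * ((√τ)⁻¹ * M) := by rw [Real.mul_self_sqrt hτ.le]
      _ = _ := by field_simp
  have hτd : 0 < τ ^ (-(d : ℝ) / 2) := Real.rpow_pos_of_pos hτ _
  have hτa : 0 < τ ^ (((a : ℝ) - d) / 2) := Real.rpow_pos_of_pos hτ _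
  have X1 : 0 ≤ Real.exp D * (Real.exp D * C₁) := by positivity
  have X2 : 0 ≤ Real.exp D * (Real.exp D * L) := by positivity
  have X3 : 0 ≤ 2 ^ a * (E * (W₁ + P₁) + M ^ a * (Real.exp D * (Real.exp D * C₁))) := by positivity
  refine ⟨fun x => (hbA x).trans ?_, fun s => ?_, fun x => ?_⟩
  · gcongr; linarith
  · calc _ ≤ ∑ x ∈ s, Real.exp D * ‖v x‖ := Finset.sum_le_sum fun x _ => hkv x
      _ ≤ Real.exp D * (Real.exp D * L) := by
          rw [← Finset.mul_sum]; gcongr; exact r2 s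
      _ ≤ _ := by linarith
  · have e1 : ‖latticeVec x - t • drift Q‖ ^ a
        ≤ 2 ^ a * (‖latticeVec x - c‖ ^ a + (M * √τ) ^ a) := by
      refine (pow_le_pow_left₀ (norm_nonneg _) ?_ a).trans
        (add_pow_le_two_pow (norm_nonneg _) (by positivity) a)
      calc _ = ‖(latticeVec x - c) + (c - t • drift Q)‖ := by congr 1; abel
        _ ≤ _ := (norm_add_le _ _).trans (by gcongr)
    have e2 : ‖latticeVec x - c‖ ^ a * ‖heatKernel Q t x‖
        ≤ E * (W₁ + P₁) * τ ^ (((a : ℝ) - d) / 2) := by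
      calc _ ≤ ‖latticeVec x - c‖ ^ a * (Real.exp D * ‖v x‖) := by gcongr; exact hkv x
        _ = Real.exp D * (‖latticeVec x - c‖ ^ a * ‖v x‖) := by ring
        _ ≤ Real.exp D * (Real.exp (2 ^ (a + 1) * D) *
              (W₁ * τ ^ (((a : ℝ) - d) / 2) + P₁ * τ ^ (((a : ℝ) - d) / 2))) := by
            refine mul_le_mul_of_nonneg_left ((r3 x).trans ?_) (Real.exp_pos _).le
            gcongr
        _ = _ := by rw [hE]; ring
    have e3 : (M * √τ) ^ a * ‖heatKernel Q t x‖
        ≤ M ^ a * (Real.exp D * (Real.exp D * C₁)) * τ ^ (((a : ℝ) - d) / 2) := by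
      have e4 : τ ^ (((a : ℝ) - d) / 2) = √τ ^ a * τ ^ (-(d : ℝ) / 2) := by
        rw [sqrt_pow_eq_rpow hτ.le, ← Real.rpow_add hτ]; congr 1; ring
      calc _ ≤ (M * √τ) ^ a * (Real.exp D * (Real.exp D * C₁) * τ ^ (-(d : ℝ) / 2)) := by
            gcongr; exact hbA x
        _ = _ := by rw [e4]; ring
    calc _ ≤ 2 ^ a * (‖latticeVec x - c‖ ^ a + (M * √τ) ^ a) * ‖heatKernel Q t x‖ := by gcongr
      _ = 2 ^ a * (‖latticeVec x - c‖ ^ a * ‖heatKernel Q t x‖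
          + (M * √τ) ^ a * ‖heatKernel Q t x‖) := by ring
      _ ≤ 2 ^ a * (E * (W₁ + P₁) * τ ^ (((a : ℝ) - d) / 2)
          + M ^ a * (Real.exp D * (Real.exp D * C₁)) * τ ^ (((a : ℝ) - d) / 2)) := by gcongr
      _ = 2 ^ a * (E * (W₁ + P₁) + M ^ a * (Real.exp D * (Real.exp D * C₁)))
          * τ ^ (((a : ℝ) - d) / 2) := by ring
      _ ≤ _ := by gcongr; linarith

/-! ### The kernel with a source -/

/-- Quantitative assumptions on the source `g`. -/
structure SourceClass {d : ℕ} (M η : ℝ) (a : ℕ) (g : ZSpace d → ℝ) : Prop where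
  summable : Summable g
  norm_le : ∑' y, |g y| ≤ M
  summable_moment : Summable fun y => ‖latticeVec y‖ ^ η * |g y|
  moment_le : ∑' y, ‖latticeVec y‖ ^ η * |g y| ≤ M
  summable_high : Summable fun y => (‖latticeVec y‖ ^ a * |g y|) ^ (2 : ℝ)
  high_le : ∑' y, (‖latticeVec y‖ ^ a * |g y|) ^ (2 : ℝ) ≤ M ^ (2 : ℝ)

/-- The convolution of the source `g` with the kernel generated by `Q`. -/
def sourceKernel {d : ℕ} (Q g : ZSpace d → ℝ) (t : ℝ) (x : ZSpace d) : ℂ :=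
  invFourier (fun k => latticeFourier g k *
    Complex.exp (t * (latticeFourier Q k - latticeFourier Q 0))) x

/-- Uniform decay of the kernel with a source. -/
theorem sourceKernel_bound (d : ℕ) {M K η p : ℝ} {a : ℕ} (hM : 0 < M) (hK : 0 < K) (hη : 0 < η)
    (hp : 1 ≤ p) (hpa : 2 ≤ a - d + d / p) (had : (d : ℝ) ≤ 2 * a) :
    ∃ C, 0 < C ∧ ∀ Q g : ZSpace d → ℝ, KernelClass M K η p a Q → SourceClass M η a g →
      ∀ t : ℝ, 0 < t → ∀ x, ‖sourceKernel Q g t x‖ ≤ C * max t 1 ^ (-(d : ℝ) / 2) *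
        (1 + ‖latticeVec x - t • drift Q‖ / √(max t 1)) ^ (-(a : ℝ)) := by
  obtain ⟨C, hC0, hC⟩ := heatKernel_bounds d hM hK hη hp hpa
  set B := M * C + 2 ^ a * (M * C + M * C) with hB
  refine ⟨2 ^ a * (B + B), by positivity, fun Q g hQ hg t ht x => ?_⟩
  obtain ⟨h1, h2, h3⟩ := hC Q hQ t ht
  set τ := max t 1 with hτdef
  have hτ : 0 < τ := lt_max_of_lt_right one_pos
  have hτ1 : 1 ≤ τ := le_max_right _ _
  have hs : 0 < √τ := Real.sqrt_pos.mpr hτ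
  have hτd : 0 < τ ^ (-(d : ℝ) / 2) := Real.rpow_pos_of_pos hτ _
  have hτa : 0 < τ ^ (((a : ℝ) - d) / 2) := Real.rpow_pos_of_pos hτ _
  obtain ⟨g1, -, g3⟩ := conv_bounds (c := t • drift Q) (a := a) (by norm_num : (1 : ℝ) ≤ 2) hM.le
    (by positivity : 0 ≤ C * τ ^ (-(d : ℝ) / 2)) hC0.le
    (by positivity : 0 ≤ C * τ ^ (((a : ℝ) - d) / 2)) hg.summable
    hg.norm_le hg.summable_high hg.high_le
    (fun x => hasSum_invFourier_mul hg.summable (continuous_heat hQ.summable t) x) h1 h2 h3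
  have b1 : ‖sourceKernel Q g t x‖ ≤ B * τ ^ (-(d : ℝ) / 2) := by
    refine (g1 x).trans ?_
    rw [← mul_assoc]
    gcongr
    have : 0 ≤ 2 ^ a * (M * C + M * C) := by positivity
    linarith
  have b2 : ‖latticeVec x - t • drift Q‖ ^ a * ‖sourceKernel Q g t x‖
      ≤ B * τ ^ (((a : ℝ) - d) / 2) := by
    refine (g3 x).trans ?_
    -- The pairing in ℓ² yields τ^{-d/4}, which is at most τ^{(a-d)/2} by `had`; this is why a
    -- square-summable moment of the source suffices.
    have e1 : (C * τ ^ (-(d : ℝ) / 2)) ^ (1 / (2 : ℝ)) * C ^ (1 - 1 / (2 : ℝ))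
        ≤ C * τ ^ (((a : ℝ) - d) / 2) := by
      rw [Real.mul_rpow hC0.le hτd.le, mul_right_comm, ← Real.rpow_add hC0, ← Real.rpow_mul hτ.le]
      norm_num
      gcongr
      linarith
    calc _ ≤ 2 ^ a * (M * (C * τ ^ (((a : ℝ) - d) / 2)) + M * (C * τ ^ (((a : ℝ) - d) / 2))) := by
          gcongr
      _ = (2 ^ a * (M * C + M * C)) * τ ^ (((a : ℝ) - d) / 2) := by ring
      _ ≤ _ := by
          gcongr
          have : 0 ≤ M * C := by positivity
          linarith
  set D := ‖latticeVec x - t • drift Q‖ with hD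
  have hD0 : 0 ≤ D := norm_nonneg _
  rw [Real.rpow_neg (by positivity), ← div_eq_mul_inv, Real.rpow_natCast,
    le_div_iff₀ (by positivity)]
  have e3 : τ ^ (((a : ℝ) - d) / 2) = √τ ^ a * τ ^ (-(d : ℝ) / 2) := by
    rw [sqrt_pow_eq_rpow hτ.le, ← Real.rpow_add hτ]; congr 1; ring
  have e4 : (D / √τ) ^ a * ‖sourceKernel Q g t x‖ ≤ B * τ ^ (-(d : ℝ) / 2) := by
    rw [div_pow, div_mul_eq_mul_div, div_le_iff₀ (by positivity)]
    calc _ ≤ _ := b2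
      _ = _ := by rw [e3]; ring
  calc ‖sourceKernel Q g t x‖ * (1 + D / √τ) ^ a
      ≤ ‖sourceKernel Q g t x‖ * (2 ^ a * (1 ^ a + (D / √τ) ^ a)) := by
        gcongr; exact add_pow_le_two_pow zero_le_one (by positivity) a
    _ = 2 ^ a * (‖sourceKernel Q g t x‖ + (D / √τ) ^ a * ‖sourceKernel Q g t x‖) := by
        rw [one_pow]; ring
    _ ≤ 2 ^ a * (B * τ ^ (-(d : ℝ) / 2) + B * τ ^ (-(d : ℝ) / 2)) := by gcongr
    _ = _ := by ring

/-! ### The Gaussian approximation -/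

/-- The quadratic form `½ ∑_y Q(y) (k·y)²`. -/
def covForm {d : ℕ} (Q : ZSpace d → ℝ) (k : RSpace d) : ℝ :=
  ∑' y, Q y * ((inner ℝ k (latticeVec y)) ^ 2 / 2)

theorem summable_covForm {d : ℕ} {Q : ZSpace d → ℝ}
    (hQ : Summable fun y => ‖latticeVec y‖ ^ 2 * |Q y|) (k : RSpace d) :
    Summable fun y => Q y * ((inner ℝ k (latticeVec y)) ^ 2 / 2) := by
  refine Summable.of_norm_bounded (hQ.mul_left (‖k‖ ^ 2)) fun y => ?_
  rw [norm_mul, Real.norm_eq_abs, Real.norm_of_nonneg (by positivity)]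
  have h6 : (inner ℝ k (latticeVec y)) ^ 2 ≤ (‖k‖ * ‖latticeVec y‖) ^ 2 := by
    rw [← sq_abs]; gcongr; exact abs_real_inner_le_norm _ _
  have h7 : (inner ℝ k (latticeVec y)) ^ 2 / 2 ≤ ‖k‖ ^ 2 * ‖latticeVec y‖ ^ 2 := by
    rw [mul_pow] at h6; nlinarith [sq_nonneg (inner ℝ k (latticeVec y))]
  calc |Q y| * _ ≤ |Q y| * (‖k‖ ^ 2 * ‖latticeVec y‖ ^ 2) := by gcongr
    _ = _ := by ring

theorem covForm_le {d : ℕ} {Q : ZSpace d → ℝ} {M : ℝ}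
    (hQ : Summable fun y => ‖latticeVec y‖ ^ 2 * |Q y|)
    (hM : ∑' y, ‖latticeVec y‖ ^ 2 * |Q y| ≤ M) (k : RSpace d) :
    covForm Q k ≤ M * ‖k‖ ^ 2 := by
  have h : covForm Q k ≤ ∑' y, ‖k‖ ^ 2 * (‖latticeVec y‖ ^ 2 * |Q y|) := by
    refine (summable_covForm hQ k).tsum_le_tsum (fun y => ?_) (hQ.mul_left _)
    have h6 : (inner ℝ k (latticeVec y)) ^ 2 ≤ (‖k‖ * ‖latticeVec y‖) ^ 2 := by
      rw [← sq_abs]; gcongr; exact abs_real_inner_le_norm _ _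
    have h7 : (inner ℝ k (latticeVec y)) ^ 2 / 2 ≤ ‖k‖ ^ 2 * ‖latticeVec y‖ ^ 2 := by
      rw [mul_pow] at h6; nlinarith [sq_nonneg (inner ℝ k (latticeVec y))]
    calc _ ≤ |Q y| * ((inner ℝ k (latticeVec y)) ^ 2 / 2) := by gcongr; exact le_abs_self _
      _ ≤ |Q y| * (‖k‖ ^ 2 * ‖latticeVec y‖ ^ 2) := by gcongr
      _ = _ := by ring
  rw [tsum_mul_left] at h
  nlinarith [sq_nonneg ‖k‖]

/-- For |u| ≤ 1 the remainder is cubic, for |u| ≥ 1 each term is at most quadratic; both are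
dominated by |u|^{2+η} because 0 < η ≤ 1. -/
theorem norm_exp_taylor_le {η : ℝ} (hη : 0 < η) (hη1 : η ≤ 1) (u : ℝ) :
    ‖Complex.exp (-(Complex.I * (u : ℂ))) - 1 + Complex.I * u + ((u ^ 2 / 2 : ℝ) : ℂ)‖
      ≤ 4 * |u| ^ (2 + η) := by
  rcases le_total |u| 1 with h | h
  · have hx : ‖-(Complex.I * (u : ℂ))‖ ≤ 1 := by simpa using h
    have h1 := Complex.exp_bound hx (n := 3) (by norm_num)
    have e : Complex.exp (-(Complex.I * (u : ℂ))) - 1 + Complex.I * u + ((u ^ 2 / 2 : ℝ) : ℂ)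
        = Complex.exp (-(Complex.I * (u : ℂ)))
          - ∑ m ∈ Finset.range 3, (-(Complex.I * (u : ℂ))) ^ m / m.factorial := by
      simp only [Finset.sum_range_succ, Finset.sum_range_zero, neg_pow (Complex.I * (u : ℂ)),
        mul_pow, Complex.I_sq]
      push_cast
      norm_num [Nat.factorial]
      ring
    rw [e]
    refine h1.trans ?_
    have e2 : ‖-(Complex.I * (u : ℂ))‖ = |u| := by simp
    rw [e2]
    have h3 : |u| ^ 3 ≤ |u| ^ (2 + η) := by
      rw [← Real.rpow_natCast]
      rcases (abs_nonneg u).eq_or_lt with h0 | h0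
      · rw [← h0, Real.zero_rpow (by norm_num), Real.zero_rpow (by positivity)]
      · exact Real.rpow_le_rpow_of_exponent_ge h0 h (by push_cast; linarith)
    norm_num [Nat.factorial]
    nlinarith [show 0 ≤ |u| ^ 3 by positivity]
  · have h3 : |u| ^ 2 ≤ |u| ^ (2 + η) := by
      rw [← Real.rpow_natCast]
      exact Real.rpow_le_rpow_of_exponent_le h (by push_cast; linarith)
    have e1 : ‖Complex.exp (-(Complex.I * (u : ℂ)))‖ = 1 := by
      have : -(Complex.I * (u : ℂ)) = ((-u : ℝ) : ℂ) * Complex.I := by push_cast; ring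
      rw [this, Complex.norm_exp_ofReal_mul_I]
    calc _ ≤ ‖Complex.exp (-(Complex.I * (u : ℂ)))‖ + ‖(1 : ℂ)‖ + ‖Complex.I * (u : ℂ)‖
          + ‖((u ^ 2 / 2 : ℝ) : ℂ)‖ :=
          (norm_add_le _ _).trans (add_le_add_left ((norm_add_le _ _).trans
            (add_le_add_left (norm_sub_le _ _) _)) _)
      _ = 1 + 1 + |u| + |u| ^ 2 / 2 := by
          rw [e1, norm_one, norm_mul, Complex.norm_I, Complex.norm_real, Complex.norm_real,
            Real.norm_eq_abs, Real.norm_of_nonneg (by positivity), one_mul, sq_abs]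
      _ ≤ 4 * |u| ^ 2 := by nlinarith
      _ ≤ _ := by gcongr

theorem KernelClass.symbol_sub_le {d : ℕ} {M K η p : ℝ} {a : ℕ} {Q : ZSpace d → ℝ}
    (h : KernelClass M K η p a Q) (hη : 0 < η) (hη1 : η ≤ 1) (k : RSpace d) :
    ‖latticeFourier Q 0 - latticeFourier Q k - Complex.I * ((inner ℝ k (drift Q) : ℝ) : ℂ)
      - ((covForm Q k : ℝ) : ℂ)‖ ≤ 4 * M * ‖k‖ ^ (2 + η) := by
  have h2 := h.summable_sq hη
  have hs1 := (hasSum_fourier h.summable 0).sub (hasSum_fourier h.summable k)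
  have hs2 := (Complex.hasSum_ofReal.mpr (inner_drift (summable_norm_mul h2) k)).mul_left Complex.I
  have hs3 := Complex.hasSum_ofReal.mpr (summable_covForm h2 k).hasSum
  have hs := (hs1.sub hs2).sub hs3
  rw [covForm, ← hs.tsum_eq]
  refine (tsum_of_norm_bounded
    (h.summable_moment.mul_left (4 * ‖k‖ ^ (2 + η))).hasSum fun y => ?_).trans ?_
  · set u := inner ℝ k (latticeVec y) with hu
    have e : (Q y : ℂ) * chr 0 (-y) - (Q y : ℂ) * chr k (-y) - Complex.I * ((Q y * u : ℝ) : ℂ)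
        - ((Q y * (u ^ 2 / 2) : ℝ) : ℂ)
        = -((Q y : ℂ) * (Complex.exp (-(Complex.I * (u : ℂ))) - 1 + Complex.I * u
          + ((u ^ 2 / 2 : ℝ) : ℂ))) := by
      rw [chr_zero_left, chr_neg_right, ← hu]; push_cast; ring
    rw [e, norm_neg, norm_mul, Complex.norm_real, Real.norm_eq_abs]
    have h3 : |u| ^ (2 + η) ≤ ‖k‖ ^ (2 + η) * ‖latticeVec y‖ ^ (2 + η) := by
      rw [← Real.mul_rpow (norm_nonneg _) (norm_nonneg _)]
      exact Real.rpow_le_rpow (abs_nonneg _) (abs_real_inner_le_norm _ _) (by linarith)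
    calc _ ≤ |Q y| * (4 * |u| ^ (2 + η)) := by
          gcongr; exact norm_exp_taylor_le hη hη1 u
      _ ≤ |Q y| * (4 * (‖k‖ ^ (2 + η) * ‖latticeVec y‖ ^ (2 + η))) := by gcongr
      _ = _ := by ring
  · rw [tsum_mul_left]
    have := h.moment_le
    have h0 : 0 ≤ ‖k‖ ^ (2 + η) := Real.rpow_nonneg (norm_nonneg _) _
    nlinarith

/-- The quadratic form is homogeneous, so the infrared bound extends from the box to all k: apply it
at sk with s small, divide by s², and let s → 0. The symbol error is O(s^{2+η}) and disappears. -/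
theorem KernelClass.le_covForm {d : ℕ} {M K η p : ℝ} {a : ℕ} {Q : ZSpace d → ℝ}
    (h : KernelClass M K η p a Q) (hη : 0 < η) (hη1 : η ≤ 1) (k : RSpace d) :
    K * ‖k‖ ^ 2 ≤ covForm Q k := by
  have hlim : Filter.Tendsto (fun s : ℝ => covForm Q k + 4 * M * (s ^ η * ‖k‖ ^ (2 + η)))
      (nhdsWithin 0 (Set.Ioi 0)) (nhds (covForm Q k)) := by
    have h1 : Filter.Tendsto (fun s : ℝ => s ^ η) (nhdsWithin 0 (Set.Ioi 0)) (nhds 0) := by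
      have := (Real.continuous_rpow_const hη.le).tendsto 0
      rw [Real.zero_rpow hη.ne'] at this
      exact this.mono_left nhdsWithin_le_nhds
    have h2 := ((h1.mul_const (‖k‖ ^ (2 + η))).const_mul (4 * M)).const_add (covForm Q k)
    simpa using h2
  refine ge_of_tendsto hlim ?_
  have hsmall : ∀ᶠ s : ℝ in nhdsWithin 0 (Set.Ioi 0), s * ‖k‖ < Real.pi := by
    have : Filter.Tendsto (fun s : ℝ => s * ‖k‖) (nhdsWithin 0 (Set.Ioi 0)) (nhds (0 * ‖k‖)) :=
      (Filter.tendsto_id.mono_left nhdsWithin_le_nhds).mul_const _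
    rw [zero_mul] at this
    exact this.eventually_lt_const Real.pi_pos
  filter_upwards [hsmall, self_mem_nhdsWithin] with s hs hs0
  have hs0 : 0 < s := hs0
  have hbox : s • k ∈ torusBox d := fun i => by
    refine (abs_apply_le_norm _ i).trans ?_
    rw [norm_smul, Real.norm_of_nonneg hs0.le]; exact hs.le
  have h1 := h.infrared _ hbox
  have h2 := (Complex.abs_re_le_norm _).trans (h.symbol_sub_le hη hη1 (s • k))
  have hcov : covForm Q (s • k) = s ^ 2 * covForm Q k := by
    rw [covForm, covForm, ← tsum_mul_left]
    congr 1; ext y; rw [real_inner_smul_left]; ring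
  simp only [Complex.sub_re, Complex.I_mul_re, Complex.ofReal_im, Complex.ofReal_re, neg_zero,
    sub_zero] at h1 h2
  rw [hcov, norm_smul, Real.norm_of_nonneg hs0.le, Real.mul_rpow hs0.le (norm_nonneg _),
    Real.rpow_add hs0, Real.rpow_two] at h2
  rw [norm_smul, Real.norm_of_nonneg hs0.le, mul_pow] at h1
  have h3 := (abs_le.mp h2).2
  have h4 : s ^ 2 * (K * ‖k‖ ^ 2)
      ≤ s ^ 2 * (covForm Q k + 4 * M * (s ^ η * ‖k‖ ^ (2 + η))) := by
    linarith
  exact le_of_mul_le_mul_left h4 (by positivity)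

/-- Mean value inequality on the half-plane Re ≥ r, which is convex and on which the derivative has
modulus at most e^{-r}. -/
theorem norm_exp_neg_sub_le {z w : ℂ} {r : ℝ} (hz : r ≤ z.re) (hw : r ≤ w.re) :
    ‖Complex.exp (-z) - Complex.exp (-w)‖ ≤ Real.exp (-r) * ‖z - w‖ := by
  have hconv : Convex ℝ {u : ℂ | r ≤ u.re} := convex_halfSpace_re_ge r
  refine hconv.norm_image_sub_le_of_norm_hasDerivWithin_le (f := fun u => Complex.exp (-u))
    (f' := fun u => -Complex.exp (-u)) (fun u _ => ?_) (fun u hu => ?_) hw hz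
  · have := ((hasDerivAt_neg u).cexp).hasDerivWithinAt (s := {u : ℂ | r ≤ u.re})
    simpa using this
  · rw [norm_neg, Complex.norm_exp, Real.exp_le_exp]
    simpa using hu

theorem SourceClass.fourier_sub_le {d : ℕ} {M η : ℝ} {a : ℕ} {g : ZSpace d → ℝ}
    (h : SourceClass M η a g) (hη : 0 < η) (hη1 : η ≤ 1) (k : RSpace d) :
    ‖latticeFourier g k - latticeFourier g 0‖ ≤ 2 * M * ‖k‖ ^ η := by
  have hs := (hasSum_fourier h.summable k).sub (hasSum_fourier h.summable 0)
  rw [← hs.tsum_eq]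
  refine (tsum_of_norm_bounded
    (h.summable_moment.mul_left (2 * ‖k‖ ^ η)).hasSum fun y => ?_).trans ?_
  · rw [← mul_sub, norm_mul, Complex.norm_real, Real.norm_eq_abs, chr_zero_left, chr_neg_right]
    set u := inner ℝ k (latticeVec y) with hu
    have h1 : ‖Complex.exp (-(Complex.I * (u : ℂ))) - 1‖ ≤ 2 * |u| ^ η := by
      rcases le_total |u| 1 with h1 | h1
      · have := Real.norm_exp_I_mul_ofReal_sub_one_le (x := -u)
        have e : -(Complex.I * (u : ℂ)) = Complex.I * ((-u : ℝ) : ℂ) := by push_cast; ring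
        rw [e]
        refine this.trans ?_
        rw [norm_neg, Real.norm_eq_abs]
        have h3 : |u| ≤ |u| ^ η := by
          rcases (abs_nonneg u).eq_or_lt with h0 | h0
          · rw [← h0, Real.zero_rpow hη.ne']
          · exact Real.self_le_rpow_of_le_one h0.le h1 hη1
        linarith [abs_nonneg u]
      · have e1 : ‖Complex.exp (-(Complex.I * (u : ℂ)))‖ = 1 := by
          have : -(Complex.I * (u : ℂ)) = ((-u : ℝ) : ℂ) * Complex.I := by push_cast; ring
          rw [this, Complex.norm_exp_ofReal_mul_I]
        have := norm_sub_le (Complex.exp (-(Complex.I * (u : ℂ)))) 1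
        rw [e1, norm_one] at this
        linarith [Real.one_le_rpow h1 hη.le]
    have h3 : |u| ^ η ≤ ‖k‖ ^ η * ‖latticeVec y‖ ^ η := by
      rw [← Real.mul_rpow (norm_nonneg _) (norm_nonneg _)]
      exact Real.rpow_le_rpow (abs_nonneg _) (abs_real_inner_le_norm _ _) hη.le
    calc _ ≤ |g y| * (2 * |u| ^ η) := by gcongr
      _ ≤ |g y| * (2 * (‖k‖ ^ η * ‖latticeVec y‖ ^ η)) := by gcongr
      _ = _ := by ring
  · rw [tsum_mul_left]
    have := h.moment_le
    have h0 : 0 ≤ ‖k‖ ^ η := Real.rpow_nonneg (norm_nonneg _) _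
    nlinarith

/-! ### Gaussian integrals of quadratic forms -/

/-- The covariance operator of `Q`. -/
def covOp {d : ℕ} (Q : ZSpace d → ℝ) : RSpace d →ₗ[ℝ] RSpace d :=
  Matrix.toEuclideanLin (Matrix.of fun i j : Fin d => ∑' y, Q y * ((y i : ℝ) * (y j : ℝ) / 2))

theorem inner_covOp {d : ℕ} {Q : ZSpace d → ℝ}
    (hQ : Summable fun y => ‖latticeVec y‖ ^ 2 * |Q y|) (k l : RSpace d) :
    inner ℝ k (covOp Q l) =
      ∑' y, Q y * (inner ℝ k (latticeVec y) * inner ℝ l (latticeVec y) / 2) := by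
  have hs : ∀ i j, Summable fun y : ZSpace d => Q y * ((y i : ℝ) * (y j : ℝ) / 2) := fun i j => by
    refine Summable.of_norm_bounded hQ fun y => ?_
    rw [norm_mul, Real.norm_eq_abs, Real.norm_eq_abs, abs_div, abs_mul]
    have h1 : |(y i : ℝ)| ≤ ‖latticeVec y‖ := abs_apply_le_norm (latticeVec y) i
    have h2 : |(y j : ℝ)| ≤ ‖latticeVec y‖ := abs_apply_le_norm (latticeVec y) j
    have h3 : |(y i : ℝ)| * |(y j : ℝ)| / |(2 : ℝ)| ≤ ‖latticeVec y‖ ^ 2 := by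
      rw [abs_of_pos (by norm_num : (0 : ℝ) < 2)]
      nlinarith [mul_le_mul h1 h2 (abs_nonneg _) (norm_nonneg _), abs_nonneg (y i : ℝ),
        abs_nonneg (y j : ℝ), mul_nonneg (abs_nonneg (y i : ℝ)) (abs_nonneg (y j : ℝ))]
    calc _ ≤ |Q y| * ‖latticeVec y‖ ^ 2 := by gcongr
      _ = _ := mul_comm _ _
  have e : ∀ y : ZSpace d, Q y * (inner ℝ k (latticeVec y) * inner ℝ l (latticeVec y) / 2)
      = ∑ i, ∑ j, k i * (Q y * ((y i : ℝ) * (y j : ℝ) / 2) * l j) := fun y => by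
    rw [inner_latticeVec, inner_latticeVec, Finset.sum_mul_sum, Finset.sum_div, Finset.mul_sum]
    refine Finset.sum_congr rfl fun i _ => ?_
    rw [Finset.sum_div, Finset.mul_sum]
    exact Finset.sum_congr rfl fun j _ => by ring
  simp_rw [e]
  rw [Summable.tsum_finsetSum fun i _ =>
    summable_sum fun j _ => ((hs i j).mul_right _).mul_left _]
  rw [PiLp.inner_apply]
  refine Finset.sum_congr rfl fun i _ => ?_
  rw [Summable.tsum_finsetSum fun j _ => ((hs i j).mul_right _).mul_left _]
  simp only [tsum_mul_left, tsum_mul_right, covOp, Matrix.toLpLin_apply,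
    Matrix.mulVec, dotProduct, Matrix.of_apply]
  rw [← Finset.mul_sum]
  simp [mul_comm]

theorem covOp_isSymmetric {d : ℕ} {Q : ZSpace d → ℝ}
    (hQ : Summable fun y => ‖latticeVec y‖ ^ 2 * |Q y|) : (covOp Q).IsSymmetric := fun k l => by
  rw [inner_covOp hQ, real_inner_comm, inner_covOp hQ]
  congr 1; ext y; ring

theorem inner_covOp_self {d : ℕ} {Q : ZSpace d → ℝ}
    (hQ : Summable fun y => ‖latticeVec y‖ ^ 2 * |Q y|) (k : RSpace d) :
    inner ℝ k (covOp Q k) = covForm Q k := by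
  rw [inner_covOp hQ, covForm]
  congr 1; ext y; ring

/-- The Fourier transform of the Gaussian `exp(-t q(k))`. -/
theorem exists_gaussian_integral {d : ℕ} {Q : ZSpace d → ℝ} {K M t : ℝ} (hK : 0 < K)
    (ht : 0 < t) (hQ : Summable fun y => ‖latticeVec y‖ ^ 2 * |Q y|)
    (hlow : ∀ k : RSpace d, K * ‖k‖ ^ 2 ≤ covForm Q k)
    (hup : ∀ k : RSpace d, covForm Q k ≤ M * ‖k‖ ^ 2) (z : RSpace d) :
    ∃ r : ℝ, ∫ k : RSpace d, Complex.exp (-((t * covForm Q k : ℝ) : ℂ) +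
        Complex.I * ((inner ℝ k z : ℝ) : ℂ)) = (r : ℂ) ∧
      √(Real.pi / (t * M)) ^ d * Real.exp (-(‖z‖ ^ 2 / (4 * t * K))) ≤ r := by
  have hsym := covOp_isSymmetric hQ
  have hn : Module.finrank ℝ (RSpace d) = d := by simp
  -- In an orthonormal eigenbasis the integral factorises into one-dimensional Gaussians. The two
  -- bounds on the form place each eigenvalue in [K, M], which makes the lower bound on the product
  -- uniform.
  set b := hsym.eigenvectorBasis hn with hb
  set lam := hsym.eigenvalues hn with hlam
  have hq : ∀ k : RSpace d, covForm Q k = ∑ i, lam i * (b.repr k i) ^ 2 := fun k => by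
    rw [← inner_covOp_self hQ, ← b.repr.inner_map_map, PiLp.inner_apply]
    refine Finset.sum_congr rfl fun i _ => ?_
    rw [hsym.eigenvectorBasis_apply_self_apply hn]
    simp [hb, hlam]; ring
  have hlb : ∀ i, K ≤ lam i ∧ lam i ≤ M := fun i => by
    have h1 := hlow (b i)
    have h2 := hup (b i)
    have h3 : covForm Q (b i) = lam i := by
      rw [hq, Finset.sum_eq_single i]
      · simp
      · intro j _ hj
        simp [OrthonormalBasis.repr_self, hj]
      · simp
    rw [h3, b.norm_eq_one] at h1 h2
    constructor <;> linarith
  have hlam0 : ∀ i, 0 < t * lam i := fun i => mul_pos ht (hK.trans_le (hlb i).1)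
  refine ⟨∏ i, √(Real.pi / (t * lam i)) *
    Real.exp (-((b.repr z i) ^ 2 / (4 * (t * lam i)))), ?_, ?_⟩
  · have e1 : ∫ k : RSpace d, Complex.exp (-((t * covForm Q k : ℝ) : ℂ) +
        Complex.I * ((inner ℝ k z : ℝ) : ℂ))
        = ∫ u : RSpace d, Complex.exp (-∑ i, ((t * lam i : ℝ) : ℂ) * ((u i : ℝ) : ℂ) ^ 2
          + ∑ i, (Complex.I * (b.repr z i : ℂ)) * (u i : ℂ)) := by
      symm
      rw [← b.repr.measurePreserving.integral_comp b.repr.toHomeomorph.measurableEmbedding]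
      congr 1; ext k
      rw [hq, ← b.repr.inner_map_map, PiLp.inner_apply]
      congr 1
      push_cast
      simp only [Finset.mul_sum]
      congr 1
      · rw [neg_inj]
        exact Finset.sum_congr rfl fun i _ => by ring
      · refine Finset.sum_congr rfl fun i _ => ?_
        simp; ring
    rw [e1, ← (PiLp.volume_preserving_toLp (Fin d)).integral_comp
      (MeasurableEquiv.toLp 2 _).measurableEmbedding]
    have := GaussianFourier.integral_cexp_neg_sum_mul_add (ι := Fin d)
      (b := fun i => ((t * lam i : ℝ) : ℂ)) (fun i => by simpa using hlam0 i)
      (fun i => Complex.I * (b.repr z i : ℂ))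
    refine this.trans ?_
    rw [Complex.ofReal_prod]
    refine Finset.prod_congr rfl fun i _ => ?_
    rw [show ((√(Real.pi / (t * lam i)) * Real.exp (-((b.repr z i) ^ 2 / (4 * (t * lam i)))) : ℝ) : ℂ)
      = ((√(Real.pi / (t * lam i)) : ℝ) : ℂ)
        * Complex.exp ((-((b.repr z i) ^ 2 / (4 * (t * lam i))) : ℝ) : ℂ) by
      rw [Complex.ofReal_mul, Complex.ofReal_exp]]
    congr 1
    · rw [Real.sqrt_eq_rpow, Complex.ofReal_cpow (by have := hlam0 i; positivity)]
      push_cast; rfl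
    · congr 1
      rw [mul_pow, Complex.I_sq]; push_cast; ring
  · rw [Finset.prod_mul_distrib, ← Real.exp_sum]
    have hz : ∑ i, (b.repr z i) ^ 2 = ‖z‖ ^ 2 := by
      rw [← b.repr.norm_map z, EuclideanSpace.norm_sq_eq]
      simp
    refine mul_le_mul ?_ ?_ (Real.exp_pos _).le (Finset.prod_nonneg fun i _ => Real.sqrt_nonneg _)
    · calc √(Real.pi / (t * M)) ^ d = ∏ _i : Fin d, √(Real.pi / (t * M)) := by simp
        _ ≤ _ := by
          refine Finset.prod_le_prod (fun i _ => Real.sqrt_nonneg _) fun i _ => ?_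
          refine Real.sqrt_le_sqrt ?_
          have := hlam0 i
          have := (hlb i).2
          gcongr
    · rw [Real.exp_le_exp, ← hz, Finset.sum_div, ← Finset.sum_neg_distrib]
      refine Finset.sum_le_sum fun i _ => ?_
      rw [neg_le_neg_iff, mul_assoc]
      have := (hlb i).1
      gcongr

/-! ### The local central limit theorem -/

theorem continuous_covForm {d : ℕ} {Q : ZSpace d → ℝ}
    (hQ : Summable fun y => ‖latticeVec y‖ ^ 2 * |Q y|) : Continuous (covForm Q) := by
  have h : covForm Q = fun k => inner ℝ k (covOp Q k) :=
    funext fun k => (inner_covOp_self hQ k).symm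
  rw [h]
  have := LinearMap.continuous_of_finiteDimensional (covOp Q)
  fun_prop

theorem rpow_le_one_add_cube {s e : ℝ} (hs : 0 ≤ s) (he : 0 ≤ e) (he3 : e ≤ 3) :
    s ^ e ≤ (1 + s) ^ 3 := by
  calc s ^ e ≤ (1 + s) ^ e := Real.rpow_le_rpow hs (by linarith) he
    _ ≤ (1 + s) ^ (3 : ℝ) := Real.rpow_le_rpow_of_exponent_le (by linarith) he3
    _ = _ := by norm_cast

/-- In the parabolic variable √t k, the source error ‖k‖^η and the symbol error t‖k‖^{2+η} each
produce the factor t^{-η/2}, times a power absorbed by (1 + √t‖k‖)³. The drift contributes only a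
phase after recentring. -/
theorem gaussian_error_le {d : ℕ} {M K η p : ℝ} {a : ℕ} (hM : 0 < M) (hη : 0 < η)
    (hη1 : η ≤ 1) {Q g : ZSpace d → ℝ} (hQ : KernelClass M K η p a Q) (hg : SourceClass M η a g)
    {t : ℝ} (ht : 1 ≤ t) (x : ZSpace d) (k : RSpace d) :
    ‖(torusBox d).indicator (fun k => latticeFourier g k *
        Complex.exp (t * (latticeFourier Q k - latticeFourier Q 0)) * chr k x) k
      - latticeFourier g 0 * Complex.exp (-((t * covForm Q k : ℝ) : ℂ) +
        Complex.I * ((inner ℝ k (latticeVec x - t • drift Q) : ℝ) : ℂ))‖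
      ≤ (2 * M + 4 * M * M) * t ^ (-(η / 2)) *
        ((1 + √t * ‖k‖) ^ 3 * Real.exp (-(t * K * ‖k‖ ^ 2))) := by
  have ht0 : 0 < t := by linarith
  have hlow := hQ.le_covForm hη hη1 k
  have hg0 : ‖latticeFourier g 0‖ ≤ M := (norm_latticeFourier_le hg.summable 0).trans hg.norm_le
  have hsk : 0 ≤ √t * ‖k‖ := by positivity
  have htη : 0 < t ^ (-(η / 2)) := Real.rpow_pos_of_pos ht0 _
  have e1 : ‖k‖ ^ η = t ^ (-(η / 2)) * (√t * ‖k‖) ^ η := by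
    rw [Real.mul_rpow (Real.sqrt_nonneg _) (norm_nonneg _), Real.sqrt_eq_rpow,
      ← Real.rpow_mul ht0.le, ← mul_assoc, ← Real.rpow_add ht0]
    ring_nf; simp
  have e2 : t * ‖k‖ ^ (2 + η) = t ^ (-(η / 2)) * (√t * ‖k‖) ^ (2 + η) := by
    rw [Real.mul_rpow (Real.sqrt_nonneg _) (norm_nonneg _), Real.sqrt_eq_rpow,
      ← Real.rpow_mul ht0.le, ← mul_assoc, ← Real.rpow_add ht0]
    ring_nf; rw [Real.rpow_one]; ring
  have b1 : ‖k‖ ^ η ≤ t ^ (-(η / 2)) * (1 + √t * ‖k‖) ^ 3 := by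
    rw [e1]; gcongr; exact rpow_le_one_add_cube hsk hη.le (by linarith)
  have b2 : t * ‖k‖ ^ (2 + η) ≤ t ^ (-(η / 2)) * (1 + √t * ‖k‖) ^ 3 := by
    rw [e2]; gcongr; exact rpow_le_one_add_cube hsk (by linarith) (by linarith)
  have hgauss : Real.exp (-(t * covForm Q k)) ≤ Real.exp (-(t * K * ‖k‖ ^ 2)) := by
    rw [Real.exp_le_exp]; nlinarith
  set z := latticeVec x - t • drift Q with hz
  have hphase : ∀ w : ℝ, ‖Complex.exp (Complex.I * (w : ℂ))‖ = 1 := fun w => by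
    rw [mul_comm]; exact Complex.norm_exp_ofReal_mul_I w
  set E := Real.exp (-(t * K * ‖k‖ ^ 2)) with hE
  have hE0 : 0 < E := Real.exp_pos _
  by_cases hk : k ∈ torusBox d
  · rw [Set.indicator_of_mem hk]
    set B : ℂ := latticeFourier Q 0 - latticeFourier Q k
      - Complex.I * ((inner ℝ k (drift Q) : ℝ) : ℂ) with hB
    have hBre : B.re = (latticeFourier Q 0 - latticeFourier Q k).re := by
      simp [hB]
    have c1 : Complex.exp (t * (latticeFourier Q k - latticeFourier Q 0)) * chr k x
        = Complex.exp (-(t * B)) * Complex.exp (Complex.I * ((inner ℝ k z : ℝ) : ℂ)) := by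
      rw [chr, ← Complex.exp_add, ← Complex.exp_add, hz, inner_sub_right, real_inner_smul_right, hB]
      push_cast; ring_nf
    have c2 : latticeFourier g k * Complex.exp (t * (latticeFourier Q k - latticeFourier Q 0))
          * chr k x
        - latticeFourier g 0 * Complex.exp (-((t * covForm Q k : ℝ) : ℂ) +
          Complex.I * ((inner ℝ k z : ℝ) : ℂ))
        = ((latticeFourier g k - latticeFourier g 0) * Complex.exp (-(t * B))
          + latticeFourier g 0 * (Complex.exp (-(t * B))
            - Complex.exp (-((t * covForm Q k : ℝ) : ℂ))))
          * Complex.exp (Complex.I * ((inner ℝ k z : ℝ) : ℂ)) := by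
      rw [mul_assoc, c1, Complex.exp_add]; ring
    rw [c2, norm_mul, hphase, mul_one]
    have hre1 : t * K * ‖k‖ ^ 2 ≤ ((t : ℂ) * B).re := by
      rw [Complex.re_ofReal_mul, hBre]
      have := hQ.infrared k hk
      nlinarith
    have hre2 : t * K * ‖k‖ ^ 2 ≤ (((t * covForm Q k : ℝ)) : ℂ).re := by
      rw [Complex.ofReal_re]; nlinarith
    have d1 : ‖Complex.exp (-(t * B))‖ ≤ E := by
      rw [Complex.norm_exp, hE, Real.exp_le_exp, Complex.neg_re]; linarith
    have d2 : ‖Complex.exp (-(t * B)) - Complex.exp (-((t * covForm Q k : ℝ) : ℂ))‖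
        ≤ E * (4 * M * (t * ‖k‖ ^ (2 + η))) := by
      refine (norm_exp_neg_sub_le hre1 hre2).trans ?_
      have : (t : ℂ) * B - ((t * covForm Q k : ℝ) : ℂ) = t * (B - ((covForm Q k : ℝ) : ℂ)) := by
        push_cast; ring
      rw [this, norm_mul, Complex.norm_real, Real.norm_of_nonneg ht0.le]
      have h5 := hQ.symbol_sub_le hη hη1 k
      rw [← hB] at h5
      calc E * (t * ‖B - ((covForm Q k : ℝ) : ℂ)‖) ≤ E * (t * (4 * M * ‖k‖ ^ (2 + η))) := by gcongr
        _ = _ := by ring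
    calc _ ≤ ‖latticeFourier g k - latticeFourier g 0‖ * ‖Complex.exp (-(t * B))‖
          + ‖latticeFourier g 0‖ * ‖Complex.exp (-(t * B))
            - Complex.exp (-((t * covForm Q k : ℝ) : ℂ))‖ := by
          refine (norm_add_le _ _).trans ?_
          rw [norm_mul, norm_mul]
      _ ≤ (2 * M * ‖k‖ ^ η) * E + M * (E * (4 * M * (t * ‖k‖ ^ (2 + η)))) := by
          gcongr
          exact hg.fourier_sub_le hη hη1 k
      _ ≤ (2 * M * (t ^ (-(η / 2)) * (1 + √t * ‖k‖) ^ 3)) * E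
          + M * (E * (4 * M * (t ^ (-(η / 2)) * (1 + √t * ‖k‖) ^ 3))) := by gcongr
      _ = _ := by ring
  · rw [Set.indicator_of_notMem hk, zero_sub, norm_neg, norm_mul, Complex.exp_add, norm_mul,
      hphase, mul_one, ← Complex.ofReal_neg, Complex.norm_exp_ofReal]
    -- Off the box only the Gaussian tail remains. There ‖k‖^η ≥ 1 can be inserted at no cost, and
    -- it supplies the same factor t^{-η/2}.
    have hk1 : 1 ≤ ‖k‖ := by
      simp only [torusBox, Set.mem_ofPred_eq, not_forall, not_le] at hk
      obtain ⟨i, hi⟩ := hk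
      linarith [abs_apply_le_norm k i, Real.pi_gt_three]
    have h1 : 1 ≤ ‖k‖ ^ η := Real.one_le_rpow hk1 hη.le
    calc _ ≤ M * E := by gcongr
      _ = M * 1 * E := by ring
      _ ≤ M * (t ^ (-(η / 2)) * (1 + √t * ‖k‖) ^ 3) * E := by gcongr; exact h1.trans b1
      _ ≤ (2 * M + 4 * M * M) * (t ^ (-(η / 2)) * (1 + √t * ‖k‖) ^ 3) * E := by
          gcongr; nlinarith
      _ = _ := by ring

/-- The local central limit theorem, as a lower bound for the kernel with a source. -/
theorem re_sourceKernel_ge (d : ℕ) {M K η p : ℝ} {a : ℕ} (hM : 0 < M) (hK : 0 < K) (hη : 0 < η)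
    (hη1 : η ≤ 1) :
    ∃ c C, 0 < c ∧ 0 < C ∧ ∀ Q g : ZSpace d → ℝ, KernelClass M K η p a Q → SourceClass M η a g →
      M⁻¹ ≤ (latticeFourier g 0).re → ∀ t : ℝ, 1 ≤ t → ∀ x,
        c * t ^ (-(d : ℝ) / 2) * Real.exp (-(‖latticeVec x - t • drift Q‖ ^ 2 / (4 * t * K)))
          - C * t ^ (-(d : ℝ) / 2 - η / 2) ≤ (sourceKernel Q g t x).re := by
  obtain ⟨C, hC0, hC⟩ := gaussian_moment_scaling d 3 hK
  set w : ℝ := (2 * Real.pi)⁻¹ ^ d with hw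
  have hw0 : 0 < w := by positivity
  refine ⟨w * M⁻¹ * √(Real.pi / M) ^ d, w * ((2 * M + 4 * M * M) * C), by positivity, by positivity,
    fun Q g hQ hg hglow t ht x => ?_⟩
  have ht0 : 0 < t := by linarith
  have h2 := hQ.summable_sq hη
  set z := latticeVec x - t • drift Q with hz
  obtain ⟨r, hr1, hr2⟩ := exists_gaussian_integral hK ht0 h2 (hQ.le_covForm hη hη1)
    (covForm_le h2 (hQ.sq_le hη)) z
  set F1 : RSpace d → ℂ := fun k => latticeFourier g k *
        Complex.exp (t * (latticeFourier Q k - latticeFourier Q 0)) * chr k x with hF1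
  set F2 : RSpace d → ℂ := fun k => latticeFourier g 0 *
    Complex.exp (-((t * covForm Q k : ℝ) : ℂ) + Complex.I * ((inner ℝ k z : ℝ) : ℂ)) with hF2
  have hcont : Continuous F1 :=
    ((continuous_latticeFourier hg.summable).mul (continuous_heat hQ.summable t)).mul
      (continuous_chr x)
  have hI1 : Integrable ((torusBox d).indicator F1) :=
    (integrable_indicator_iff (measurableSet_torusBox d)).mpr (integrableOn_torusBox hcont)
  have hI2 : Integrable F2 := by
    have hcf := continuous_covForm h2
    refine ((integrable_exp_neg_mul_sq_norm (d := d) (mul_pos ht0 hK)).const_mul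
      ‖latticeFourier g 0‖).mono' (by fun_prop) (Filter.Eventually.of_forall fun k => ?_)
    rw [hF2, norm_mul, Complex.norm_exp]
    gcongr
    have := hQ.le_covForm hη hη1 k
    simp only [Complex.add_re, Complex.neg_re, Complex.ofReal_re, Complex.I_mul_re,
      Complex.ofReal_im, neg_zero, add_zero, neg_le_neg_iff]
    nlinarith
  obtain ⟨hi, hle⟩ := hC t ht0
  have hdiff : ‖(∫ k in torusBox d, F1 k) - latticeFourier g 0 * r‖
      ≤ (2 * M + 4 * M * M) * t ^ (-(η / 2)) * (C * t ^ (-(d : ℝ) / 2)) := by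
    have e1 : (∫ k in torusBox d, F1 k) - latticeFourier g 0 * r
        = ∫ k, ((torusBox d).indicator F1 k - F2 k) := by
      rw [integral_sub hI1 hI2, integral_indicator (measurableSet_torusBox d), ← hr1,
        ← integral_const_mul]
    rw [e1]
    refine (norm_integral_le_of_norm_le
      (hi.const_mul ((2 * M + 4 * M * M) * t ^ (-(η / 2))))
      (Filter.Eventually.of_forall fun k => gaussian_error_le hM hη hη1 hQ hg ht x k)).trans ?_
    rw [integral_const_mul]
    gcongr
  have hP : sourceKernel Q g t x = (w : ℂ) * ∫ k in torusBox d, F1 k := by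
    rw [sourceKernel, invFourier, hw]; push_cast; rfl
  have hr0 : 0 ≤ r := le_trans (by positivity) hr2
  have hreal : (latticeFourier g 0 * r).re = (latticeFourier g 0).re * r := by
    rw [latticeFourier_zero, ← Complex.ofReal_mul, Complex.ofReal_re, Complex.ofReal_re]
  have hmain : (latticeFourier g 0).re * r
      - (2 * M + 4 * M * M) * t ^ (-(η / 2)) * (C * t ^ (-(d : ℝ) / 2))
      ≤ (∫ k in torusBox d, F1 k).re := by
    have h5 := (Complex.abs_re_le_norm _).trans hdiff
    rw [Complex.sub_re, hreal] at h5
    linarith [(abs_le.mp h5).1]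
  have e3 : √(Real.pi / (t * M)) ^ d = √(Real.pi / M) ^ d * t ^ (-(d : ℝ) / 2) := by
    have : Real.pi / (t * M) = Real.pi / M * t⁻¹ := by field_simp
    rw [this, Real.sqrt_mul (by positivity), mul_pow, Real.sqrt_inv, inv_pow,
      sqrt_pow_eq_rpow ht0.le, ← Real.rpow_neg ht0.le]
    congr 2; ring
  rw [e3] at hr2
  rw [hP, Complex.re_ofReal_mul]
  have e4 : t ^ (-(d : ℝ) / 2 - η / 2) = t ^ (-(η / 2)) * t ^ (-(d : ℝ) / 2) := by
    rw [← Real.rpow_add ht0]; congr 1; ring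
  rw [e4]
  have hM1 : 0 < M⁻¹ := inv_pos.mpr hM
  calc _ = w * (M⁻¹ * (√(Real.pi / M) ^ d * t ^ (-(d : ℝ) / 2)
          * Real.exp (-(‖z‖ ^ 2 / (4 * t * K))))
        - (2 * M + 4 * M * M) * t ^ (-(η / 2)) * (C * t ^ (-(d : ℝ) / 2))) := by ring
    _ ≤ w * ((latticeFourier g 0).re * r
        - (2 * M + 4 * M * M) * t ^ (-(η / 2)) * (C * t ^ (-(d : ℝ) / 2))) := by
        gcongr
        exact hM1.le.trans hglow
    _ ≤ _ := by gcongr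

/-! ### From norm bounds to summability -/

theorem latticeNorm_le_iff {d : ℕ} {f : ZSpace d → ℝ} {p M : ℝ} (hp : 0 < p) (hM : 0 ≤ M)
    (h : latticeNorm f p ≤ ENNReal.ofReal M) :
    Summable (fun y => |f y| ^ p) ∧ ∑' y, |f y| ^ p ≤ M ^ p := by
  have h0 : ENNReal.ofReal p ≠ 0 := by simpa using hp
  rw [latticeNorm, eLpNorm_eq_lintegral_rpow_enorm_toReal h0 ENNReal.ofReal_ne_top,
    lintegral_count, ENNReal.toReal_ofReal hp.le] at h
  have h1 : ∑' y, ENNReal.ofReal (|f y| ^ p) ≤ ENNReal.ofReal (M ^ p) := by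
    have h2 := ENNReal.rpow_le_rpow h hp.le
    rw [← ENNReal.rpow_mul, one_div_mul_cancel hp.ne', ENNReal.rpow_one,
      ENNReal.ofReal_rpow_of_nonneg hM hp.le] at h2
    refine le_trans (le_of_eq ?_) h2
    congr 1; ext y
    rw [← ENNReal.ofReal_rpow_of_nonneg (abs_nonneg _) hp.le, Real.enorm_eq_ofReal_abs]
  have hnn : ∀ y, 0 ≤ |f y| ^ p := fun y => Real.rpow_nonneg (abs_nonneg _) _
  have hne : ∑' y, ENNReal.ofReal (|f y| ^ p) ≠ ∞ := ne_top_of_le_ne_top ENNReal.ofReal_ne_top h1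
  have hs : Summable fun y => |f y| ^ p := by
    have := ENNReal.summable_toReal hne
    simpa only [ENNReal.toReal_ofReal (hnn _)] using this
  refine ⟨hs, ?_⟩
  rw [← ENNReal.ofReal_tsum_of_nonneg hnn hs] at h1
  exact (ENNReal.ofReal_le_ofReal_iff (Real.rpow_nonneg hM _)).mp h1

theorem summable_of_latticeNorm_one {d : ℕ} {f : ZSpace d → ℝ} {M : ℝ} (hM : 0 ≤ M)
    (h : latticeNorm f 1 ≤ ENNReal.ofReal M) :
    Summable (fun y => |f y|) ∧ ∑' y, |f y| ≤ M := by
  simpa using latticeNorm_le_iff one_pos hM h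

/-- Each term is at most M, so f² ≤ M^{2-q} f^q. This brings the second moment of g, given in
ℓ^{min(p_d,2)}, into ℓ² when d ≤ 3. -/
theorem tsum_sq_le_of_tsum_rpow_le {ι : Type*} {f : ι → ℝ} {q M : ℝ} (hf : ∀ i, 0 ≤ f i)
    (hq : 0 < q) (hq2 : q ≤ 2) (hM : 0 < M) (hs : Summable fun i => f i ^ q)
    (hle : ∑' i, f i ^ q ≤ M ^ q) :
    Summable (fun i => f i ^ (2 : ℝ)) ∧ ∑' i, f i ^ (2 : ℝ) ≤ M ^ (2 : ℝ) := by
  have hfM : ∀ i, f i ≤ M := fun i => by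
    have : f i ^ q ≤ M ^ q :=
      (hs.le_tsum i fun j _ => Real.rpow_nonneg (hf j) _).trans hle
    exact (Real.rpow_le_rpow_iff (hf i) hM.le hq).mp this
  have h1 : ∀ i, f i ^ (2 : ℝ) ≤ M ^ (2 - q) * f i ^ q := fun i => by
    rcases (hf i).eq_or_lt with h | h
    · rw [← h, Real.zero_rpow (by norm_num), Real.zero_rpow hq.ne', mul_zero]
    · have : f i ^ (2 : ℝ) = f i ^ (2 - q) * f i ^ q := by
        rw [← Real.rpow_add h]; congr 1; ring
      rw [this]
      exact mul_le_mul_of_nonneg_right (Real.rpow_le_rpow (hf i) (hfM i) (by linarith))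
        (Real.rpow_nonneg (hf i) _)
  have hs2 : Summable fun i => f i ^ (2 : ℝ) :=
    Summable.of_nonneg_of_le (fun i => Real.rpow_nonneg (hf i) _) h1 (hs.mul_left _)
  refine ⟨hs2, (hs2.tsum_le_tsum h1 (hs.mul_left _)).trans ?_⟩
  rw [tsum_mul_left]
  calc _ ≤ M ^ (2 - q) * M ^ q := by gcongr
    _ = _ := by rw [← Real.rpow_add hM]; congr 1; ring

/-- The order of spatial decay of the kernel that is used in dimension `d`. -/
def decayOrder (d : ℕ) : ℕ := max 2 (d - 1)

/-- The exponent of the norm that controls the highest moment of the generator. -/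
def highExp (d : ℕ) : ℝ := if d ≤ 3 then 1 else min ((d : ℝ) / 3) 2

theorem one_le_highExp (d : ℕ) : 1 ≤ highExp d := by
  unfold highExp
  split_ifs with h
  · exact le_rfl
  · have : (4 : ℝ) ≤ d := by exact_mod_cast (not_le.mp h)
    exact le_min (by linarith) (by norm_num)

theorem decayOrder_of_le {d : ℕ} (h : d ≤ 3) : decayOrder d = 2 := by
  unfold decayOrder; omega

theorem decayOrder_of_ge {d : ℕ} (h : 3 ≤ d) : decayOrder d = d - 1 := by
  unfold decayOrder; omega

/-- With a = 2 and p = 1 it is an equality for d ≤ 3. For d ≥ 4 one has a - d = -1, and p ≤ d/3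
gives d/p ≥ 3. -/
theorem highExp_condition {d : ℕ} : 2 ≤ (decayOrder d : ℝ) - d + d / highExp d := by
  by_cases h : d ≤ 3
  · rw [decayOrder_of_le h, highExp, if_pos h]; push_cast; linarith
  · have h4 : (4 : ℝ) ≤ d := by exact_mod_cast (not_le.mp h)
    rw [decayOrder_of_ge (by omega), highExp, if_neg h, Nat.cast_sub (by omega)]
    push_cast
    have : 3 ≤ (d : ℝ) / min ((d : ℝ) / 3) 2 := by
      rw [le_div_iff₀ (lt_min (by linarith) (by norm_num))]
      linarith [min_le_left ((d : ℝ) / 3) 2]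
    linarith

theorem le_two_mul_decayOrder (d : ℕ) : (d : ℝ) ≤ 2 * decayOrder d := by
  have : d ≤ 2 * decayOrder d := by unfold decayOrder; omega
  exact_mod_cast this

theorem norm_rpow_le_rpow {d : ℕ} {s t : ℝ} (hs : 0 < s) (hst : s ≤ t) (y : ZSpace d) :
    ‖latticeVec y‖ ^ s ≤ ‖latticeVec y‖ ^ t := by
  by_cases h : y = 0
  · subst h; simp [Real.zero_rpow hs.ne', Real.zero_rpow (hs.trans_le hst).ne']
  · exact Real.rpow_le_rpow_of_exponent_le (one_le_norm_latticeVec h) hst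

theorem moment_mono {d : ℕ} {f : ZSpace d → ℝ} {s t M : ℝ} (hs : 0 < s) (hst : s ≤ t)
    (h1 : Summable fun y => ‖latticeVec y‖ ^ t * |f y|)
    (h2 : ∑' y, ‖latticeVec y‖ ^ t * |f y| ≤ M) :
    Summable (fun y => ‖latticeVec y‖ ^ s * |f y|) ∧ ∑' y, ‖latticeVec y‖ ^ s * |f y| ≤ M := by
  have hle : ∀ y, ‖latticeVec y‖ ^ s * |f y| ≤ ‖latticeVec y‖ ^ t * |f y| := fun y =>
    mul_le_mul_of_nonneg_right (norm_rpow_le_rpow hs hst y) (abs_nonneg _)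
  have h3 : Summable fun y => ‖latticeVec y‖ ^ s * |f y| :=
    Summable.of_nonneg_of_le (fun y => by positivity) hle h1
  exact ⟨h3, (h3.tsum_le_tsum hle h1).trans h2⟩

/-- The moment exponent is capped at 1 because the Taylor remainder of order 2 + η is used only for
η ≤ 1. For d ≤ 3 the high moment is the ordinary second moment in ℓ¹, a consequence of the moment of
order 2 + ζ; only for d ≥ 4 is the separate hypothesis needed. -/
theorem MomentClass.kernelClass {d : ℕ} {M K ζ : ℝ} (hM : 0 < M) (hζ : 0 < ζ)
    {Q g : ZSpace d → ℝ} (h : MomentClass M K ζ Q g) :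
    KernelClass M K (min ζ 1) (highExp d) (decayOrder d) Q := by
  obtain ⟨h1, h2⟩ := summable_of_latticeNorm_one hM.le h.Q_norm
  obtain ⟨h3, h4⟩ := summable_of_latticeNorm_one hM.le h.Q_moment
  have e : ∀ y : ZSpace d, |‖latticeVec y‖ ^ (2 + ζ) * Q y| = ‖latticeVec y‖ ^ (2 + ζ) * |Q y| :=
    fun y => by rw [abs_mul, abs_of_nonneg (by positivity)]
  simp only [e] at h3 h4
  have hη : 0 < min ζ 1 := lt_min hζ one_pos
  obtain ⟨h5, h6⟩ := moment_mono (show 0 < 2 + min ζ 1 by positivity)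
    (by gcongr; exact min_le_left _ _) h3 h4
  have hhigh : Summable (fun y => (‖latticeVec y‖ ^ decayOrder d * |Q y|) ^ highExp d) ∧
      ∑' y, (‖latticeVec y‖ ^ decayOrder d * |Q y|) ^ highExp d ≤ M ^ highExp d := by
    by_cases hd : d ≤ 3
    · rw [decayOrder_of_le hd, highExp, if_pos hd]
      simp only [Real.rpow_one]
      have := moment_mono (f := Q) (show (0 : ℝ) < 2 by norm_num)
        (show (2 : ℝ) ≤ 2 + ζ by linarith) h3 h4
      simpa only [Real.rpow_two] using this
    · have := latticeNorm_le_iff (lt_of_lt_of_le one_pos (by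
        simpa only [highExp, if_neg hd] using one_le_highExp d)) hM.le (h.Q_high (by omega))
      rw [decayOrder_of_ge (by omega), highExp, if_neg hd]
      simpa only [abs_mul, abs_pow, abs_norm] using this
  exact ⟨h1.of_abs, h2, h5, h6, hhigh.1, hhigh.2, fun k hk => h.infrared k hk⟩

theorem MomentClass.sourceClass {d : ℕ} (hd1 : 1 ≤ d) {M K ζ : ℝ} (hM : 0 < M) (hζ : 0 < ζ)
    {Q g : ZSpace d → ℝ} (h : MomentClass M K ζ Q g) :
    SourceClass M (min ζ 1) (decayOrder d) g := by
  obtain ⟨h1, h2⟩ := summable_of_latticeNorm_one hM.le h.g_norm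
  obtain ⟨h3, h4⟩ := summable_of_latticeNorm_one hM.le h.g_moment
  have e : ∀ y : ZSpace d, |‖latticeVec y‖ ^ ζ * g y| = ‖latticeVec y‖ ^ ζ * |g y| :=
    fun y => by rw [abs_mul, abs_of_nonneg (by positivity)]
  simp only [e] at h3 h4
  have hη : 0 < min ζ 1 := lt_min hζ one_pos
  obtain ⟨h5, h6⟩ := moment_mono hη (min_le_left _ _) h3 h4
  have hhigh : Summable (fun y => (‖latticeVec y‖ ^ decayOrder d * |g y|) ^ (2 : ℝ)) ∧
      ∑' y, (‖latticeVec y‖ ^ decayOrder d * |g y|) ^ (2 : ℝ) ≤ M ^ (2 : ℝ) := by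
    by_cases hd : d ≤ 3
    · rw [decayOrder_of_le hd]
      have hq : 0 < pExp d ζ := by
        unfold pExp
        split_ifs with h0
        · norm_num
        · have : (2 : ℝ) ≤ d := by exact_mod_cast (show 2 ≤ d by omega)
          have : 0 < min ζ 2 := lt_min hζ (by norm_num)
          exact div_pos (by linarith) (by linarith)
      have hq' : 0 < min (pExp d ζ) 2 := lt_min hq (by norm_num)
      obtain ⟨h7, h8⟩ := latticeNorm_le_iff hq' hM.le h.g_second
      simp only [abs_mul, abs_pow, abs_norm] at h7 h8
      exact tsum_sq_le_of_tsum_rpow_le (fun y => by positivity) hq' (min_le_right _ _) hM h7 h8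
    · have := latticeNorm_le_iff (by norm_num) hM.le (h.g_high (by omega))
      rw [decayOrder_of_ge (by omega)]
      simpa only [abs_mul, abs_pow, abs_norm] using this
  exact ⟨h1.of_abs, h2, h5, h6, hhigh.1, hhigh.2⟩

/-! ### Symmetric functions, tilts and the susceptibility -/

/-- Change of sign of the coordinates in `s`. -/
def flipZ {d : ℕ} (s : Finset (Fin d)) (x : ZSpace d) : ZSpace d :=
  fun i => if i ∈ s then -x i else x i

/-- Change of sign of the coordinates in `s`. -/
def flipR {d : ℕ} (s : Finset (Fin d)) (μ : RSpace d) : RSpace d :=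
  WithLp.toLp 2 fun i => if i ∈ s then -μ i else μ i

theorem flipZ_involutive {d : ℕ} (s : Finset (Fin d)) : Function.Involutive (flipZ s) :=
  fun x => by ext i; by_cases h : i ∈ s <;> simp [flipZ, h]

theorem LatticeSymmetric.flip {d : ℕ} {f : ZSpace d → ℝ} (hf : LatticeSymmetric f)
    (s : Finset (Fin d)) (x : ZSpace d) : f (flipZ s x) = f x := by
  classical
  induction s using Finset.induction_on with
  | empty => congr 1
  | insert i s hi ih =>
    rw [← ih, ← hf.1 (flipZ s x) i]
    congr 1; ext j
    by_cases hj : j = i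
    · subst hj; rw [Function.update_self]; simp [flipZ, hi]
    · rw [Function.update_of_ne hj]; simp [flipZ, hj]

theorem LatticeSymmetric.neg {d : ℕ} {f : ZSpace d → ℝ} (hf : LatticeSymmetric f)
    (x : ZSpace d) : f (-x) = f x := by
  rw [← hf.flip Finset.univ x]; congr 1; ext i; simp [flipZ]

theorem inner_flipR {d : ℕ} (s : Finset (Fin d)) (μ : RSpace d) (x : ZSpace d) :
    inner ℝ (flipR s μ) (latticeVec x) = inner ℝ μ (latticeVec (flipZ s x)) := by
  rw [inner_latticeVec, inner_latticeVec]
  refine Finset.sum_congr rfl fun i _ => ?_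
  by_cases h : i ∈ s <;> simp [flipR, flipZ, h]

theorem mem_omegaSet_iff {d : ℕ} {S : ZSpace d → ℝ} (hS : ∀ x, 0 ≤ S x) (μ : RSpace d) :
    μ ∈ omegaSet S ↔ Summable (tilt μ S) := by
  have h0 : ∀ x, 0 ≤ tilt μ S x := fun x => mul_nonneg (hS x) (Real.exp_pos _).le
  rw [omegaSet, Set.mem_ofPred_eq, tiltedSusceptibility]
  constructor
  · intro h
    have := ENNReal.summable_toReal h.ne
    simpa only [ENNReal.toReal_ofReal (h0 _)] using this
  · intro h
    rw [← ENNReal.ofReal_tsum_of_nonneg h0 h]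
    exact ENNReal.ofReal_lt_top

theorem flipR_mem_omegaSet {d : ℕ} {S : ZSpace d → ℝ} (hS : ∀ x, 0 ≤ S x)
    (hsym : LatticeSymmetric S) (s : Finset (Fin d)) {μ : RSpace d} (h : μ ∈ omegaSet S) :
    flipR s μ ∈ omegaSet S := by
  rw [mem_omegaSet_iff hS] at h ⊢
  have := (flipZ_involutive s).toPerm.summable_iff.mpr h
  refine this.congr fun x => ?_
  simp only [Function.comp, tilt, Function.Involutive.coe_toPerm]
  rw [inner_flipR, hsym.flip]

theorem perm_mem_omegaSet {d : ℕ} {S : ZSpace d → ℝ} (hS : ∀ x, 0 ≤ S x)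
    (hsym : LatticeSymmetric S) (σ : Equiv.Perm (Fin d)) {μ : RSpace d} (h : μ ∈ omegaSet S) :
    (WithLp.toLp 2 fun i => μ (σ i) : RSpace d) ∈ omegaSet S := by
  rw [mem_omegaSet_iff hS] at h ⊢
  have := (Equiv.arrowCongr σ (Equiv.refl ℤ)).summable_iff.mpr h
  refine this.congr fun x => ?_
  have e : (Equiv.arrowCongr σ (Equiv.refl ℤ)) x = fun i => x (σ.symm i) := rfl
  simp only [Function.comp, e, tilt]
  rw [hsym.2 x σ.symm, inner_latticeVec, inner_latticeVec]
  congr 2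
  rw [← Equiv.sum_comp σ]
  simp

theorem convex_omegaSet {d : ℕ} {S : ZSpace d → ℝ} (hS : ∀ x, 0 ≤ S x) :
    Convex ℝ (omegaSet S) := by
  intro μ hμ ν hν a b ha hb hab
  rw [mem_omegaSet_iff hS] at hμ hν ⊢
  refine Summable.of_nonneg_of_le (fun x => mul_nonneg (hS x) (Real.exp_pos _).le) (fun x => ?_)
    ((hμ.mul_left a).add (hν.mul_left b))
  have h := convexOn_exp.2 (Set.mem_univ (inner ℝ μ (latticeVec x)))
    (Set.mem_univ (inner ℝ ν (latticeVec x))) ha hb hab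
  simp only [smul_eq_mul] at h
  rw [tilt, inner_add_left, real_inner_smul_left, real_inner_smul_left]
  calc _ ≤ S x * (a * Real.exp (inner ℝ μ (latticeVec x))
        + b * Real.exp (inner ℝ ν (latticeVec x))) := mul_le_mul_of_nonneg_left h (hS x)
    _ = _ := by simp only [tilt]; ring

/-! ### Tilted convolution equation -/

theorem latticeFourier_conv {d : ℕ} {f h : ZSpace d → ℝ} (hf : Summable f) (hh : Summable h)
    (k : RSpace d) :
    latticeFourier (latticeConv f h) k = latticeFourier f k * latticeFourier h k := by
  set φ : ZSpace d → ℂ := fun y => (f y : ℂ) * chr k (-y) with hφ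
  set ψ : ZSpace d → ℂ := fun y => (h y : ℂ) * chr k (-y) with hψ
  have hφn : Summable fun y => ‖φ y‖ := by simpa [hφ] using hf.abs
  have hψn : Summable fun y => ‖ψ y‖ := by simpa [hψ] using hh.abs
  let e : ZSpace d × ZSpace d ≃ ZSpace d × ZSpace d :=
    { toFun := fun q => (q.1 - q.2, q.2)
      invFun := fun q => (q.1 + q.2, q.2)
      left_inv := fun q => by simp
      right_inv := fun q => by simp }
  have hs := summable_mul_of_summable_norm hφn hψn
  have hs' : Summable fun q : ZSpace d × ZSpace d => φ (q.1 - q.2) * ψ q.2 :=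
    e.summable_iff.mpr hs
  have ht : ∑' q : ZSpace d × ZSpace d, φ (q.1 - q.2) * ψ q.2
      = ∑' q : ZSpace d × ZSpace d, φ q.1 * ψ q.2 :=
    e.tsum_eq (fun q : ZSpace d × ZSpace d => φ q.1 * ψ q.2)
  rw [latticeFourier_eq, latticeFourier_eq f, latticeFourier_eq h,
    tsum_mul_tsum_of_summable_norm hφn hψn, ← ht, hs'.tsum_prod]
  congr 1; ext x
  rw [latticeConv, Complex.ofReal_tsum, ← tsum_mul_right]
  congr 1; ext y
  have : chr k (-x) = chr k (-(x - y)) * chr k (-y) := by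
    rw [← chr_add]; congr 1; abel
  rw [this]; simp only [hφ, hψ]; push_cast; ring

theorem tilt_conv {d : ℕ} (μ : RSpace d) (f h : ZSpace d → ℝ) (x : ZSpace d) :
    tilt μ (latticeConv f h) x = latticeConv (tilt μ f) (tilt μ h) x := by
  rw [tilt, latticeConv, latticeConv, ← tsum_mul_right]
  congr 1; ext y
  rw [tilt, tilt, latticeVec_sub, inner_sub_right, Real.exp_sub]
  have := (Real.exp_pos (inner ℝ μ (latticeVec y))).ne'
  field_simp

theorem tilt_smul_abs_le {d : ℕ} (f : ZSpace d → ℝ) (μ : RSpace d) {s : ℝ} (hs0 : 0 ≤ s)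
    (hs1 : s ≤ 1) (y : ZSpace d) : |tilt (s • μ) f y| ≤ |f y| + |tilt μ f y| := by
  rw [tilt, tilt, abs_mul, abs_mul, Real.abs_exp, Real.abs_exp, real_inner_smul_left]
  set u := inner ℝ μ (latticeVec y)
  have : Real.exp (s * u) ≤ 1 + Real.exp u := by
    rcases le_total u 0 with h | h
    · have : Real.exp (s * u) ≤ 1 := Real.exp_le_one_iff.mpr (mul_nonpos_of_nonneg_of_nonpos hs0 h)
      linarith [Real.exp_pos u]
    · have : Real.exp (s * u) ≤ Real.exp u := Real.exp_le_exp.mpr (by nlinarith)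
      linarith
  calc |f y| * Real.exp (s * u) ≤ |f y| * (1 + Real.exp u) := by gcongr
    _ = _ := by ring

/-- Summability at the two ends of the segment suffices: e^{su} ≤ 1 + e^u for 0 ≤ s ≤ 1 dominates
every tilt in between. -/
theorem continuousOn_fourier_tilt {d : ℕ} {f : ZSpace d → ℝ} {μ : RSpace d} (hf : Summable f)
    (hμ : Summable (tilt μ f)) (k : RSpace d) :
    ContinuousOn (fun s : ℝ => latticeFourier (tilt (s • μ) f) k) (Set.Icc 0 1) := by
  have h : (fun s : ℝ => latticeFourier (tilt (s • μ) f) k)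
      = fun s => ∑' y, ((tilt (s • μ) f y : ℝ) : ℂ) * chr k (-y) :=
    funext fun s => latticeFourier_eq _ _
  rw [h]
  refine continuousOn_tsum (fun y => ?_) (hf.abs.add hμ.abs) (fun y s hs => ?_)
  · unfold tilt
    simp only [real_inner_smul_left]
    fun_prop
  · rw [norm_mul, norm_chr, mul_one, Complex.norm_real, Real.norm_eq_abs]
    exact tilt_smul_abs_le f μ hs.1 hs.2 y

section Domain

variable {d : ℕ} [NeZero d] {M K ζ : ℝ} {S J g : ZSpace d → ℝ}

theorem CrossoverHypotheses.kernelClass (h : CrossoverHypotheses M K ζ S J g) (hM : 0 < M)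
    (hζ : 0 < ζ) {μ : RSpace d} (hμ : μ ∈ closure (omegaSet S)) :
    KernelClass M K (min ζ 1) (highExp d) (decayOrder d) (tilt μ J) :=
  (h.oz.tilts_mem μ hμ).kernelClass hM hζ

theorem CrossoverHypotheses.sourceClass (h : CrossoverHypotheses M K ζ S J g) (hM : 0 < M)
    (hζ : 0 < ζ) {μ : RSpace d} (hμ : μ ∈ closure (omegaSet S)) :
    SourceClass M (min ζ 1) (decayOrder d) (tilt μ g) :=
  (h.oz.tilts_mem μ hμ).sourceClass (Nat.one_le_iff_ne_zero.mpr (NeZero.ne d)) hM hζ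

theorem CrossoverHypotheses.fourier_equation (h : CrossoverHypotheses M K ζ S J g) (hM : 0 < M)
    (hζ : 0 < ζ) {μ : RSpace d} (hμ : μ ∈ omegaSet S) (k : RSpace d) :
    latticeFourier (tilt μ S) k * (1 - latticeFourier (tilt μ J) k)
      = latticeFourier (tilt μ g) k := by
  have hS := (mem_omegaSet_iff h.decay.nonneg μ).mp hμ
  have hJ := (h.kernelClass hM hζ (subset_closure hμ)).summable
  have hg := (h.sourceClass hM hζ (subset_closure hμ)).summable
  have e : ∀ x, latticeConv (tilt μ J) (tilt μ S) x = tilt μ S x - tilt μ g x := fun x => by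
    rw [← tilt_conv, tilt, tilt, tilt]
    have := h.oz.equation x
    rw [show latticeConv J S x = S x - g x by linarith]; ring
  have h1 := latticeFourier_conv hJ hS k
  rw [funext e, latticeFourier_sub hS hg] at h1
  linear_combination h1

/-- At k = 0 the equation says that the mass of the tilted S times 1 - ∑ J^{(μ)} is the mass of the
tilted g, which is positive, while S is non-negative. -/
theorem CrossoverHypotheses.tsum_tilt_lt_one (h : CrossoverHypotheses M K ζ S J g) (hM : 0 < M)
    (hζ : 0 < ζ) {μ : RSpace d} (hμ : μ ∈ omegaSet S) : ∑' y, tilt μ J y < 1 := by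
  have h1 := h.fourier_equation hM hζ hμ 0
  have h2 := h.oz.g_pos μ (subset_closure hμ)
  rw [← h1, latticeFourier_zero, latticeFourier_zero, ← Complex.ofReal_one,
    ← Complex.ofReal_sub, ← Complex.ofReal_mul, Complex.ofReal_re] at h2
  have h3 : 0 ≤ ∑' y, tilt μ S y :=
    tsum_nonneg fun y => mul_nonneg (h.decay.nonneg y) (Real.exp_pos _).le
  by_contra hcon
  nlinarith [mul_nonpos_of_nonneg_of_nonpos h3 (show 1 - ∑' y, tilt μ J y ≤ 0 by linarith)]

theorem DecayAssumption.combo_mem (h : DecayAssumption S) {μ ν : RSpace d}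
    (hμ : μ ∈ closure (omegaSet S)) (hν : ν ∈ omegaSet S) {a b : ℝ} (ha : 0 ≤ a) (hb : 0 < b)
    (hab : a + b = 1) : a • μ + b • ν ∈ omegaSet S := by
  have hint : interior (omegaSet S) = omegaSet S := h.isOpen.interior_eq
  have := (convex_omegaSet h.nonneg).combo_closure_interior_mem_interior hμ
    (by rwa [hint]) ha hb hab
  rwa [hint] at this

theorem DecayAssumption.smul_mem (h : DecayAssumption S) {μ : RSpace d}
    (hμ : μ ∈ closure (omegaSet S)) {s : ℝ} (hs0 : 0 ≤ s) (hs1 : s < 1) : s • μ ∈ omegaSet S := by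
  have := h.combo_mem hμ h.zero_mem hs0 (show 0 < 1 - s by linarith) (by ring)
  simpa using this

theorem DecayAssumption.smul_mem_closure (h : DecayAssumption S) {μ : RSpace d}
    (hμ : μ ∈ closure (omegaSet S)) {s : ℝ} (hs0 : 0 ≤ s) (hs1 : s ≤ 1) :
    s • μ ∈ closure (omegaSet S) := by
  rcases hs1.eq_or_lt with rfl | h1
  · simpa using hμ
  · exact subset_closure (h.smul_mem hμ hs0 h1)

theorem DecayAssumption.mem_frontier_iff (h : DecayAssumption S) {μ : RSpace d} :
    μ ∈ frontier (omegaSet S) ↔ μ ∈ closure (omegaSet S) ∧ μ ∉ omegaSet S := by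
  rw [h.isOpen.frontier_eq]; rfl

/-- Radial continuity from inside Ω gives a mass of at most 1. If it were smaller, the
susceptibility would stay bounded along the ray; passing to the limit on finite sums, μ itself would
lie in Ω, which is open and so contains no frontier point. -/
theorem CrossoverHypotheses.tsum_tilt_frontier (h : CrossoverHypotheses M K ζ S J g) (hM : 0 < M)
    (hζ : 0 < ζ) {μ : RSpace d} (hμ : μ ∈ frontier (omegaSet S)) : ∑' y, tilt μ J y = 1 := by
  obtain ⟨hμc, hμn⟩ := h.decay.mem_frontier_iff.mp hμ
  have hJ0 := h.oz.J_summable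
  have hJ := (h.kernelClass hM hζ hμc).summable
  have hcont := continuousOn_fourier_tilt hJ0 hJ 0
  simp only [latticeFourier_zero] at hcont
  have hcont' : ContinuousOn (fun s : ℝ => ∑' y, tilt (s • μ) J y) (Set.Icc 0 1) := by
    have := Complex.continuous_re.comp_continuousOn hcont
    simpa [Function.comp_def] using this
  have hw : Filter.Tendsto (fun s : ℝ => ∑' y, tilt (s • μ) J y) (nhdsWithin 1 (Set.Ico 0 1))
      (nhds (∑' y, tilt μ J y)) := by
    have := (hcont' 1 (by simp)).mono_left (nhdsWithin_mono 1 Set.Ico_subset_Icc_self)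
    simpa using this
  have hne : (nhdsWithin (1 : ℝ) (Set.Ico 0 1)).NeBot := by
    rw [← mem_closure_iff_nhdsWithin_neBot, closure_Ico (by norm_num)]; simp
  have hle : ∑' y, tilt μ J y ≤ 1 := by
    refine le_of_tendsto hw ?_
    filter_upwards [self_mem_nhdsWithin] with s hs
    exact (h.tsum_tilt_lt_one hM hζ (h.decay.smul_mem hμc hs.1 hs.2)).le
  by_contra hne1
  have hlt : ∑' y, tilt μ J y < 1 := lt_of_le_of_ne hle hne1
  apply hμn
  rw [mem_omegaSet_iff h.decay.nonneg]
  set δ := (1 - ∑' y, tilt μ J y) / 2 with hδ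
  have hδ0 : 0 < δ := by rw [hδ]; linarith
  refine summable_of_sum_le (c := M / δ)
    (fun y => mul_nonneg (h.decay.nonneg y) (Real.exp_pos _).le) fun T => ?_
  have hT : Filter.Tendsto (fun s : ℝ => ∑ y ∈ T, tilt (s • μ) S y) (nhdsWithin 1 (Set.Ico 0 1))
      (nhds (∑ y ∈ T, tilt μ S y)) := by
    have hc : Continuous fun s : ℝ => ∑ y ∈ T, tilt (s • μ) S y := by
      unfold tilt; simp only [real_inner_smul_left]; fun_prop
    have := (hc.tendsto 1).mono_left (nhdsWithin_le_nhds (s := Set.Ico (0 : ℝ) 1))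
    simpa using this
  refine le_of_tendsto hT ?_
  filter_upwards [self_mem_nhdsWithin, hw.eventually_lt_const
    (show ∑' y, tilt μ J y < 1 - δ by rw [hδ]; linarith)] with s hs hs'
  have hsm := h.decay.smul_mem hμc hs.1 hs.2
  have hS := (mem_omegaSet_iff h.decay.nonneg _).mp hsm
  have h1 := h.fourier_equation hM hζ hsm 0
  have hgM : (∑' y, tilt (s • μ) S y) * (1 - ∑' y, tilt (s • μ) J y) ≤ M := by
    have h2 := h.sourceClass hM hζ (subset_closure hsm)
    have h3 := (Complex.re_le_norm _).trans ((norm_latticeFourier_le h2.summable 0).trans h2.norm_le)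
    rw [← h1, latticeFourier_zero, latticeFourier_zero, ← Complex.ofReal_one,
      ← Complex.ofReal_sub, ← Complex.ofReal_mul, Complex.ofReal_re] at h3
    exact h3
  have hnn : ∀ y, 0 ≤ tilt (s • μ) S y :=
    fun y => mul_nonneg (h.decay.nonneg y) (Real.exp_pos _).le
  have hpos : 0 ≤ ∑' y, tilt (s • μ) S y := tsum_nonneg hnn
  refine (hS.sum_le_tsum T fun y _ => hnn y).trans ?_
  rw [le_div_iff₀ hδ0]
  refine le_trans ?_ hgM
  gcongr
  linarith

end Domain

/-! ### The drift at the boundary -/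

theorem flipR_univ {d : ℕ} (μ : RSpace d) : flipR Finset.univ μ = -μ := by
  ext i; simp [flipR]

theorem tilt_neg_apply {d : ℕ} {f : ZSpace d → ℝ} (hf : LatticeSymmetric f) (μ : RSpace d)
    (y : ZSpace d) : tilt (-μ) f y = tilt μ f (-y) := by
  rw [tilt, tilt, hf.neg, latticeVec_neg, inner_neg_right, inner_neg_left]

theorem drift_neg {d : ℕ} {f : ZSpace d → ℝ} (hf : LatticeSymmetric f) (μ : RSpace d) :
    drift (tilt (-μ) f) = -drift (tilt μ f) := by
  rw [drift, drift, ← (Equiv.neg (ZSpace d)).tsum_eq (fun y => tilt μ f y • latticeVec y),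
    ← tsum_neg]
  congr 1; ext1 y
  simp [tilt_neg_apply hf, latticeVec_neg]

theorem integral_sq_mul_exp (u : ℝ) :
    ∫ s in (-1 : ℝ)..1, u ^ 2 * Real.exp (s * u) = u * Real.exp u - u * Real.exp (-u) := by
  have h : ∀ s ∈ Set.uIcc (-1 : ℝ) 1,
      HasDerivAt (fun s => u * Real.exp (s * u)) (u ^ 2 * Real.exp (s * u)) s := fun s _ => by
    have := (((hasDerivAt_id s).mul_const u).exp).const_mul u
    refine this.congr_deriv ?_
    simp; ring
  rw [intervalIntegral.integral_eq_sub_of_hasDerivAt h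
    (by apply Continuous.intervalIntegrable; fun_prop)]
  simp

theorem exp_mul_le_add {s u : ℝ} (hs : |s| ≤ 1) : Real.exp (s * u) ≤ Real.exp u + Real.exp (-u) := by
  have h1 : s * u ≤ |u| := by
    calc s * u ≤ |s * u| := le_abs_self _
      _ = |s| * |u| := abs_mul _ _
      _ ≤ 1 * |u| := by gcongr
      _ = |u| := one_mul _
  refine (Real.exp_le_exp.mpr h1).trans ?_
  rcases abs_cases u with ⟨h2, -⟩ | ⟨h2, -⟩ <;> rw [h2] <;> linarith [Real.exp_pos u, Real.exp_pos (-u)]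

theorem abs_exp_sub_exp_neg_le (u : ℝ) :
    |Real.exp u - Real.exp (-u)| ≤ 2 * |u| * (Real.exp u + Real.exp (-u)) := by
  have key : ∀ v : ℝ, 0 ≤ v → |Real.exp v - Real.exp (-v)| ≤ 2 * v * (Real.exp v + Real.exp (-v)) := by
    intro v hv
    have h1 : Real.exp (-v) ≤ Real.exp v := Real.exp_le_exp.mpr (by linarith)
    rw [abs_of_nonneg (by linarith)]
    have h2 := Real.add_one_le_exp (-v)
    have h4 : Real.exp v * Real.exp (-v) = 1 := by rw [← Real.exp_add]; simp
    have h5 : 1 ≤ Real.exp v := Real.one_le_exp hv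
    have h6 := Real.exp_pos (-v)
    have h7 : Real.exp v - 1 ≤ v * Real.exp v := by nlinarith
    nlinarith
  rcases le_total 0 u with hu | hu
  · rw [abs_of_nonneg hu]; exact key u hu
  · have := key (-u) (by linarith)
    rw [neg_neg, abs_sub_comm] at this
    rw [abs_of_nonpos hu, add_comm (Real.exp u)]; exact this

/-- The factor 1 + e^δ, multiplied by e^{μ·y}, becomes the sum of the weights at the two endpoints.
Second moments at these two tilts are therefore enough, without any bound along the segment between
them. -/
theorem exp_taylor_two_sided (δ : ℝ) :
    |Real.exp δ - 1 - δ| ≤ δ ^ 2 * (1 + Real.exp δ) := by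
  have h0 := Real.add_one_le_exp δ
  have h1 := Real.exp_pos δ
  rcases le_total |δ| 1 with h | h
  · refine (Real.abs_exp_sub_one_sub_id_le h).trans ?_
    nlinarith [sq_nonneg δ]
  · rw [abs_of_nonneg (by linarith)]
    have h2 : 1 ≤ δ ^ 2 := by rw [← sq_abs]; nlinarith
    have h3 : -δ ≤ δ ^ 2 := by
      rw [← sq_abs]; nlinarith [neg_le_abs δ]
    nlinarith

section Domain

variable {d : ℕ} [NeZero d] {M K ζ : ℝ} {S J g : ZSpace d → ℝ}

theorem DecayAssumption.neg_mem (h : DecayAssumption S) {μ : RSpace d} (hμ : μ ∈ omegaSet S) :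
    -μ ∈ omegaSet S := by
  have := flipR_mem_omegaSet h.nonneg h.symmetric Finset.univ hμ
  rwa [flipR_univ] at this

theorem DecayAssumption.neg_mem_closure (h : DecayAssumption S) {μ : RSpace d}
    (hμ : μ ∈ closure (omegaSet S)) : -μ ∈ closure (omegaSet S) :=
  map_mem_closure continuous_neg hμ fun _ hν => h.neg_mem hν

/-- The second derivative of s ↦ ∑ J^{(sμ)} is twice the covariance form at μ, hence at least
2K‖μ‖². Integration over [-1, 1] gives 4K‖μ‖² below; the boundary terms are equal by oddness of the
drift, which is the symmetry of J, and sum to twice the required inner product. -/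
theorem CrossoverHypotheses.inner_drift_ge (h : CrossoverHypotheses M K ζ S J g) (hM : 0 < M)
    (hζ : 0 < ζ) {μ : RSpace d} (hμ : μ ∈ closure (omegaSet S)) :
    2 * K * ‖μ‖ ^ 2 ≤ inner ℝ μ (drift (tilt μ J)) := by
  have hη : 0 < min ζ 1 := lt_min hζ one_pos
  have hQ := h.kernelClass hM hζ hμ
  have hQ' := h.kernelClass hM hζ (h.decay.neg_mem_closure hμ)
  have h2 := hQ.summable_sq hη
  have h2' := hQ'.summable_sq hη
  set u : ZSpace d → ℝ := fun y => inner ℝ μ (latticeVec y) with hu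
  have hmem : ∀ s ∈ Set.Icc (-1 : ℝ) 1, s • μ ∈ closure (omegaSet S) := fun s hs => by
    rcases le_total 0 s with h0 | h0
    · exact h.decay.smul_mem_closure hμ h0 hs.2
    · have := h.decay.smul_mem_closure (h.decay.neg_mem_closure hμ)
        (show 0 ≤ -s by linarith) (show -s ≤ 1 by linarith [hs.1])
      simpa using this
  have hmem' : ∀ s ∈ Set.uIoc (-1 : ℝ) 1, s ∈ Set.Icc (-1 : ℝ) 1 := fun s hs => by
    rw [Set.uIoc_of_le (by norm_num)] at hs; exact ⟨hs.1.le, hs.2⟩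
  have hQt : ∀ (s : ℝ) y, J y * (u y ^ 2 * Real.exp (s * u y))
      = 2 * (tilt (s • μ) J y * (u y ^ 2 / 2)) := fun s y => by
    rw [tilt, real_inner_smul_left]; ring
  have hsum : ∀ s ∈ Set.Icc (-1 : ℝ) 1,
      HasSum (fun y => J y * (u y ^ 2 * Real.exp (s * u y))) (2 * covForm (tilt (s • μ) J) μ) :=
    fun s hs => by
      have := (summable_covForm ((h.kernelClass hM hζ (hmem s hs)).summable_sq hη) μ).hasSum.mul_left 2
      exact hasSum_of_eq this (fun y => hQt s y) rfl
  have hbound : Summable fun y => ‖μ‖ ^ 2 * (‖latticeVec y‖ ^ 2 * |tilt μ J y|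
      + ‖latticeVec y‖ ^ 2 * |tilt (-μ) J y|) := (h2.add h2').mul_left _
  have hble : ∀ y, ∀ s ∈ Set.Icc (-1 : ℝ) 1, ‖J y * (u y ^ 2 * Real.exp (s * u y))‖
      ≤ ‖μ‖ ^ 2 * (‖latticeVec y‖ ^ 2 * |tilt μ J y| + ‖latticeVec y‖ ^ 2 * |tilt (-μ) J y|) :=
    fun y s hs => by
      rw [norm_mul, Real.norm_eq_abs, Real.norm_of_nonneg (by positivity), tilt, tilt, abs_mul,
        abs_mul, Real.abs_exp, Real.abs_exp, inner_neg_left]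
      have e1 : u y ^ 2 ≤ ‖μ‖ ^ 2 * ‖latticeVec y‖ ^ 2 := by
        rw [← mul_pow, ← sq_abs]; gcongr; exact abs_real_inner_le_norm _ _
      have e2 := exp_mul_le_add (u := u y) (abs_le.mpr ⟨hs.1, hs.2⟩)
      calc _ ≤ |J y| * ((‖μ‖ ^ 2 * ‖latticeVec y‖ ^ 2) * (Real.exp (u y) + Real.exp (-u y))) := by
            gcongr
        _ = _ := by simp only [hu]; ring
  have hint : HasSum (fun y => ∫ s in (-1 : ℝ)..1, J y * (u y ^ 2 * Real.exp (s * u y)))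
      (∫ s in (-1 : ℝ)..1, 2 * covForm (tilt (s • μ) J) μ) := by
    refine intervalIntegral.hasSum_integral_of_dominated_convergence
      (fun y _ => ‖μ‖ ^ 2 * (‖latticeVec y‖ ^ 2 * |tilt μ J y|
        + ‖latticeVec y‖ ^ 2 * |tilt (-μ) J y|)) (fun y => ?_) (fun y => ?_) ?_ ?_ ?_
    · exact (by fun_prop : Continuous fun s : ℝ =>
        J y * (u y ^ 2 * Real.exp (s * u y))).aestronglyMeasurable
    · exact Filter.Eventually.of_forall fun s hs => hble y s (hmem' s hs)
    · exact Filter.Eventually.of_forall fun _ _ => hbound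
    · exact intervalIntegrable_const
    · exact Filter.Eventually.of_forall fun s hs => hsum s (hmem' s hs)
  have hlow : ∫ _s in (-1 : ℝ)..1, 2 * (K * ‖μ‖ ^ 2)
      ≤ ∫ s in (-1 : ℝ)..1, 2 * covForm (tilt (s • μ) J) μ := by
    refine intervalIntegral.integral_mono_on (by norm_num) intervalIntegrable_const ?_ fun s hs => ?_
    · have hc : ContinuousOn (fun s : ℝ => ∑' y, J y * (u y ^ 2 * Real.exp (s * u y)))
          (Set.Icc (-1) 1) :=
        continuousOn_tsum (fun y => by fun_prop) hbound hble
      refine ContinuousOn.intervalIntegrable ?_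
      rw [Set.uIcc_of_le (by norm_num)]
      exact hc.congr fun s hs => (hsum s hs).tsum_eq.symm
    · have := (h.kernelClass hM hζ (hmem s hs)).le_covForm hη (min_le_right _ _) μ
      linarith
  have hd1 := inner_drift (summable_norm_mul h2) μ
  have hd2 := inner_drift (summable_norm_mul h2') μ
  have hfin := hasSum_of_eq (hd1.sub hd2)
    (g := fun y => ∫ s in (-1 : ℝ)..1, J y * (u y ^ 2 * Real.exp (s * u y))) (fun y => by
      rw [intervalIntegral.integral_const_mul, integral_sq_mul_exp, tilt, tilt, inner_neg_left]
      simp only [hu]; ring) rfl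
  rw [hint.unique hfin, drift_neg h.oz.J_symmetric, inner_neg_right] at hlow
  simp at hlow
  linarith

/-- By oddness 2‖b‖² = ∑ J(y)(e^{μ·y} - e^{-μ·y}) b·y, and the difference of exponentials supplies a
factor |μ·y|. This linear bound makes the speed vanish together with the mass. -/
theorem CrossoverHypotheses.norm_drift_le (h : CrossoverHypotheses M K ζ S J g) (hM : 0 < M)
    (hζ : 0 < ζ) {μ : RSpace d} (hμ : μ ∈ closure (omegaSet S)) :
    ‖drift (tilt μ J)‖ ≤ 2 * M * ‖μ‖ := by
  have hη : 0 < min ζ 1 := lt_min hζ one_pos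
  have hQ := h.kernelClass hM hζ hμ
  have hQ' := h.kernelClass hM hζ (h.decay.neg_mem_closure hμ)
  have h2 := hQ.summable_sq hη
  have h2' := hQ'.summable_sq hη
  set v := drift (tilt μ J) with hv
  have hd := (inner_drift (summable_norm_mul h2) v).sub (inner_drift (summable_norm_mul h2') v)
  rw [drift_neg h.oz.J_symmetric, ← hv, inner_neg_right, sub_neg_eq_add,
    real_inner_self_eq_norm_sq] at hd
  have hle := hasSum_le (fun y => ?_) hd ((h2.add h2').mul_left (2 * ‖μ‖ * ‖v‖)).hasSum
  · rw [tsum_mul_left, h2.tsum_add h2'] at hle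
    have h3 : 2 * ‖μ‖ * ‖v‖ * (∑' y, ‖latticeVec y‖ ^ 2 * |tilt μ J y|
        + ∑' y, ‖latticeVec y‖ ^ 2 * |tilt (-μ) J y|) ≤ 2 * ‖μ‖ * ‖v‖ * (M + M) := by
      gcongr
      · exact hQ.sq_le hη
      · exact hQ'.sq_le hη
    rcases (norm_nonneg v).eq_or_lt with h0 | h0
    · rw [← h0]; positivity
    · have h4 : ‖v‖ * ‖v‖ ≤ (2 * M * ‖μ‖) * ‖v‖ := by nlinarith
      exact le_of_mul_le_mul_right h4 h0
  · set u := inner ℝ μ (latticeVec y) with hu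
    have e1 : |u| ≤ ‖μ‖ * ‖latticeVec y‖ := abs_real_inner_le_norm _ _
    have e2 : |inner ℝ v (latticeVec y)| ≤ ‖v‖ * ‖latticeVec y‖ := abs_real_inner_le_norm _ _
    rw [tilt, tilt, inner_neg_left, ← hu, abs_mul, abs_mul, Real.abs_exp, Real.abs_exp]
    calc _ = J y * (Real.exp u - Real.exp (-u)) * inner ℝ v (latticeVec y) := by ring
      _ ≤ |J y| * |Real.exp u - Real.exp (-u)| * |inner ℝ v (latticeVec y)| := by
          rw [← abs_mul, ← abs_mul]; exact le_abs_self _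
      _ ≤ |J y| * (2 * |u| * (Real.exp u + Real.exp (-u))) * (‖v‖ * ‖latticeVec y‖) := by
          gcongr; exact abs_exp_sub_exp_neg_le u
      _ ≤ |J y| * (2 * (‖μ‖ * ‖latticeVec y‖) * (Real.exp u + Real.exp (-u)))
          * (‖v‖ * ‖latticeVec y‖) := by gcongr
      _ = _ := by ring

theorem CrossoverHypotheses.tsum_tilt_sub_le (h : CrossoverHypotheses M K ζ S J g) (hM : 0 < M)
    (hζ : 0 < ζ) {μ w : RSpace d} (hμ : μ ∈ closure (omegaSet S)) (hw : w ∈ closure (omegaSet S)) :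
    ∑' y, tilt w J y - ∑' y, tilt μ J y
      ≤ inner ℝ (w - μ) (drift (tilt μ J)) + 2 * M * ‖w - μ‖ ^ 2 := by
  have hη : 0 < min ζ 1 := lt_min hζ one_pos
  have hQ := h.kernelClass hM hζ hμ
  have hQ' := h.kernelClass hM hζ hw
  have h2 := hQ.summable_sq hη
  have h2' := hQ'.summable_sq hη
  have hd := (hQ'.summable.hasSum.sub hQ.summable.hasSum).sub
    (inner_drift (summable_norm_mul h2) (w - μ))
  have hle := hasSum_le (fun y => ?_) hd ((h2.add h2').mul_left (‖w - μ‖ ^ 2)).hasSum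
  · rw [tsum_mul_left, h2.tsum_add h2'] at hle
    have h3 : ‖w - μ‖ ^ 2 * (∑' y, ‖latticeVec y‖ ^ 2 * |tilt μ J y|
        + ∑' y, ‖latticeVec y‖ ^ 2 * |tilt w J y|) ≤ ‖w - μ‖ ^ 2 * (M + M) := by
      gcongr
      · exact hQ.sq_le hη
      · exact hQ'.sq_le hη
    linarith
  · set δ := inner ℝ (w - μ) (latticeVec y) with hδ
    set u := inner ℝ μ (latticeVec y) with hu
    have e0 : Real.exp (inner ℝ w (latticeVec y)) = Real.exp u * Real.exp δ := by
      rw [← Real.exp_add, hu, hδ, inner_sub_left]; ring_nf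
    have e1 : δ ^ 2 ≤ ‖w - μ‖ ^ 2 * ‖latticeVec y‖ ^ 2 := by
      rw [← mul_pow, ← sq_abs]; gcongr; exact abs_real_inner_le_norm _ _
    rw [tilt, tilt, e0, ← hu, abs_mul, abs_mul, abs_mul, Real.abs_exp, Real.abs_exp]
    calc _ = J y * Real.exp u * (Real.exp δ - 1 - δ) := by ring
      _ ≤ |J y| * Real.exp u * |Real.exp δ - 1 - δ| := by
          rw [← Real.abs_exp u, ← abs_mul, ← abs_mul, Real.abs_exp]; exact le_abs_self _
      _ ≤ |J y| * Real.exp u * (δ ^ 2 * (1 + Real.exp δ)) := by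
          gcongr; exact exp_taylor_two_sided δ
      _ ≤ |J y| * Real.exp u * ((‖w - μ‖ ^ 2 * ‖latticeVec y‖ ^ 2) * (1 + Real.exp δ)) := by
          gcongr
      _ = _ := by ring

end Domain

/-! ### The maximiser of a linear functional over the closure of the domain -/

/-- A form of Farkas' lemma: if the open half-space {v·b < 0} lies in {v·x ≤ 0}, then x is a
non-negative multiple of b. The component u of x orthogonal to b is killed by testing with u - εb
and letting ε → 0. -/
theorem norm_sub_smul_of_inner {E : Type*} [NormedAddCommGroup E] [InnerProductSpace ℝ E]
    {x b : E} (hb : b ≠ 0) (h : ∀ v, inner ℝ v b < 0 → inner ℝ v x ≤ 0) (t : ℝ) :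
    ‖x - t • b‖ = |‖x‖ - t * ‖b‖| := by
  have hb0 : 0 < ‖b‖ := norm_pos_iff.mpr hb
  set κ := inner ℝ x b / ‖b‖ ^ 2 with hκ
  set u := x - κ • b with hu
  have hub : inner ℝ u b = 0 := by
    rw [hu, inner_sub_left, real_inner_smul_left, real_inner_self_eq_norm_sq, hκ,
      div_mul_cancel₀ _ (by positivity), sub_self]
  have hux : inner ℝ u x = ‖u‖ ^ 2 := by
    have : x = u + κ • b := by rw [hu]; abel
    conv_lhs => rw [this]
    rw [inner_add_right, real_inner_smul_right, hub, real_inner_self_eq_norm_sq]; ring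
  have hε : ∀ ε : ℝ, 0 < ε → ‖u‖ ^ 2 ≤ ε * inner ℝ b x := fun ε hε => by
    have := h (u - ε • b) (by
      rw [inner_sub_left, hub, real_inner_smul_left, real_inner_self_eq_norm_sq]
      have : 0 < ε * ‖b‖ ^ 2 := by positivity
      linarith)
    rw [inner_sub_left, hux, real_inner_smul_left] at this
    linarith
  have hu0 : ‖u‖ ^ 2 ≤ 0 := by
    have ht : Filter.Tendsto (fun ε : ℝ => ε * inner ℝ b x) (nhdsWithin 0 (Set.Ioi 0)) (nhds 0) := by
      have c : Continuous fun ε : ℝ => ε * (inner ℝ b x : ℝ) := by fun_prop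
      simpa using (c.tendsto 0).mono_left nhdsWithin_le_nhds
    refine ge_of_tendsto ht ?_
    filter_upwards [self_mem_nhdsWithin] with ε h using hε ε h
  have hue : u = 0 := by
    have := pow_eq_zero_iff (two_ne_zero) |>.mp (le_antisymm hu0 (by positivity))
    exact norm_eq_zero.mp this
  have hxe : x = κ • b := by rw [hu] at hue; exact sub_eq_zero.mp hue
  have hκ0 : 0 ≤ κ := by
    have := h (-b) (by
      rw [inner_neg_left, real_inner_self_eq_norm_sq]
      have : 0 < ‖b‖ ^ 2 := by positivity
      linarith)
    rw [inner_neg_left, real_inner_comm] at this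
    exact div_nonneg (by linarith) (by positivity)
  have hxn : ‖x‖ = κ * ‖b‖ := by
    conv_lhs => rw [hxe]
    rw [norm_smul, Real.norm_of_nonneg hκ0]
  rw [hxn, ← sub_mul, abs_mul, abs_norm]
  conv_lhs => rw [hxe]
  rw [← sub_smul, norm_smul, Real.norm_eq_abs]

theorem KernelClass.norm_drift_le {d : ℕ} {M K η p : ℝ} {a : ℕ} {Q : ZSpace d → ℝ} (h : KernelClass M K η p a Q)
    (hη : 0 < η) : ‖drift Q‖ ≤ M := by
  have h2 := h.summable_sq hη
  have hle : ∀ y, ‖Q y • latticeVec y‖ ≤ ‖latticeVec y‖ ^ 2 * |Q y| := fun y => by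
    rw [norm_smul, Real.norm_eq_abs, mul_comm]
    by_cases hy : y = 0
    · subst hy; simp
    · have := one_le_norm_latticeVec hy
      gcongr; nlinarith
  have hs : Summable fun y => ‖Q y • latticeVec y‖ :=
    Summable.of_nonneg_of_le (fun _ => norm_nonneg _) hle h2
  calc _ ≤ ∑' y, ‖Q y • latticeVec y‖ := norm_tsum_le_tsum_norm hs
    _ ≤ _ := hs.tsum_le_tsum hle h2
    _ ≤ M := h.sq_le hη

section Domain

variable {d : ℕ} [NeZero d] {M K ζ : ℝ} {S J g : ZSpace d → ℝ}

/-! ### The mass, the shape of `Ω`, and the norm `|·|_S` -/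

theorem scaledE1_mul (c t : ℝ) : (scaledE1 (c * t) : RSpace d) = c • scaledE1 t := by
  ext i; simp [scaledE1]

theorem DecayAssumption.bddAbove (h : DecayAssumption S) :
    BddAbove {t : ℝ | 0 ≤ t ∧ tiltedSusceptibility S (scaledE1 t) < ∞} := by
  obtain ⟨t₁, h1, h2⟩ := h.exists_notMem
  refine ⟨t₁, fun t ht => ?_⟩
  by_contra hlt
  have hlt : t₁ < t := not_le.mp hlt
  apply h2
  have ht0 : 0 < t := h1.trans hlt
  have := h.smul_mem (μ := scaledE1 t) (subset_closure ht.2) (s := t₁ / t) (by positivity)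
    ((div_lt_one ht0).mpr hlt)
  rwa [← scaledE1_mul, div_mul_cancel₀ _ ht0.ne'] at this

theorem DecayAssumption.le_mass (h : DecayAssumption S) {t : ℝ} (ht : 0 ≤ t)
    (hm : (scaledE1 t : RSpace d) ∈ omegaSet S) : t ≤ mass S :=
  le_csSup h.bddAbove ⟨ht, hm⟩

theorem DecayAssumption.mass_pos (h : DecayAssumption S) : 0 < mass S := by
  obtain ⟨ρ, hρ, hb⟩ := Metric.isOpen_iff.mp h.isOpen 0 h.zero_mem
  have : (scaledE1 (ρ / 2) : RSpace d) ∈ omegaSet S := hb (by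
    rw [mem_ball_zero_iff, scaledE1, PiLp.norm_single, Real.norm_of_nonneg (by positivity)]
    linarith)
  exact lt_of_lt_of_le (by positivity) (h.le_mass (by positivity) this)

theorem DecayAssumption.single_swap_mem (h : DecayAssumption S) {i j : Fin d} {t : ℝ}
    (ht : (EuclideanSpace.single i t : RSpace d) ∈ omegaSet S) :
    (EuclideanSpace.single j t : RSpace d) ∈ omegaSet S := by
  have := perm_mem_omegaSet h.nonneg h.symmetric (Equiv.swap i j) ht
  convert this using 1
  ext k
  simp only [PiLp.single_apply]
  by_cases hk : k = j
  · subst hk; simp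
  · rw [if_neg hk, if_neg]
    intro hcon
    apply hk
    have := congrArg (Equiv.swap i j) hcon
    simpa using this

theorem DecayAssumption.single_mem (h : DecayAssumption S) (i : Fin d) {t : ℝ}
    (ht : |t| < mass S) : (EuclideanSpace.single i t : RSpace d) ∈ omegaSet S := by
  have hne : {t : ℝ | 0 ≤ t ∧ tiltedSusceptibility S (scaledE1 t) < ∞}.Nonempty :=
    ⟨0, le_rfl, by
      have : (scaledE1 0 : RSpace d) = 0 := by ext i; simp [scaledE1]
      rw [this]; exact h.zero_mem⟩
  obtain ⟨u, hu, hlt⟩ := exists_lt_of_lt_csSup hne ht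
  have h1 : (scaledE1 |t| : RSpace d) ∈ omegaSet S := by
    have hu0 : 0 < u := (abs_nonneg t).trans_lt hlt
    have := h.smul_mem (μ := scaledE1 u) (subset_closure hu.2) (s := |t| / u) (by positivity)
      ((div_lt_one hu0).mpr hlt)
    rwa [← scaledE1_mul, div_mul_cancel₀ _ hu0.ne'] at this
  have h2 : (EuclideanSpace.single i |t| : RSpace d) ∈ omegaSet S := h.single_swap_mem h1
  rcases abs_cases t with ⟨e, -⟩ | ⟨e, -⟩
  · rwa [e] at h2
  · rw [e] at h2
    have h3 := h.neg_mem h2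
    have e2 : -(EuclideanSpace.single i (-t) : RSpace d) = EuclideanSpace.single i t := by
      ext k; simp; split_ifs <;> simp
    rwa [e2] at h3

theorem DecayAssumption.single_mem_closure (h : DecayAssumption S) (i : Fin d) {t : ℝ}
    (ht : |t| ≤ mass S) : (EuclideanSpace.single i t : RSpace d) ∈ closure (omegaSet S) := by
  have hm := h.mass_pos
  have hc : Continuous fun t : ℝ => (EuclideanSpace.single i t : RSpace d) := by
    have : (fun t : ℝ => (EuclideanSpace.single i t : RSpace d))
        = fun t => t • (EuclideanSpace.single i (1 : ℝ) : RSpace d) := by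
      ext t k; simp
    rw [this]; fun_prop
  refine map_mem_closure hc (s := Set.Ioo (-mass S) (mass S)) ?_ fun u hu =>
    h.single_mem i (abs_lt.mpr hu)
  rw [closure_Ioo (by linarith)]
  exact abs_le.mp ht

/-- Averaging a point of Ω with its reflection in all the other coordinates leaves a point on the
i-th axis, which is in Ω by convexity. By symmetry its coordinate is bounded by the mass, so Ω is
bounded. -/
theorem DecayAssumption.abs_apply_le (h : DecayAssumption S) {μ : RSpace d}
    (hμ : μ ∈ closure (omegaSet S)) (i : Fin d) : |μ i| ≤ mass S := by
  have hcl : IsClosed {μ : RSpace d | |μ i| ≤ mass S} :=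
    isClosed_le (by fun_prop) continuous_const
  refine closure_minimal (fun ν hν => ?_) hcl hμ
  have h1 := flipR_mem_omegaSet h.nonneg h.symmetric {i}ᶜ hν
  have h2 := convex_omegaSet h.nonneg hν h1 (a := 1 / 2) (b := 1 / 2) (by norm_num) (by norm_num)
    (by norm_num)
  have e : (1 / 2 : ℝ) • ν + (1 / 2 : ℝ) • flipR {i}ᶜ ν = EuclideanSpace.single i (ν i) := by
    ext k
    by_cases hk : k = i
    · subst hk; simp [flipR]; ring
    · simp [flipR, hk]
  rw [e] at h2
  have h3 : (EuclideanSpace.single i |ν i| : RSpace d) ∈ omegaSet S := by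
    rcases abs_cases (ν i) with ⟨e, -⟩ | ⟨e, -⟩
    · rwa [e]
    · rw [e]
      have h3 := h.neg_mem h2
      have e2 : -(EuclideanSpace.single i (ν i) : RSpace d) = EuclideanSpace.single i (-ν i) := by
        ext k; simp; split_ifs <;> simp
      rwa [e2] at h3
  exact h.le_mass (abs_nonneg _) (h.single_swap_mem h3)

theorem DecayAssumption.norm_le (h : DecayAssumption S) {μ : RSpace d}
    (hμ : μ ∈ closure (omegaSet S)) : ‖μ‖ ≤ d * mass S := by
  refine (norm_le_sum_abs μ).trans ?_
  refine (Finset.sum_le_sum fun i _ => h.abs_apply_le hμ i).trans ?_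
  simp

/-- The closure of Ω is compact, and a point of the open set Ω cannot be a maximiser since it may be
moved a little towards x. -/
theorem DecayAssumption.exists_maximiser (h : DecayAssumption S) {x : RSpace d} (hx : x ≠ 0) :
    ∃ μ ∈ frontier (omegaSet S), (∀ ν ∈ closure (omegaSet S), inner ℝ ν x ≤ inner ℝ μ x) ∧
      mass S * normS S x = inner ℝ μ x := by
  have hcomp : IsCompact (closure (omegaSet S)) :=
    Metric.isCompact_of_isClosed_isBounded isClosed_closure
      (isBounded_iff_forall_norm_le.mpr ⟨_, fun μ hμ => h.norm_le hμ⟩)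
  obtain ⟨μ, hμ, hmax⟩ := hcomp.exists_isMaxOn ⟨0, subset_closure h.zero_mem⟩
    (f := fun ν => inner ℝ ν x) (by fun_prop)
  refine ⟨μ, h.mem_frontier_iff.mpr ⟨hμ, fun hΩ => ?_⟩, hmax, ?_⟩
  · obtain ⟨ρ, hρ, hb⟩ := Metric.isOpen_iff.mp h.isOpen μ hΩ
    have hx0 : 0 < ‖x‖ := norm_pos_iff.mpr hx
    have h1 : μ + (ρ / 2 / ‖x‖) • x ∈ closure (omegaSet S) := subset_closure (hb (by
      rw [Metric.mem_ball, dist_self_add_left, norm_smul, Real.norm_of_nonneg (by positivity),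
        div_mul_cancel₀ _ hx0.ne']
      linarith))
    have h2 : inner ℝ (μ + (ρ / 2 / ‖x‖) • x) x ≤ inner ℝ μ x := hmax h1
    rw [inner_add_left, real_inner_smul_left, real_inner_self_eq_norm_sq] at h2
    have : 0 < ρ / 2 / ‖x‖ * ‖x‖ ^ 2 := by positivity
    linarith
  · rw [normS_eq_of_isMaxOn S x μ hμ hmax, mul_div_cancel₀ _ h.mass_pos.ne']

theorem DecayAssumption.normS_bounds (h : DecayAssumption S) {x : RSpace d} (hx : x ≠ 0) :
    normS S x ≤ d * ‖x‖ ∧ ‖x‖ ≤ d * normS S x := by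
  obtain ⟨μ, hμ, hmax, he⟩ := h.exists_maximiser hx
  have hμc := (h.mem_frontier_iff.mp hμ).1
  have hm := h.mass_pos
  constructor
  · have h1 : inner ℝ μ x ≤ mass S * (d * ‖x‖) := by
      calc inner ℝ μ x = ∑ i, x i * μ i := by simp [PiLp.inner_apply]
        _ ≤ ∑ i, |x i| * mass S := Finset.sum_le_sum fun i _ => by
            calc x i * μ i ≤ |x i * μ i| := le_abs_self _
              _ = |x i| * |μ i| := abs_mul _ _
              _ ≤ _ := by gcongr; exact h.abs_apply_le hμc i
        _ = (∑ i, |x i|) * mass S := (Finset.sum_mul ..).symm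
        _ ≤ (d * ‖x‖) * mass S := by gcongr; exact sum_abs_le x
        _ = _ := by ring
    rw [← he] at h1
    exact le_of_mul_le_mul_left h1 hm
  · have h1 : ∀ i, |x i| ≤ normS S x := fun i => by
      -- The competitor ±m_S e_i, with the sign of the coordinate, gives |x_i| ≤ |x|_S; a zero sign
      -- gives the competitor 0, which is harmless.
      have h2 : |mass S * SignType.sign (x i)| ≤ mass S := by
        rw [abs_mul, abs_of_pos hm]
        refine mul_le_of_le_one_right hm.le ?_
        rcases lt_trichotomy (x i) 0 with h | h | h <;> simp [h, sign_neg, sign_pos]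
      have h3 := hmax _ (h.single_mem_closure i h2)
      rw [EuclideanSpace.inner_single_left, ← he] at h3
      have h4 : mass S * |x i| ≤ mass S * normS S x := by
        refine le_trans (le_of_eq ?_) h3
        simp only [conj_trivial]
        rw [mul_assoc, sign_mul_self]
      exact le_of_mul_le_mul_left h4 hm
    refine (norm_le_sum_abs x).trans ?_
    refine (Finset.sum_le_sum fun i _ => h1 i).trans ?_
    simp

/-- The drift is an outward normal at μ. A direction v with v·x > 0 leaves the closure of Ω at once,
since μ is a maximiser; if also v·b < 0, then F would decrease to first order along v, although F =
1 at a frontier point close to μ + sv. -/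
theorem CrossoverHypotheses.inner_nonpos_of_inner_drift_neg (h : CrossoverHypotheses M K ζ S J g)
    (hM : 0 < M) (hK : 0 < K) (hζ : 0 < ζ) {x μ : RSpace d} (hμ : μ ∈ frontier (omegaSet S))
    (hmax : ∀ ν ∈ closure (omegaSet S), inner ℝ ν x ≤ inner ℝ μ x) {v : RSpace d}
    (hv : inner ℝ v (drift (tilt μ J)) < 0) : inner ℝ v x ≤ 0 := by
  by_contra! hvx
  have hμc := (h.decay.mem_frontier_iff.mp hμ).1
  set b := drift (tilt μ J) with hb
  have hbμ : 0 ≤ inner ℝ μ b := le_trans (by positivity) (h.inner_drift_ge hM hζ hμc)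
  obtain ⟨ρ, hρ, hball⟩ := Metric.isOpen_iff.mp h.decay.isOpen 0 h.decay.zero_mem
  set A := ‖v‖ + ‖v‖ * ‖μ‖ / ρ with hA
  have hev : ∀ᶠ s : ℝ in nhdsWithin 0 (Set.Ioi 0),
      0 < s ∧ s * ‖v‖ / ρ < 1 / 2 ∧ 2 * M * s * A ^ 2 < -inner ℝ v b / 2 := by
    have c1 : Continuous fun s : ℝ => s * ‖v‖ / ρ := by fun_prop
    have c2 : Continuous fun s : ℝ => 2 * M * s * A ^ 2 := by fun_prop
    refine Filter.Eventually.and self_mem_nhdsWithin (Filter.Eventually.and ?_ ?_)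
    · exact nhdsWithin_le_nhds ((c1.tendsto 0).eventually_lt_const (by simp))
    · exact nhdsWithin_le_nhds ((c2.tendsto 0).eventually_lt_const (by simp; linarith))
  obtain ⟨s, hs0, hs1, hs2⟩ := hev.exists
  set z := μ + s • v with hz
  have hzn : z ∉ closure (omegaSet S) := fun hcon => by
    have := hmax z hcon
    rw [hz, inner_add_left, real_inner_smul_left] at this
    nlinarith
  -- The segment joins a point of Ω to a point outside its closure, so by connectedness it meets the
  -- frontier, where F = 1.
  obtain ⟨w, hwseg, hwf⟩ : (segment ℝ 0 z ∩ frontier (omegaSet S)).Nonempty := by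
    by_contra hempty
    obtain ⟨p, -, hp1, hp2⟩ := (convex_segment (𝕜 := ℝ) (0 : RSpace d) z).isPreconnected
      (omegaSet S) (closure (omegaSet S))ᶜ h.decay.isOpen isClosed_closure.isOpen_compl
      (fun p hp => by
        by_contra hcon
        rw [Set.mem_union, not_or, Set.mem_compl_iff, not_not] at hcon
        exact hempty ⟨p, hp, h.decay.mem_frontier_iff.mpr ⟨hcon.2, hcon.1⟩⟩)
      ⟨0, left_mem_segment _ _ _, h.decay.zero_mem⟩ ⟨z, right_mem_segment _ _ _, hzn⟩
    exact hp2 (subset_closure hp1)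
  obtain ⟨hwc, hwn⟩ := h.decay.mem_frontier_iff.mp hwf
  obtain ⟨l', l, hl', hl, hll, hwe⟩ := hwseg
  have hl'e : l' = 1 - l := by linarith
  rw [smul_zero, zero_add] at hwe
  -- The crossing point `l • z` is within O(s) of μ: for smaller `l` it would be a convex
  -- combination of μ with a point of the ball of radius `ρ` around 0 and would lie in Ω.
  have hgap : (1 - l) * ρ ≤ l * (s * ‖v‖) := by
    by_contra! hcon
    have h1l : 0 < 1 - l := by
      by_contra! hneg
      have : 0 ≤ l * (s * ‖v‖) := by positivity
      nlinarith
    apply hwn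
    have h1 : ((l * s) / (1 - l)) • v ∈ omegaSet S := hball (by
      rw [mem_ball_zero_iff, norm_smul, Real.norm_of_nonneg (by positivity), div_mul_eq_mul_div,
        div_lt_iff₀ h1l]
      linarith)
    have h2 := h.decay.combo_mem hμc h1 hl h1l (by ring)
    rw [smul_smul, mul_div_cancel₀ _ h1l.ne', mul_smul, ← smul_add] at h2
    rwa [← hwe]
  have hl1 : l ≤ 1 := by linarith
  have hgap' : 1 - l ≤ s * ‖v‖ / ρ := by
    rw [le_div_iff₀ hρ]
    refine hgap.trans (mul_le_of_le_one_left (by positivity) hl1)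
  have hdiff : w - μ = (l * s) • v - (1 - l) • μ := by
    rw [← hwe, hz, smul_add, sub_smul, one_smul, mul_smul]; abel
  have hnorm : ‖w - μ‖ ≤ s * A := by
    rw [hdiff]
    refine (norm_sub_le _ _).trans ?_
    rw [norm_smul, norm_smul, Real.norm_of_nonneg (by positivity),
      Real.norm_of_nonneg (by linarith)]
    calc l * s * ‖v‖ + (1 - l) * ‖μ‖ ≤ 1 * s * ‖v‖ + s * ‖v‖ / ρ * ‖μ‖ := by gcongr
      _ = s * A := by rw [hA]; ring
  -- Both values of F are 1, so the linear term is at least the negative of the quadratic error. The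
  -- part along μ has a favourable sign as μ·b ≥ 0, and what is left contradicts the choice of `s`,
  -- because `l ≥ 1/2`.
  have hF := h.tsum_tilt_sub_le hM hζ hμc hwc
  rw [h.tsum_tilt_frontier hM hζ hμ, h.tsum_tilt_frontier hM hζ hwf, sub_self, ← hb, hdiff,
    inner_sub_left, real_inner_smul_left, real_inner_smul_left, ← hdiff] at hF
  have hsq : 2 * M * ‖w - μ‖ ^ 2 ≤ 2 * M * (s * A) ^ 2 := by gcongr
  have h5 : 0 ≤ (1 - l) * inner ℝ μ b := mul_nonneg (by linarith) hbμ
  have h6 : l * s * (-inner ℝ v b) ≤ s * (2 * M * s * A ^ 2) := by nlinarith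
  have h7 : l * (-inner ℝ v b) ≤ 2 * M * s * A ^ 2 := by
    have : s * (l * (-inner ℝ v b)) ≤ s * (2 * M * s * A ^ 2) := by linarith
    exact le_of_mul_le_mul_left this hs0
  nlinarith

/-- The tilt that is dual to `x`, with the properties of the corresponding drift. -/
theorem CrossoverHypotheses.exists_dual_tilt (h : CrossoverHypotheses M K ζ S J g) (hM : 0 < M)
    (hK : 0 < K) (hζ : 0 < ζ) {x : RSpace d} (hx : x ≠ 0) :
    ∃ μ ∈ frontier (omegaSet S), mass S * normS S x = inner ℝ μ x ∧
      2 * K / d * mass S ≤ ‖drift (tilt μ J)‖ ∧ ‖drift (tilt μ J)‖ ≤ 2 * M * d * mass S ∧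
      ‖drift (tilt μ J)‖ ≤ M ∧
      ∀ t : ℝ, ‖x - t • drift (tilt μ J)‖ = |‖x‖ - t * ‖drift (tilt μ J)‖| := by
  obtain ⟨μ, hμ, hmax, he⟩ := h.decay.exists_maximiser hx
  have hμc := (h.decay.mem_frontier_iff.mp hμ).1
  have hd : (0 : ℝ) < d := by exact_mod_cast Nat.pos_of_ne_zero (NeZero.ne d)
  have hm := h.decay.mass_pos
  have hx0 : 0 < ‖x‖ := norm_pos_iff.mpr hx
  -- From m_S‖x‖ ≤ d m_S|x|_S = d μ·x ≤ d‖μ‖‖x‖. Hence ‖μ‖, and with it the drift, cannot be small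
  -- compared with the mass.
  have hb1 : mass S ≤ d * ‖μ‖ := by
    have h1 := real_inner_le_norm μ x
    rw [← he] at h1
    have h2 := (h.decay.normS_bounds hx).2
    have h3 : mass S * ‖x‖ ≤ (d * ‖μ‖) * ‖x‖ := by
      calc mass S * ‖x‖ ≤ mass S * (d * normS S x) := by gcongr
        _ = d * (mass S * normS S x) := by ring
        _ ≤ d * (‖μ‖ * ‖x‖) := by gcongr
        _ = _ := by ring
    exact le_of_mul_le_mul_right h3 hx0
  have hμ0 : 0 < ‖μ‖ := by
    by_contra! hcon
    nlinarith
  have hlow : 2 * K * ‖μ‖ ≤ ‖drift (tilt μ J)‖ := by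
    have h1 := (h.inner_drift_ge hM hζ hμc).trans (real_inner_le_norm _ _)
    have : (2 * K * ‖μ‖) * ‖μ‖ ≤ ‖drift (tilt μ J)‖ * ‖μ‖ := by nlinarith
    exact le_of_mul_le_mul_right this hμ0
  have hbne : drift (tilt μ J) ≠ 0 := norm_pos_iff.mp (lt_of_lt_of_le (by positivity) hlow)
  refine ⟨μ, hμ, he, ?_, ?_, ?_, fun t => norm_sub_smul_of_inner hbne
    (fun v hv => h.inner_nonpos_of_inner_drift_neg hM hK hζ hμ hmax hv) t⟩
  · refine le_trans ?_ hlow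
    rw [div_mul_eq_mul_div, div_le_iff₀ hd]
    nlinarith
  · refine (h.norm_drift_le hM hζ hμc).trans ?_
    have := h.decay.norm_le hμc
    calc 2 * M * ‖μ‖ ≤ 2 * M * (d * mass S) := by gcongr
      _ = _ := by ring
  · exact (h.kernelClass hM hζ hμc).norm_drift_le (lt_min hζ one_pos)

end Domain

/-! ### Representation as a time integral -/

theorem continuous_sourceKernel {d : ℕ} {Q g : ZSpace d → ℝ} (hQ : Summable Q) (hg : Summable g)
    (x : ZSpace d) : Continuous fun t : ℝ => sourceKernel Q g t x := by
  unfold sourceKernel invFourier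
  refine continuous_const.mul ?_
  have h1 := continuous_latticeFourier hQ
  have h2 := continuous_latticeFourier hg
  have h3 := continuous_chr x
  refine continuous_parametric_integral_of_continuous
    (f := fun (t : ℝ) (k : RSpace d) => latticeFourier g k *
      Complex.exp (t * (latticeFourier Q k - latticeFourier Q 0)) * chr k x) ?_ (isCompact_torusBox d)
  simp only [Function.uncurry_def]
  fun_prop

/-- Write 1/(δ + z) as the Laplace integral ∫ e^{-t(δ+z)} dt and exchange integrals. The killing δ >
0 gives absolute integrability; it is removed only later, by a limit. -/
theorem invFourier_resolvent {d : ℕ} {Q g : ZSpace d → ℝ} (hQ : Summable Q) (hg : Summable g)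
    (hre : ∀ k ∈ torusBox d, 0 ≤ (latticeFourier Q 0 - latticeFourier Q k).re) {δ : ℝ} (hδ : 0 < δ)
    (x : ZSpace d) :
    invFourier (fun k => latticeFourier g k / (δ + (latticeFourier Q 0 - latticeFourier Q k))) x
      = ∫ t in Set.Ioi (0 : ℝ), Complex.exp (-(δ * t)) * sourceKernel Q g t x := by
  have c1 := continuous_latticeFourier hQ
  have c2 := continuous_latticeFourier hg
  have c3 := continuous_chr x
  have hfin : IsFiniteMeasure (volume.restrict (torusBox d)) :=
    ⟨by simpa using volume_torusBox_lt_top d⟩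
  set f : RSpace d → ℝ → ℂ := fun k t => Complex.exp (-(δ * t)) * (latticeFourier g k *
      Complex.exp (t * (latticeFourier Q k - latticeFourier Q 0)) * chr k x) with hf
  have hcf : Continuous (Function.uncurry f) := by
    simp only [hf, Function.uncurry_def]; fun_prop
  have hdom : Integrable (fun q : RSpace d × ℝ => (∑' y, |g y|) * Real.exp (-δ * q.2))
      ((volume.restrict (torusBox d)).prod (volume.restrict (Set.Ioi (0 : ℝ)))) :=
    Integrable.mul_prod (f := fun _ : RSpace d => ∑' y, |g y|)
      (g := fun t : ℝ => Real.exp (-δ * t)) (integrable_const _)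
      (exp_neg_integrableOn_Ioi 0 hδ)
  have hint : Integrable (Function.uncurry f)
      ((volume.restrict (torusBox d)).prod (volume.restrict (Set.Ioi (0 : ℝ)))) := by
    refine hdom.mono' hcf.aestronglyMeasurable ?_
    rw [Measure.prod_restrict,
      ae_restrict_iff' ((measurableSet_torusBox d).prod measurableSet_Ioi)]
    refine Filter.Eventually.of_forall fun q hq => ?_
    have ht : 0 < q.2 := hq.2
    simp only [hf, Function.uncurry]
    rw [norm_mul, norm_mul, norm_mul, norm_chr, mul_one, norm_heat, Complex.norm_exp]
    have e1 : (-((δ : ℂ) * (q.2 : ℂ))).re = -δ * q.2 := by simp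
    rw [e1, mul_comm]
    have e2 : Real.exp (-(q.2 * (latticeFourier Q 0 - latticeFourier Q q.1).re)) ≤ 1 :=
      Real.exp_le_one_iff.mpr (by have := hre q.1 hq.1; nlinarith)
    calc _ ≤ (∑' y, |g y|) * 1 * Real.exp (-δ * q.2) := by
          gcongr; exact norm_latticeFourier_le hg _
      _ = _ := by rw [mul_one]
  have hswap := integral_integral_swap hint
  have hleft : ∀ k ∈ torusBox d, ∫ t in Set.Ioi (0 : ℝ), f k t
      = latticeFourier g k / (δ + (latticeFourier Q 0 - latticeFourier Q k)) * chr k x := by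
    intro k hk
    set z := latticeFourier Q k - latticeFourier Q 0 - δ with hz
    have hzre : z.re < 0 := by
      have := hre k hk
      simp only [hz, Complex.sub_re, Complex.ofReal_re] at this ⊢
      linarith
    have e : ∀ t : ℝ, f k t = (latticeFourier g k * chr k x) * Complex.exp (z * t) := fun t => by
      simp only [hf, hz]
      rw [mul_right_comm, mul_left_comm, ← Complex.exp_add]
      congr 2; ring
    simp_rw [e]
    rw [integral_const_mul, integral_exp_mul_complex_Ioi hzre]
    have hz2 : (δ : ℂ) + (latticeFourier Q 0 - latticeFourier Q k) = -z := by rw [hz]; ring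
    rw [hz2]
    simp [div_neg, neg_div]
    ring
  rw [setIntegral_congr_fun (measurableSet_torusBox d) hleft] at hswap
  unfold sourceKernel invFourier
  rw [hswap, ← integral_const_mul]
  refine integral_congr_ae (Filter.Eventually.of_forall fun t => ?_)
  simp only [hf]
  rw [integral_const_mul]; ring

section Domain

variable {d : ℕ} [NeZero d] {M K ζ : ℝ} {S J g : ZSpace d → ℝ}

theorem CrossoverHypotheses.re_symbol_nonneg (h : CrossoverHypotheses M K ζ S J g) (hM : 0 < M)
    (hK : 0 < K) (hζ : 0 < ζ) {μ : RSpace d} (hμ : μ ∈ closure (omegaSet S)) :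
    ∀ k ∈ torusBox d, 0 ≤ (latticeFourier (tilt μ J) 0 - latticeFourier (tilt μ J) k).re :=
  fun k hk => le_trans (by positivity) ((h.kernelClass hM hζ hμ).infrared k hk)

theorem CrossoverHypotheses.tilt_eq_integral (h : CrossoverHypotheses M K ζ S J g) (hM : 0 < M)
    (hK : 0 < K) (hζ : 0 < ζ) {μ : RSpace d} (hμ : μ ∈ omegaSet S) (x : ZSpace d) :
    (tilt μ S x : ℂ) = ∫ t in Set.Ioi (0 : ℝ),
      Complex.exp (-(((1 - ∑' y, tilt μ J y : ℝ) : ℂ) * t)) *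
        sourceKernel (tilt μ J) (tilt μ g) t x := by
  have hS := (mem_omegaSet_iff h.decay.nonneg μ).mp hμ
  have hc := subset_closure hμ
  have hδ : 0 < 1 - ∑' y, tilt μ J y := by linarith [h.tsum_tilt_lt_one hM hζ hμ]
  have hre := h.re_symbol_nonneg hM hK hζ hc
  rw [← invFourier_resolvent (h.kernelClass hM hζ hc).summable (h.sourceClass hM hζ hc).summable
    hre hδ, ← invFourier_latticeFourier hS x]
  unfold invFourier
  congr 1
  refine setIntegral_congr_fun (measurableSet_torusBox d) fun k hk => ?_
  have h1 := h.fourier_equation hM hζ hμ k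
  have h2 : (((1 - ∑' y, tilt μ J y : ℝ) : ℂ)
      + (latticeFourier (tilt μ J) 0 - latticeFourier (tilt μ J) k))
      = 1 - latticeFourier (tilt μ J) k := by
    rw [latticeFourier_zero]; push_cast; ring
  have h3 : (1 - latticeFourier (tilt μ J) k) ≠ 0 := by
    rw [← h2]
    intro h0
    have := congrArg Complex.re h0
    rw [Complex.add_re, Complex.ofReal_re, Complex.zero_re] at this
    linarith [hre k hk]
  dsimp only
  rw [h2, ← h1, mul_div_cancel_right₀ _ h3]

theorem one_add_div_sqrt_ge {D X β t : ℝ} (hX : 0 ≤ X) (hD0 : 0 ≤ D)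
    (hD : t * β - X ≤ D) :
    min 1 (β / (1 + X)) * √(max t 1) ≤ 1 + D / √(max t 1) := by
  rcases le_total t 1 with ht | ht
  · rw [max_eq_right ht, Real.sqrt_one, mul_one, div_one]
    linarith [min_le_left 1 (β / (1 + X))]
  · rw [max_eq_left ht]
    have hs : 1 ≤ √t := Real.one_le_sqrt.mpr ht
    have hsq : √t * √t = t := Real.mul_self_sqrt (by linarith)
    have h1 : β / (1 + X) * √t ≤ 1 + D / √t := by
      have e : 1 + D / √t = (√t + D) / √t := by field_simp
      rw [e, le_div_iff₀ (by linarith), mul_assoc, hsq, div_mul_eq_mul_div,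
        div_le_iff₀ (by linarith)]
      nlinarith [mul_nonneg hX hD0]
    refine le_trans ?_ h1
    gcongr
    exact min_le_right _ _

theorem integrableOn_max_rpow {r : ℝ} (hr : r < -1) :
    IntegrableOn (fun t : ℝ => max t 1 ^ r) (Set.Ioi 0) := by
  have h1 : IntegrableOn (fun t : ℝ => max t 1 ^ r) (Set.Ioc 0 1) :=
    (integrableOn_const (C := (1 : ℝ)) (by simp)).congr_fun (fun t ht => by
      simp [max_eq_right ht.2]) measurableSet_Ioc
  have h2 : IntegrableOn (fun t : ℝ => max t 1 ^ r) (Set.Ioi 1) :=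
    (integrableOn_Ioi_rpow_of_lt hr one_pos).congr_fun (fun t ht => by
      simp [max_eq_left (Set.mem_Ioi.mp ht).le]) measurableSet_Ioi
  have := h1.union h2
  rwa [Set.Ioc_union_Ioi_eq_Ioi zero_le_one] at this

/-- The kernels of all the tilts `s μ` with `½ ≤ s ≤ 1` are dominated by an integrable function
of time. -/
theorem CrossoverHypotheses.exists_dominating (h : CrossoverHypotheses M K ζ S J g) (hM : 0 < M)
    (hK : 0 < K) (hζ : 0 < ζ) {μ : RSpace d} (hμ : μ ∈ closure (omegaSet S)) (hμ0 : μ ≠ 0)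
    (x : ZSpace d) : ∃ B : ℝ → ℝ, IntegrableOn B (Set.Ioi 0) ∧ ∀ s ∈ Set.Icc (1 / 2 : ℝ) 1,
      ∀ t ∈ Set.Ioi (0 : ℝ), ‖sourceKernel (tilt (s • μ) J) (tilt (s • μ) g) t x‖ ≤ B t := by
  have hη : 0 < min ζ 1 := lt_min hζ one_pos
  obtain ⟨C, hC, hb⟩ := sourceKernel_bound d (a := decayOrder d) hM hK hη (one_le_highExp d)
    highExp_condition (le_two_mul_decayOrder d)
  have hμn : 0 < ‖μ‖ := norm_pos_iff.mpr hμ0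
  set c := min 1 (K * ‖μ‖ / (1 + ‖latticeVec x‖)) with hc
  have hc0 : 0 < c := lt_min one_pos (by positivity)
  have hd : (1 : ℝ) ≤ d := by exact_mod_cast Nat.one_le_iff_ne_zero.mpr (NeZero.ne d)
  refine ⟨fun t => C * c ^ (-2 : ℝ) * max t 1 ^ (-(d : ℝ) / 2 - 1),
    (integrableOn_max_rpow (by linarith)).const_mul _, fun s hs t ht => ?_⟩
  have hsc := h.decay.smul_mem_closure hμ (by linarith [hs.1]) hs.2
  have ht0 : 0 < t := ht
  refine (hb _ _ (h.kernelClass hM hζ hsc) (h.sourceClass hM hζ hsc) t ht x).trans ?_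
  set v := drift (tilt (s • μ) J) with hv
  set τ := max t 1 with hτ
  have hτ0 : 0 < τ := lt_max_of_lt_right one_pos
  -- The restriction s ≥ 1/2 keeps the speed bounded below uniformly along the ray.
  have hvn : K * ‖μ‖ ≤ ‖v‖ := by
    have h1 := (h.inner_drift_ge hM hζ hsc).trans (real_inner_le_norm _ _)
    have hsn : 0 < ‖s • μ‖ := by
      rw [norm_smul, Real.norm_of_nonneg (by linarith [hs.1])]
      have := hs.1; positivity
    have h2 : 2 * K * ‖s • μ‖ ≤ ‖v‖ := by
      have : (2 * K * ‖s • μ‖) * ‖s • μ‖ ≤ ‖v‖ * ‖s • μ‖ := by nlinarith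
      exact le_of_mul_le_mul_right this hsn
    refine le_trans ?_ h2
    rw [norm_smul, Real.norm_of_nonneg (by linarith [hs.1])]
    have : 1 ≤ 2 * s := by linarith [hs.1]
    calc K * ‖μ‖ = K * 1 * ‖μ‖ := by ring
      _ ≤ K * (2 * s) * ‖μ‖ := by gcongr
      _ = _ := by ring
  have hD : t * (K * ‖μ‖) - ‖latticeVec x‖ ≤ ‖latticeVec x - t • v‖ := by
    have h1 := norm_sub_norm_le (t • v) (latticeVec x)
    rw [norm_sub_rev, norm_smul, Real.norm_of_nonneg ht0.le] at h1
    have : t * (K * ‖μ‖) ≤ t * ‖v‖ := by gcongr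
    linarith
  have hge := one_add_div_sqrt_ge (norm_nonneg (latticeVec x)) (norm_nonneg _) hD
  rw [← hc, ← hτ] at hge
  have hs0 : 0 < √τ := Real.sqrt_pos.mpr hτ0
  -- At large times the wave has passed x at distance of order t, so already two orders of spatial
  -- decay give an additional τ^{-1}. The total τ^{-d/2-1} is integrable even for d = 1.
  have h1 : (1 + ‖latticeVec x - t • v‖ / √τ) ^ (-(decayOrder d : ℝ)) ≤ c ^ (-2 : ℝ) * τ ^ (-1 : ℝ) := by
    have ha : (2 : ℝ) ≤ decayOrder d := by exact_mod_cast le_max_left 2 (d - 1)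
    have hge1 : 1 ≤ 1 + ‖latticeVec x - t • v‖ / √τ := by
      have : 0 ≤ ‖latticeVec x - t • v‖ / √τ := by positivity
      linarith
    calc _ ≤ (1 + ‖latticeVec x - t • v‖ / √τ) ^ (-2 : ℝ) :=
          Real.rpow_le_rpow_of_exponent_le hge1 (by linarith)
      _ ≤ (c * √τ) ^ (-2 : ℝ) :=
          Real.rpow_le_rpow_of_nonpos (by positivity) hge (by norm_num)
      _ = _ := by
          rw [Real.mul_rpow hc0.le hs0.le, Real.sqrt_eq_rpow, ← Real.rpow_mul hτ0.le]
          norm_num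
  calc C * τ ^ (-(d : ℝ) / 2) * (1 + ‖latticeVec x - t • v‖ / √τ) ^ (-(decayOrder d : ℝ))
      ≤ C * τ ^ (-(d : ℝ) / 2) * (c ^ (-2 : ℝ) * τ ^ (-1 : ℝ)) := by gcongr
    _ = C * c ^ (-2 : ℝ) * (τ ^ (-(d : ℝ) / 2) * τ ^ (-1 : ℝ)) := by ring
    _ = _ := by rw [← Real.rpow_add hτ0]; rfl

theorem CrossoverHypotheses.tendsto_sourceKernel (h : CrossoverHypotheses M K ζ S J g)
    (hM : 0 < M) (hK : 0 < K) (hζ : 0 < ζ) {μ : RSpace d} (hμ : μ ∈ closure (omegaSet S))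
    (x : ZSpace d) {t : ℝ} (ht : 0 < t) :
    Filter.Tendsto (fun s : ℝ => sourceKernel (tilt (s • μ) J) (tilt (s • μ) g) t x)
      (nhdsWithin 1 (Set.Ico (1 / 2) 1)) (nhds (sourceKernel (tilt μ J) (tilt μ g) t x)) := by
  have hmono : nhdsWithin (1 : ℝ) (Set.Ico (1 / 2) 1) ≤ nhdsWithin 1 (Set.Icc 0 1) :=
    nhdsWithin_mono 1 fun s hs => ⟨by linarith [hs.1], hs.2.le⟩
  have hlim : ∀ (f : ZSpace d → ℝ), Summable f → Summable (tilt μ f) → ∀ k,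
      Filter.Tendsto (fun s : ℝ => latticeFourier (tilt (s • μ) f) k)
        (nhdsWithin 1 (Set.Ico (1 / 2) 1)) (nhds (latticeFourier (tilt μ f) k)) :=
    fun f h1 h2 k => by
      have := ((continuousOn_fourier_tilt h1 h2 k) 1 (by simp)).mono_left hmono
      simpa using this
  have hJ := hlim J h.oz.J_summable (h.kernelClass hM hζ hμ).summable
  have hg := hlim g h.oz.g_summable (h.sourceClass hM hζ hμ).summable
  have hfin : IsFiniteMeasure (volume.restrict (torusBox d)) :=
    ⟨by simpa using volume_torusBox_lt_top d⟩
  unfold sourceKernel invFourier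
  refine Filter.Tendsto.const_mul _ ?_
  refine tendsto_integral_filter_of_dominated_convergence (fun _ => M) ?_ ?_ (integrable_const _) ?_
  · filter_upwards [self_mem_nhdsWithin] with s hs
    have hsc := h.decay.smul_mem_closure hμ (by linarith [hs.1]) hs.2.le
    have c1 := continuous_heat (h.kernelClass hM hζ hsc).summable t
    have c2 := continuous_latticeFourier (h.sourceClass hM hζ hsc).summable
    exact ((c2.mul c1).mul (continuous_chr x)).aestronglyMeasurable
  · filter_upwards [self_mem_nhdsWithin] with s hs
    have hsc := h.decay.smul_mem_closure hμ (by linarith [hs.1]) hs.2.le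
    filter_upwards [ae_restrict_mem (measurableSet_torusBox d)] with k hk
    rw [norm_mul, norm_mul, norm_chr, mul_one, norm_heat]
    have e2 : Real.exp (-(t * (latticeFourier (tilt (s • μ) J) 0
        - latticeFourier (tilt (s • μ) J) k).re)) ≤ 1 :=
      Real.exp_le_one_iff.mpr (by have := h.re_symbol_nonneg hM hK hζ hsc k hk; nlinarith)
    have hgs := h.sourceClass hM hζ hsc
    calc _ ≤ M * 1 := by
          gcongr
          exact (norm_latticeFourier_le hgs.summable k).trans hgs.norm_le
      _ = M := mul_one M
  · refine Filter.Eventually.of_forall fun k => ?_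
    exact ((hg k).mul ((Complex.continuous_exp.tendsto _).comp
      (((hJ k).sub (hJ 0)).const_mul _))).mul_const _

/-- The representation holds inside Ω with killing rate 1 - ∑ J^{(sμ)}. As s ↑ 1 the rate tends to
0, the kernels converge for each t, and the domination above permits passage to the limit. -/
theorem CrossoverHypotheses.mul_exp_eq_integral (h : CrossoverHypotheses M K ζ S J g)
    (hM : 0 < M) (hK : 0 < K) (hζ : 0 < ζ) {μ : RSpace d} (hμ : μ ∈ frontier (omegaSet S))
    (x : ZSpace d) :
    IntegrableOn (fun t => (sourceKernel (tilt μ J) (tilt μ g) t x).re) (Set.Ioi 0) ∧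
      S x * Real.exp (inner ℝ μ (latticeVec x))
        = ∫ t in Set.Ioi (0 : ℝ), (sourceKernel (tilt μ J) (tilt μ g) t x).re := by
  obtain ⟨hμc, hμn⟩ := h.decay.mem_frontier_iff.mp hμ
  have hμ0 : μ ≠ 0 := fun h0 => hμn (h0 ▸ h.decay.zero_mem)
  obtain ⟨B, hBint, hB⟩ := h.exists_dominating hM hK hζ hμc hμ0 x
  have hQ1 := (h.kernelClass hM hζ hμc).summable
  have hg1 := (h.sourceClass hM hζ hμc).summable
  have hint : IntegrableOn (fun t => sourceKernel (tilt μ J) (tilt μ g) t x) (Set.Ioi 0) := by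
    refine Integrable.mono' hBint (continuous_sourceKernel hQ1 hg1 x).aestronglyMeasurable ?_
    filter_upwards [ae_restrict_mem measurableSet_Ioi] with t ht
    have := hB 1 (by norm_num) t ht
    rwa [one_smul] at this
  refine ⟨hint.re, ?_⟩
  have hne : (nhdsWithin (1 : ℝ) (Set.Ico (1 / 2) 1)).NeBot := by
    rw [← mem_closure_iff_nhdsWithin_neBot, closure_Ico (by norm_num)]; norm_num
  have hmono : nhdsWithin (1 : ℝ) (Set.Ico (1 / 2) 1) ≤ nhdsWithin 1 (Set.Icc 0 1) :=
    nhdsWithin_mono 1 fun s hs => ⟨by linarith [hs.1], hs.2.le⟩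
  have hleft : Filter.Tendsto (fun s : ℝ => (tilt (s • μ) S x : ℂ))
      (nhdsWithin 1 (Set.Ico (1 / 2) 1)) (nhds (tilt μ S x : ℂ)) := by
    have hc : Continuous fun s : ℝ => (tilt (s • μ) S x : ℂ) := by
      unfold tilt; simp only [real_inner_smul_left]; fun_prop
    have := (hc.tendsto 1).mono_left (nhdsWithin_le_nhds (s := Set.Ico (1 / 2 : ℝ) 1))
    simpa using this
  have hδ : Filter.Tendsto (fun s : ℝ => ((1 - ∑' y, tilt (s • μ) J y : ℝ) : ℂ))
      (nhdsWithin 1 (Set.Ico (1 / 2) 1)) (nhds 0) := by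
    have h1 := ((continuousOn_fourier_tilt h.oz.J_summable hQ1 0) 1 (by simp)).mono_left hmono
    have h2 := h1.const_sub 1
    simp only [one_smul, latticeFourier_zero, h.tsum_tilt_frontier hM hζ hμ] at h2
    simpa using h2
  have hright : Filter.Tendsto (fun s : ℝ => ∫ t in Set.Ioi (0 : ℝ),
      Complex.exp (-(((1 - ∑' y, tilt (s • μ) J y : ℝ) : ℂ) * t)) *
        sourceKernel (tilt (s • μ) J) (tilt (s • μ) g) t x)
      (nhdsWithin 1 (Set.Ico (1 / 2) 1))
      (nhds (∫ t in Set.Ioi (0 : ℝ), sourceKernel (tilt μ J) (tilt μ g) t x)) := by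
    refine tendsto_integral_filter_of_dominated_convergence B ?_ ?_ hBint ?_
    · filter_upwards [self_mem_nhdsWithin] with s hs
      have hsc := h.decay.smul_mem_closure hμc (by linarith [hs.1]) hs.2.le
      have c1 := continuous_sourceKernel (h.kernelClass hM hζ hsc).summable
        (h.sourceClass hM hζ hsc).summable x
      exact (Continuous.mul (by fun_prop) c1).aestronglyMeasurable
    · filter_upwards [self_mem_nhdsWithin] with s hs
      have hsm := h.decay.smul_mem hμc (by linarith [hs.1]) hs.2
      filter_upwards [ae_restrict_mem measurableSet_Ioi] with t ht
      rw [norm_mul, ← Complex.ofReal_mul, ← Complex.ofReal_neg, ← Complex.ofReal_exp,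
        Complex.norm_real, Real.norm_of_nonneg (Real.exp_pos _).le]
      have e : Real.exp (-((1 - ∑' y, tilt (s • μ) J y) * t)) ≤ 1 :=
        Real.exp_le_one_iff.mpr (by
          have h1 := h.tsum_tilt_lt_one hM hζ hsm
          have h2 : 0 < t := ht
          have : 0 < (1 - ∑' y, tilt (s • μ) J y) * t := mul_pos (by linarith) h2
          linarith)
      calc _ ≤ 1 * B t := by
            gcongr; exact hB s ⟨hs.1, hs.2.le⟩ t ht
        _ = B t := one_mul _
    · filter_upwards [ae_restrict_mem measurableSet_Ioi] with t ht
      have h1 := (Complex.continuous_exp.tendsto _).comp ((hδ.mul_const (t : ℂ)).neg)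
      have h2 := h1.mul (h.tendsto_sourceKernel hM hK hζ hμc x ht)
      simpa [Function.comp_def] using h2
  have heq : ∀ᶠ s : ℝ in nhdsWithin 1 (Set.Ico (1 / 2) 1), (tilt (s • μ) S x : ℂ)
      = ∫ t in Set.Ioi (0 : ℝ),
        Complex.exp (-(((1 - ∑' y, tilt (s • μ) J y : ℝ) : ℂ) * t)) *
          sourceKernel (tilt (s • μ) J) (tilt (s • μ) g) t x := by
    filter_upwards [self_mem_nhdsWithin] with s hs
    exact h.tilt_eq_integral hM hK hζ (h.decay.smul_mem hμc (by linarith [hs.1]) hs.2) x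
  have hfinal := tendsto_nhds_unique (hleft.congr' heq) hright
  have := congrArg Complex.re hfinal
  rw [Complex.ofReal_re] at this
  rw [← tilt, this]
  exact (integral_re hint).symm

end Domain

/-! ### Time integrals of travelling profiles -/

/-- A diffusive profile that travels at speed `β`, seen at distance `X`. -/
def profile (d : ℕ) (α X β t : ℝ) : ℝ :=
  max t 1 ^ (-(d : ℝ) / 2) * (1 + |X - t * β| / √(max t 1)) ^ (-α)

theorem profile_pos (d : ℕ) (α X β t : ℝ) : 0 < profile d α X β t := by
  have : 0 < max t 1 := lt_max_of_lt_right one_pos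
  unfold profile; positivity

theorem measurable_profile (d : ℕ) (α X β : ℝ) : Measurable (profile d α X β) := by
  unfold profile; fun_prop

theorem integral_le_of_le_on {f g : ℝ → ℝ} {A : Set ℝ} {r : ℝ} (hA : MeasurableSet A)
    (hf : Measurable f) (hf0 : ∀ t, 0 ≤ f t) (hg : IntegrableOn g A) (hfg : ∀ t ∈ A, f t ≤ g t)
    (hr : ∫ t in A, g t ≤ r) : IntegrableOn f A ∧ ∫ t in A, f t ≤ r := by
  have hi : IntegrableOn f A := by
    refine Integrable.mono' hg hf.aestronglyMeasurable ?_
    filter_upwards [ae_restrict_mem hA] with t ht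
    rw [Real.norm_of_nonneg (hf0 t)]; exact hfg t ht
  exact ⟨hi, (setIntegral_mono_on hi hg hA hfg).trans hr⟩

theorem integral_union_le {f : ℝ → ℝ} {A B : Set ℝ} {a b : ℝ} (hB : MeasurableSet B)
    (hAB : Disjoint A B) (h1 : IntegrableOn f A ∧ ∫ t in A, f t ≤ a)
    (h2 : IntegrableOn f B ∧ ∫ t in B, f t ≤ b) :
    IntegrableOn f (A ∪ B) ∧ ∫ t in A ∪ B, f t ≤ a + b := by
  refine ⟨h1.1.union h2.1, ?_⟩
  rw [setIntegral_union hAB hB h1.1 h2.1]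
  exact add_le_add h1.2 h2.2

/-- Before arrival the integrand is at most a constant times X^{-α} max(t,1)^{(α-d)/2}. Splitting
off t^{-3/4}, which is integrable at 0, leaves a power with non-negative exponent, bounded by its
value at T. The factor 4 is the integral of t^{-3/4} over (0, 1]. -/
theorem integral_profile_early {d : ℕ} {α X β T : ℝ} (hα : 0 ≤ α) (hαd : -(3 / 2) ≤ α - d)
    (hX : 0 < X) (hT : 1 ≤ T) (hD : ∀ t ∈ Set.Ioc 0 T, X / 2 ≤ |X - t * β|) :
    IntegrableOn (profile d α X β) (Set.Ioc 0 T) ∧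
      ∫ t in Set.Ioc 0 T, profile d α X β t ≤ 4 * 2 ^ α * (X ^ (-α) * T ^ ((α - d) / 2 + 1)) := by
  have hT0 : 0 < T := by linarith
  have hint : IntegrableOn (fun t : ℝ => t ^ (-(3 / 4) : ℝ)) (Set.Ioc 0 T) := by
    have := (intervalIntegral.intervalIntegrable_rpow' (a := 0) (b := T)
      (show (-1 : ℝ) < -(3 / 4) by norm_num)).1
    exact this
  refine integral_le_of_le_on measurableSet_Ioc (measurable_profile _ _ _ _)
    (fun t => (profile_pos _ _ _ _ _).le)
    (hint.const_mul (2 ^ α * X ^ (-α) * T ^ ((α - d) / 2 + 3 / 4))) (fun t ht => ?_) (le_of_eq ?_)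
  · have ht0 : 0 < t := ht.1
    unfold profile
    set τ := max t 1 with hτ
    have hτ0 : 0 < τ := lt_max_of_lt_right one_pos
    have hs : 0 < √τ := Real.sqrt_pos.mpr hτ0
    have h1 : (1 + |X - t * β| / √τ) ^ (-α) ≤ 2 ^ α * X ^ (-α) * τ ^ (α / 2) := by
      calc _ ≤ (X / 2 / √τ) ^ (-α) := by
            refine Real.rpow_le_rpow_of_nonpos (by positivity) ?_ (by linarith)
            have := hD t ht
            have h2 : X / 2 / √τ ≤ |X - t * β| / √τ := by gcongr
            linarith
        _ = _ := by
            rw [Real.div_rpow (by positivity) hs.le, Real.div_rpow hX.le (by norm_num),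
              Real.sqrt_eq_rpow, ← Real.rpow_mul hτ0.le, Real.rpow_neg (by norm_num : (0:ℝ) ≤ 2),
              show (1 / 2 : ℝ) * -α = -(α / 2) by ring, Real.rpow_neg hτ0.le]
            field_simp
    have h3 : τ ^ (-(d : ℝ) / 2) * τ ^ (α / 2) ≤ T ^ ((α - d) / 2 + 3 / 4) * t ^ (-(3 / 4) : ℝ) := by
      rw [← Real.rpow_add hτ0, show -(d : ℝ) / 2 + α / 2 = ((α - d) / 2 + 3 / 4) + -(3 / 4) by ring,
        Real.rpow_add hτ0]
      gcongr ?_ * ?_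
      · exact Real.rpow_le_rpow hτ0.le (max_le ht.2 hT) (by linarith)
      · exact Real.rpow_le_rpow_of_nonpos ht0 (le_max_left _ _) (by norm_num)
    calc _ ≤ τ ^ (-(d : ℝ) / 2) * (2 ^ α * X ^ (-α) * τ ^ (α / 2)) := by gcongr
      _ = 2 ^ α * X ^ (-α) * (τ ^ (-(d : ℝ) / 2) * τ ^ (α / 2)) := by ring
      _ ≤ 2 ^ α * X ^ (-α) * (T ^ ((α - d) / 2 + 3 / 4) * t ^ (-(3 / 4) : ℝ)) := by gcongr
      _ = _ := by ring
  · rw [integral_const_mul, ← intervalIntegral.integral_of_le hT0.le,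
      integral_rpow (Or.inl (by norm_num))]
    rw [Real.zero_rpow (by norm_num), show (α - (d : ℝ)) / 2 + 1
      = ((α - d) / 2 + 3 / 4) + (-(3 / 4) + 1) by ring, Real.rpow_add hT0 _ (-(3 / 4) + 1)]
    ring

theorem integral_one_add_abs {α c T : ℝ} (hα : 1 < α) (hc : 0 < c) :
    Integrable (fun t : ℝ => (1 + c * |t - T|) ^ (-α)) ∧
      ∫ t : ℝ, (1 + c * |t - T|) ^ (-α) = (∫ u : ℝ, (1 + |u|) ^ (-α)) / c := by
  have h0 : Integrable fun u : ℝ => (1 + |u|) ^ (-α) := by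
    have := integrable_one_add_norm (E := ℝ) (μ := volume) (r := α) (by simpa using hα)
    simpa using this
  have e : (fun t : ℝ => (1 + c * |t - T|) ^ (-α)) = fun t => (fun u => (1 + |c * u|) ^ (-α)) (t - T) := by
    ext t; simp only [abs_mul, abs_of_pos hc]
  rw [e]
  constructor
  · exact (h0.comp_mul_left' hc.ne').comp_sub_right T
  · rw [integral_sub_right_eq_self (fun u : ℝ => (1 + |c * u|) ^ (-α)) T,
      Measure.integral_comp_mul_left (fun u : ℝ => (1 + |u|) ^ (-α)) c, abs_inv, abs_of_pos hc,
      smul_eq_mul]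
    ring

/-- The hypothesis sT ≤ X² says that the diffusive spread √T is at most of order X. The conclusion
is what makes the early and late contributions no larger than that of the arrival window. -/
theorem rpow_ratio_le {α X T s : ℝ} (hα : 1 ≤ α) (hX : 0 < X) (hT : 0 < T) (hs : 0 < s)
    (h : s * T ≤ X ^ 2) : X ^ (1 - α) * T ^ ((α - 1) / 2) ≤ s ^ (-((α - 1) / 2)) := by
  have e : X ^ (1 - α) = (X ^ 2) ^ (-((α - 1) / 2)) := by
    rw [← Real.rpow_natCast, ← Real.rpow_mul hX.le]; congr 1; push_cast; ring
  have h1 : (X ^ 2) ^ (-((α - 1) / 2)) ≤ (s * T) ^ (-((α - 1) / 2)) :=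
    Real.rpow_le_rpow_of_nonpos (by positivity) h (by linarith)
  rw [e]
  calc _ ≤ (s * T) ^ (-((α - 1) / 2)) * T ^ ((α - 1) / 2) := by gcongr
    _ = _ := by
      rw [Real.mul_rpow hs.le hT.le, mul_assoc, ← Real.rpow_add hT]; simp

/-- Three time ranges. In (T/2, 2T] the profile is a bump of width √T/β around T, integrable since α
> 1. For t ≤ T/2 the distance is at least X/2, and for t > 2T at least tβ/2; both produce
X^{-α}T^{(α-d)/2+1}, which `rpow_ratio_le` compares with the main term. -/
theorem integral_profile_ballistic (d : ℕ) {α s : ℝ} (hd : 1 ≤ d) (hα : 3 / 2 ≤ α)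
    (hαd : -(3 / 2) ≤ α - d) (hs : 0 < s) :
    ∃ C, 0 < C ∧ ∀ X β T : ℝ, 0 < X → 0 < β → 2 ≤ T → β * T = X → s * T ≤ X ^ 2 →
      IntegrableOn (profile d α X β) (Set.Ioi 0) ∧
        ∫ t in Set.Ioi (0 : ℝ), profile d α X β t ≤ C * (T ^ ((3 - (d : ℝ)) / 2) / X) := by
  set I := ∫ u : ℝ, (1 + |u|) ^ (-α) with hI
  have hI0 : 0 ≤ I := integral_nonneg fun u => by positivity
  have hd' : (1 : ℝ) ≤ d := by exact_mod_cast hd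
  set q := (d + α) / 2 - 1 with hq
  have hq0 : 0 < q := by rw [hq]; linarith
  set Z := s ^ (-((α - 1) / 2)) with hZ
  have hZ0 : 0 < Z := Real.rpow_pos_of_pos hs _
  refine ⟨4 * 2 ^ α * Z + 2 ^ ((d : ℝ) / 2) * √2 * I + 2 ^ α * Z / q, by positivity,
    fun X β T hX hβ hT hβT hsT => ?_⟩
  have hT0 : 0 < T := by linarith
  set E := T ^ ((3 - (d : ℝ)) / 2) / X with hE
  have hE0 : 0 < E := by positivity
  have hratio := rpow_ratio_le (by linarith : 1 ≤ α) hX hT0 hs hsT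
  have hβe : β = X / T := by rw [← hβT]; field_simp
  have hearly := integral_profile_early (d := d) (β := β) (T := T / 2) (by linarith : 0 ≤ α) hαd hX
    (by linarith) (fun t ht => by
      have : t * β ≤ T / 2 * β := by gcongr; exact ht.2
      rw [abs_of_nonneg (by nlinarith)]; nlinarith)
  have hE1 : X ^ (-α) * T ^ ((α - d) / 2 + 1) ≤ Z * E := by
    have e : X ^ (-α) * T ^ ((α - d) / 2 + 1) = (X ^ (1 - α) * T ^ ((α - 1) / 2)) * E := by
      rw [hE, show -α = (1 - α) - 1 by ring, Real.rpow_sub_one hX.ne',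
        show (α - (d : ℝ)) / 2 + 1 = (α - 1) / 2 + (3 - d) / 2 by ring, Real.rpow_add hT0]
      ring
    rw [e]; gcongr
  have h1 : IntegrableOn (profile d α X β) (Set.Ioc 0 (T / 2)) ∧
      ∫ t in Set.Ioc 0 (T / 2), profile d α X β t ≤ 4 * 2 ^ α * Z * E := by
    refine ⟨hearly.1, hearly.2.trans ?_⟩
    rw [mul_assoc (4 * 2 ^ α)]
    refine mul_le_mul_of_nonneg_left (le_trans ?_ hE1) (by positivity)
    gcongr
    · linarith
    · linarith
  have h2 : IntegrableOn (profile d α X β) (Set.Ioc (T / 2) (2 * T)) ∧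
      ∫ t in Set.Ioc (T / 2) (2 * T), profile d α X β t ≤ 2 ^ ((d : ℝ) / 2) * √2 * I * E := by
    set c := β / √(2 * T) with hc
    have hc0 : 0 < c := by positivity
    obtain ⟨i1, i2⟩ := integral_one_add_abs (T := T) (by linarith : 1 < α) hc0
    refine integral_le_of_le_on measurableSet_Ioc (measurable_profile _ _ _ _)
      (fun t => (profile_pos _ _ _ _ _).le)
      (i1.integrableOn.const_mul ((T / 2) ^ (-(d : ℝ) / 2))) (fun t ht => ?_) ?_
    · have ht1 : 1 ≤ t := by linarith [ht.1]
      unfold profile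
      rw [max_eq_left ht1]
      have hst : 0 < √t := Real.sqrt_pos.mpr (by linarith)
      gcongr ?_ * ?_
      · exact Real.rpow_le_rpow_of_nonpos (by linarith) ht.1.le (by linarith)
      · refine Real.rpow_le_rpow_of_nonpos (by positivity) ?_ (by linarith)
        have e : |X - t * β| = β * |t - T| := by
          rw [← hβT, ← abs_of_pos hβ, ← abs_mul, abs_of_pos hβ, ← abs_neg]; congr 1; ring
        rw [e, hc, div_mul_eq_mul_div]
        gcongr
        exact ht.2
    · rw [integral_const_mul]
      calc _ ≤ (T / 2) ^ (-(d : ℝ) / 2) * ∫ t : ℝ, (1 + c * |t - T|) ^ (-α) := by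
            refine mul_le_mul_of_nonneg_left ?_ (by positivity)
            exact setIntegral_le_integral i1 (Filter.Eventually.of_forall fun t => by positivity)
        _ = _ := by
            rw [i2, hc, hE, hβe, Real.div_rpow hT0.le (by norm_num), neg_div,
              Real.rpow_neg (by norm_num : (0 : ℝ) ≤ 2), Real.sqrt_mul (by norm_num),
              show (3 - (d : ℝ)) / 2 = -(d / 2) + 1 / 2 + 1 by ring, Real.rpow_add hT0,
              Real.rpow_add hT0, ← Real.sqrt_eq_rpow, Real.rpow_one, ← hI]
            field_simp
  have h3 : IntegrableOn (profile d α X β) (Set.Ioi (2 * T)) ∧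
      ∫ t in Set.Ioi (2 * T), profile d α X β t ≤ 2 ^ α * Z / q * E := by
    have hq1 : -q - 1 < -1 := by linarith
    refine integral_le_of_le_on measurableSet_Ioi (measurable_profile _ _ _ _)
      (fun t => (profile_pos _ _ _ _ _).le)
      ((integrableOn_Ioi_rpow_of_lt hq1 (by positivity : 0 < 2 * T)).const_mul (2 ^ α * β ^ (-α)))
      (fun t ht => ?_) ?_
    · have ht2 : 2 * T < t := ht
      have ht0 : 0 < t := by linarith
      unfold profile
      rw [max_eq_left (by linarith)]
      have hst : 0 < √t := Real.sqrt_pos.mpr ht0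
      have h4 : (1 + |X - t * β| / √t) ^ (-α) ≤ 2 ^ α * β ^ (-α) * t ^ (-(α / 2)) := by
        calc _ ≤ (β / 2 * √t) ^ (-α) := by
              refine Real.rpow_le_rpow_of_nonpos (by positivity) ?_ (by linarith)
              have h5 : β / 2 * √t ≤ |X - t * β| / √t := by
                rw [le_div_iff₀ hst, mul_assoc, Real.mul_self_sqrt ht0.le]
                refine le_trans ?_ (neg_le_abs _)
                nlinarith
              linarith
          _ = _ := by
              rw [Real.mul_rpow (by positivity) hst.le, Real.div_rpow hβ.le (by norm_num),
                Real.sqrt_eq_rpow, ← Real.rpow_mul ht0.le, Real.rpow_neg (by norm_num : (0:ℝ) ≤ 2),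
                show (1 / 2 : ℝ) * -α = -(α / 2) by ring]
              field_simp
      calc _ ≤ t ^ (-(d : ℝ) / 2) * (2 ^ α * β ^ (-α) * t ^ (-(α / 2))) := by gcongr
        _ = 2 ^ α * β ^ (-α) * (t ^ (-(d : ℝ) / 2) * t ^ (-(α / 2))) := by ring
        _ = _ := by
            rw [← Real.rpow_add ht0]; congr 2; rw [hq]; ring
    · rw [integral_const_mul, integral_Ioi_rpow_of_lt hq1 (by positivity : 0 < 2 * T)]
      rw [show -q - 1 + 1 = -q by ring, neg_div_neg_eq]
      have h5 : (2 * T) ^ (-q) ≤ T ^ (-q) :=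
        Real.rpow_le_rpow_of_nonpos hT0 (by linarith) (by linarith)
      have e : β ^ (-α) * T ^ (-q) = X ^ (-α) * T ^ ((α - d) / 2 + 1) := by
        rw [hβe, Real.div_rpow hX.le hT0.le, div_mul_eq_mul_div, mul_div_assoc, ← Real.rpow_sub hT0]
        congr 2; rw [hq]; ring
      calc 2 ^ α * β ^ (-α) * ((2 * T) ^ (-q) / q) ≤ 2 ^ α * β ^ (-α) * (T ^ (-q) / q) := by gcongr
        _ = 2 ^ α * (β ^ (-α) * T ^ (-q)) / q := by ring
        _ ≤ 2 ^ α * (Z * E) / q := by rw [e]; gcongr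
        _ = _ := by ring
  have h12 := integral_union_le measurableSet_Ioc
    (Set.Ioc_disjoint_Ioc_of_le (le_refl (T / 2))) h1 h2
  rw [Set.Ioc_union_Ioc_eq_Ioc (by linarith) (by linarith)] at h12
  have h123 := integral_union_le measurableSet_Ioi
    (Set.Ioc_disjoint_Ioi (le_refl (2 * T))) h12 h3
  rw [Set.Ioc_union_Ioi_eq_Ioi (by linarith)] at h123
  refine ⟨h123.1, h123.2.trans (le_of_eq ?_)⟩
  ring

/-- If βX ≤ 1 the drift moves by at most X/2 up to time X²/2, so the early estimate applies.
Afterwards spatial decay is discarded and t^{-d/2} is integrated, which converges because d > 2. -/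
theorem integral_profile_diffusive (d : ℕ) {α : ℝ} (hd : 3 ≤ d) (hα : 0 ≤ α)
    (hαd : -(3 / 2) ≤ α - d) :
    ∃ C, 0 < C ∧ ∀ X β : ℝ, 2 ≤ X → 0 < β → β * X ≤ 1 →
      IntegrableOn (profile d α X β) (Set.Ioi 0) ∧
        ∫ t in Set.Ioi (0 : ℝ), profile d α X β t ≤ C * X ^ (2 - (d : ℝ)) := by
  have hd' : (3 : ℝ) ≤ d := by exact_mod_cast hd
  set q := (d : ℝ) / 2 - 1 with hq
  have hq0 : 0 < q := by rw [hq]; linarith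
  refine ⟨4 * 2 ^ α + 2 ^ q / q, by positivity, fun X β hX hβ hβX => ?_⟩
  have hX0 : 0 < X := by linarith
  have hT0 : 0 < X ^ 2 / 2 := by positivity
  have hpow : (X ^ 2) ^ (-q) = X ^ (2 - (d : ℝ)) := by
    rw [← Real.rpow_natCast, ← Real.rpow_mul hX0.le]; congr 1; rw [hq]; push_cast; ring
  have h1 : IntegrableOn (profile d α X β) (Set.Ioc 0 (X ^ 2 / 2)) ∧
      ∫ t in Set.Ioc 0 (X ^ 2 / 2), profile d α X β t ≤ 4 * 2 ^ α * X ^ (2 - (d : ℝ)) := by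
    have hearly := integral_profile_early (d := d) (β := β) (T := X ^ 2 / 2) hα hαd hX0
      (by nlinarith) (fun t ht => by
        have : t * β ≤ X ^ 2 / 2 * β := by gcongr; exact ht.2
        have h2 : X ^ 2 / 2 * β ≤ X / 2 := by nlinarith
        rw [abs_of_nonneg (by nlinarith)]; linarith)
    refine ⟨hearly.1, hearly.2.trans ?_⟩
    gcongr
    calc X ^ (-α) * (X ^ 2 / 2) ^ ((α - d) / 2 + 1)
        ≤ X ^ (-α) * (X ^ 2) ^ ((α - d) / 2 + 1) := by
          gcongr
          · linarith
          · linarith [sq_nonneg X]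
      _ = _ := by
          rw [← Real.rpow_natCast, ← Real.rpow_mul hX0.le, ← Real.rpow_add hX0]
          congr 1; push_cast; ring
  have h2 : IntegrableOn (profile d α X β) (Set.Ioi (X ^ 2 / 2)) ∧
      ∫ t in Set.Ioi (X ^ 2 / 2), profile d α X β t ≤ 2 ^ q / q * X ^ (2 - (d : ℝ)) := by
    have hq1 : -q - 1 < -1 := by linarith
    refine integral_le_of_le_on measurableSet_Ioi (measurable_profile _ _ _ _)
      (fun t => (profile_pos _ _ _ _ _).le) (integrableOn_Ioi_rpow_of_lt hq1 hT0)
      (fun t ht => ?_) (le_of_eq ?_)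
    · have ht2 : X ^ 2 / 2 < t := ht
      have ht1 : 1 ≤ t := by nlinarith
      unfold profile
      rw [max_eq_left ht1]
      have h3 : (1 + |X - t * β| / √t) ^ (-α) ≤ 1 :=
        Real.rpow_le_one_of_one_le_of_nonpos
          (by have : 0 ≤ |X - t * β| / √t := by positivity
              linarith) (by linarith)
      calc _ ≤ t ^ (-(d : ℝ) / 2) * 1 := by gcongr
        _ = _ := by rw [mul_one, hq]; congr 1; ring
    · rw [integral_Ioi_rpow_of_lt hq1 hT0, show -q - 1 + 1 = -q by ring, neg_div_neg_eq,
        Real.div_rpow (by positivity) (by norm_num), hpow, Real.rpow_neg (by norm_num : (0:ℝ) ≤ 2)]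
      field_simp
  have h12 := integral_union_le measurableSet_Ioi
    (Set.Ioc_disjoint_Ioi (le_refl (X ^ 2 / 2))) h1 h2
  rw [Set.Ioc_union_Ioi_eq_Ioi hT0.le] at h12
  refine ⟨h12.1, h12.2.trans (le_of_eq ?_)⟩
  ring

/-! ### Diffusive waves: absorption of errors and time integrals -/

/-- Two-sided estimates for a function of time that behaves like a diffusive wave of speed `β`
seen at distance `X`. -/
structure DiffusiveWave (d : ℕ) (a c₀ C₁ C₂ K η X β : ℝ) (P : ℝ → ℝ) : Prop where
  integrable : IntegrableOn P (Set.Ioi 0)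
  upper : ∀ t, 0 < t → |P t| ≤ C₁ * profile d a X β t
  lower : ∀ t, 1 ≤ t → c₀ * t ^ (-(d : ℝ) / 2) * Real.exp (-(|X - t * β| ^ 2 / (4 * t * K)))
    - C₂ * t ^ (-(d : ℝ) / 2 - η / 2) ≤ P t

theorem profile_sub_le {d : ℕ} {a δ X β L t : ℝ} (hδ : 0 ≤ δ) (hL : 0 ≤ L)
    (h : L * √(max t 1) ≤ |X - t * β|) :
    profile d a X β t ≤ (1 + L) ^ (-δ) * profile d (a - δ) X β t := by
  unfold profile
  have hτ0 : 0 < max t 1 := lt_max_of_lt_right one_pos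
  have hs : 0 < √(max t 1) := Real.sqrt_pos.mpr hτ0
  have h1 : L ≤ |X - t * β| / √(max t 1) := by rwa [le_div_iff₀ hs]
  have h2 : 0 < 1 + |X - t * β| / √(max t 1) := by positivity
  rw [show -a = -δ + -(a - δ) by ring, Real.rpow_add h2]
  calc _ = (1 + |X - t * β| / √(max t 1)) ^ (-δ) * (max t 1 ^ (-(d : ℝ) / 2)
        * (1 + |X - t * β| / √(max t 1)) ^ (-(a - δ))) := by ring
    _ ≤ _ := by
      gcongr ?_ * _
      exact Real.rpow_le_rpow_of_nonpos (by positivity) (by linarith) (by linarith)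

theorem profile_mono {d : ℕ} {a δ X β t : ℝ} (hδ : 0 ≤ δ) :
    profile d a X β t ≤ profile d (a - δ) X β t := by
  have := profile_sub_le (d := d) (a := a) (X := X) (β := β) (t := t) hδ le_rfl
    (by simp)
  simpa using this

/-- Near the front (distance at most L√t) and for t ≥ t₀, the central limit error is small relative
to the profile of order a - 1/2. Far from the front the whole function is small, since giving up
half an order of decay gains (1 + L)^{-1/2}. First L is chosen large, then t₀ depending on L. -/
theorem DiffusiveWave.pointwise_lower (d : ℕ) {a c₀ C₁ C₂ K η B : ℝ} (hc : 0 < c₀) (hC₁ : 0 < C₁)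
    (hC₂ : 0 < C₂) (hK : 0 < K) (hη : 0 < η) (hB : 0 < B) (ha : 1 / 2 ≤ a) {ε : ℝ} (hε : 0 < ε) :
    ∃ R, 0 < R ∧ ∀ X β P, R ≤ X → β ≤ B → DiffusiveWave d a c₀ C₁ C₂ K η X β P → ∀ t, 0 < t →
      -(ε * profile d (a - 1 / 2) X β t) ≤ P t ∧ (|X - t * β| ≤ 2 * √t →
        c₀ * Real.exp (-(1 / K)) * t ^ (-(d : ℝ) / 2) - ε * profile d (a - 1 / 2) X β t ≤ P t) := by
  have hL : ∃ L : ℝ, 2 ≤ L ∧ C₁ * (1 + L) ^ (-(1 / 2) : ℝ) ≤ ε := by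
    have h1 := ((tendsto_rpow_neg_atTop (show (0 : ℝ) < 1 / 2 by norm_num)).comp
      (Filter.tendsto_atTop_add_const_left Filter.atTop 1 Filter.tendsto_id)).const_mul C₁
    rw [mul_zero] at h1
    obtain ⟨L, h2, h3⟩ := ((h1.eventually_le_const hε).and (Filter.eventually_ge_atTop 2)).exists
    exact ⟨L, h3, h2⟩
  obtain ⟨L, hL2, hLε⟩ := hL
  have ht : ∃ t₀ : ℝ, 1 ≤ t₀ ∧ C₂ * (1 + L) ^ (a - 1 / 2) * t₀ ^ (-(η / 2)) ≤ ε := by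
    have h1 := (tendsto_rpow_neg_atTop (show 0 < η / 2 by positivity)).const_mul
      (C₂ * (1 + L) ^ (a - 1 / 2))
    rw [mul_zero] at h1
    obtain ⟨L, h2, h3⟩ := ((h1.eventually_le_const hε).and (Filter.eventually_ge_atTop 1)).exists
    exact ⟨L, h3, h2⟩
  obtain ⟨t₀, ht1, htε⟩ := ht
  -- For X beyond this value and speed at most `B`, every time t < t₀ lies in the far region, so
  -- that short times need no central limit theorem.
  refine ⟨B * t₀ + L * √t₀ + 1, by positivity, fun X β P hX hβ h t ht0 => ?_⟩
  set D := |X - t * β| with hD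
  set w := profile d (a - 1 / 2) X β t with hw
  have hw0 : 0 < w := profile_pos _ _ _ _ _
  by_cases hnear : t₀ ≤ t ∧ D ≤ L * √t
  · obtain ⟨htt, hDL⟩ := hnear
    have ht1' : 1 ≤ t := ht1.trans htt
    have hst : 0 < √t := Real.sqrt_pos.mpr ht0
    have herr : C₂ * t ^ (-(d : ℝ) / 2 - η / 2) ≤ ε * w := by
      have h1 : (1 + L) ^ (-(a - 1 / 2)) ≤ (1 + D / √t) ^ (-(a - 1 / 2)) := by
        refine Real.rpow_le_rpow_of_nonpos (by positivity) ?_ (by linarith)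
        have : D / √t ≤ L := by rwa [div_le_iff₀ hst]
        linarith
      have h2 : t ^ (-(η / 2)) ≤ t₀ ^ (-(η / 2)) :=
        Real.rpow_le_rpow_of_nonpos (by linarith) htt (by linarith)
      have h3 : (1 + L) ^ (a - 1 / 2) * (1 + L) ^ (-(a - 1 / 2)) = 1 := by
        rw [← Real.rpow_add (by linarith)]; simp
      have h4 : w = t ^ (-(d : ℝ) / 2) * (1 + D / √t) ^ (-(a - 1 / 2)) := by
        rw [hw, profile, max_eq_left ht1']
      calc C₂ * t ^ (-(d : ℝ) / 2 - η / 2) = C₂ * (t ^ (-(d : ℝ) / 2) * t ^ (-(η / 2))) := by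
            rw [← Real.rpow_add ht0]; rfl
        _ ≤ C₂ * (t ^ (-(d : ℝ) / 2) * t₀ ^ (-(η / 2))) := by gcongr
        _ = (C₂ * (1 + L) ^ (a - 1 / 2) * t₀ ^ (-(η / 2)))
            * (t ^ (-(d : ℝ) / 2) * (1 + L) ^ (-(a - 1 / 2))) := by
            linear_combination -(C₂ * t ^ (-(d : ℝ) / 2) * t₀ ^ (-(η / 2))) * h3
        _ ≤ ε * (t ^ (-(d : ℝ) / 2) * (1 + D / √t) ^ (-(a - 1 / 2))) := by gcongr
        _ = _ := by rw [h4]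
    have hlow := h.lower t ht1'
    refine ⟨?_, fun hD2 => ?_⟩
    · have : 0 < c₀ * t ^ (-(d : ℝ) / 2) * Real.exp (-(|X - t * β| ^ 2 / (4 * t * K))) := by
        positivity
      linarith
    · have h5 : Real.exp (-(1 / K)) ≤ Real.exp (-(|X - t * β| ^ 2 / (4 * t * K))) := by
        rw [Real.exp_le_exp, neg_le_neg_iff, div_le_div_iff₀ (by positivity) hK]
        have : D ^ 2 ≤ (2 * √t) ^ 2 := by gcongr
        rw [mul_pow, Real.sq_sqrt ht0.le] at this
        have := mul_le_mul_of_nonneg_right this hK.le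
        linarith
      have h6 : c₀ * Real.exp (-(1 / K)) * t ^ (-(d : ℝ) / 2)
          ≤ c₀ * t ^ (-(d : ℝ) / 2) * Real.exp (-(|X - t * β| ^ 2 / (4 * t * K))) := by
        rw [mul_right_comm]; gcongr
      linarith
  · have hfar : L * √(max t 1) < D := by
      by_cases htt : t₀ ≤ t
      · rw [max_eq_left (ht1.trans htt)]
        by_contra! hcon
        exact hnear ⟨htt, hcon⟩
      · have htt : t < t₀ := not_le.mp htt
        have h1 : √(max t 1) ≤ √t₀ := Real.sqrt_le_sqrt (max_le htt.le ht1)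
        have h2 : L * √(max t 1) ≤ L * √t₀ := by gcongr
        have h3 : t * β ≤ B * t₀ := by
          calc t * β ≤ t * B := by gcongr
            _ ≤ t₀ * B := by gcongr
            _ = _ := mul_comm _ _
        have h4 := le_abs_self (X - t * β)
        rw [← hD] at h4
        linarith
    have hP : |P t| ≤ ε * w := by
      calc |P t| ≤ C₁ * profile d a X β t := h.upper t ht0
        _ ≤ C₁ * ((1 + L) ^ (-(1 / 2) : ℝ) * w) := by
            gcongr; exact profile_sub_le (by norm_num) (by linarith) hfar.le
        _ = C₁ * (1 + L) ^ (-(1 / 2) : ℝ) * w := by ring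
        _ ≤ ε * w := by gcongr
    refine ⟨(abs_le.mp hP).1, fun hD2 => ?_⟩
    exfalso
    have h1 : √t ≤ √(max t 1) := Real.sqrt_le_sqrt (le_max_left _ _)
    nlinarith [Real.sqrt_nonneg t]

theorem integral_ge_of_window {P w : ℝ → ℝ} {ε b T₁ T₂ : ℝ} (hP : IntegrableOn P (Set.Ioi 0))
    (hw : IntegrableOn w (Set.Ioi 0)) (h1 : ∀ t, 0 < t → -(ε * w t) ≤ P t) (hT₁ : 0 < T₁)
    (hT : T₁ ≤ T₂) (h2 : ∀ t ∈ Set.Icc T₁ T₂, b - ε * w t ≤ P t) :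
    b * (T₂ - T₁) - ε * ∫ t in Set.Ioi 0, w t ≤ ∫ t in Set.Ioi 0, P t := by
  have hsub : Set.Icc T₁ T₂ ⊆ Set.Ioi 0 := fun t ht => lt_of_lt_of_le hT₁ ht.1
  have hi := hP.add (hw.const_mul ε)
  have h3 : ∫ t in Set.Icc T₁ T₂, b ≤ ∫ t in Set.Icc T₁ T₂, (P t + ε * w t) :=
    setIntegral_mono_on (integrableOn_const (by simp)) (hi.mono_set hsub) measurableSet_Icc
      fun t ht => by linarith [h2 t ht]
  have h4 : ∫ t in Set.Icc T₁ T₂, (P t + ε * w t) ≤ ∫ t in Set.Ioi 0, (P t + ε * w t) := by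
    refine setIntegral_mono_set hi ?_ hsub.eventuallyLE
    filter_upwards [ae_restrict_mem measurableSet_Ioi] with t ht
    have := h1 t ht
    simp only [Pi.zero_apply]; linarith
  rw [integral_add hP (hw.const_mul ε), integral_const_mul] at h4
  rw [setIntegral_const, smul_eq_mul, Measure.real, Real.volume_Icc,
    ENNReal.toReal_ofReal (by linarith)] at h3
  linarith

theorem DiffusiveWave.integral_le {d : ℕ} {a c₀ C₁ C₂ K η X β E : ℝ} {P : ℝ → ℝ} (hC₁ : 0 < C₁)
    (h : DiffusiveWave d a c₀ C₁ C₂ K η X β P)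
    (hw : IntegrableOn (profile d (a - 1 / 2) X β) (Set.Ioi 0) ∧
      ∫ t in Set.Ioi (0 : ℝ), profile d (a - 1 / 2) X β t ≤ E) :
    ∫ t in Set.Ioi (0 : ℝ), P t ≤ C₁ * E := by
  calc _ ≤ ∫ t in Set.Ioi (0 : ℝ), C₁ * profile d (a - 1 / 2) X β t := by
        refine setIntegral_mono_on h.integrable (hw.1.const_mul _) measurableSet_Ioi fun t ht => ?_
        refine (le_abs_self _).trans ((h.upper t ht).trans ?_)
        gcongr
        exact profile_mono (by norm_num)
    _ ≤ _ := by rw [integral_const_mul]; gcongr; exact hw.2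

theorem DiffusiveWave.integral_ballistic (d : ℕ) {a c₀ C₁ C₂ K η B s : ℝ} (hd : 1 ≤ d)
    (ha : 2 ≤ a) (had : -1 ≤ a - d) (hc : 0 < c₀) (hC₁ : 0 < C₁) (hC₂ : 0 < C₂) (hK : 0 < K)
    (hη : 0 < η) (hB : 0 < B) (hs : 0 < s) :
    ∃ R c C, 0 < R ∧ 0 < c ∧ 0 < C ∧ ∀ X β P, R ≤ X → 0 < β → β ≤ B → s ≤ β * X →
      DiffusiveWave d a c₀ C₁ C₂ K η X β P →
        c * ((X / β) ^ ((3 - (d : ℝ)) / 2) / X) ≤ ∫ t in Set.Ioi (0 : ℝ), P t ∧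
        ∫ t in Set.Ioi (0 : ℝ), P t ≤ C * ((X / β) ^ ((3 - (d : ℝ)) / 2) / X) := by
  obtain ⟨C, hC, hCw⟩ := integral_profile_ballistic d (α := a - 1 / 2) hd (by linarith)
    (by linarith) hs
  set c₁ := c₀ * Real.exp (-(1 / K)) with hc₁
  have hc₁0 : 0 < c₁ := by positivity
  set κ := (1 + (√s)⁻¹) ^ (-(d : ℝ) / 2) with hκ
  have hss : 0 < √s := Real.sqrt_pos.mpr hs
  have hκ0 : 0 < κ := by positivity
  -- The errors integrate to at most ε C E, half of the main contribution c₁ κ E of the window.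
  set ε := c₁ * κ / (2 * C) with hε
  have hε0 : 0 < ε := by positivity
  obtain ⟨R, hR, hlow⟩ := DiffusiveWave.pointwise_lower d hc hC₁ hC₂ hK hη hB
    (by linarith : 1 / 2 ≤ a) hε0
  refine ⟨R + 2 * B, c₁ * κ / 2, C₁ * C, by positivity, by positivity, by positivity,
    fun X β P hX hβ hβB hsX h => ?_⟩
  have hX0 : 0 < X := by linarith
  set T := X / β with hT
  have hT2 : 2 ≤ T := by rw [hT, le_div_iff₀ hβ]; linarith
  have hT0 : 0 < T := by linarith
  have hβT : β * T = X := by rw [hT]; field_simp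
  have hw := hCw X β T hX0 hβ hT2 hβT (by
    have : s * T ≤ β * X * T := by gcongr
    nlinarith)
  set E := T ^ ((3 - (d : ℝ)) / 2) / X with hE
  have hE0 : 0 < E := by positivity
  refine ⟨?_, (h.integral_le hC₁ hw).trans (le_of_eq (by ring))⟩
  have hpt := hlow X β P (by linarith) hβB h
  -- The time in which the wave travels one diffusive length √T. The bound βX ≥ s makes it at most
  -- T/√s, so t^{-d/2} is comparable to T^{-d/2} throughout the window [T, T + l].
  set l := √T / β with hl
  have hl0 : 0 < l := by positivity
  have hlT : l ≤ T * (√s)⁻¹ := by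
    have h1 : s ≤ β ^ 2 * T := by rw [pow_two, mul_assoc, hβT]; exact hsX
    have h2 : √s ≤ β * √T := by
      have := Real.sqrt_le_sqrt h1
      rwa [Real.sqrt_mul (by positivity), Real.sqrt_sq hβ.le] at this
    rw [hl, div_le_iff₀ hβ, ← div_eq_mul_inv, div_mul_eq_mul_div, le_div_iff₀ hss]
    have h3 : √T * √T = T := Real.mul_self_sqrt hT0.le
    calc √T * √s ≤ √T * (β * √T) := by gcongr
      _ = T * β := by linear_combination β * h3
  have hwin := integral_ge_of_window (ε := ε) (b := c₁ * (κ * T ^ (-(d : ℝ) / 2))) (T₁ := T)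
    (T₂ := T + l) h.integrable hw.1 (fun t ht => (hpt t ht).1) hT0 (by linarith) (fun t ht => by
      have ht0 : 0 < t := hT0.trans_le ht.1
      refine le_trans ?_ ((hpt t ht0).2 ?_)
      · have h1 : κ * T ^ (-(d : ℝ) / 2) ≤ t ^ (-(d : ℝ) / 2) := by
          rw [hκ, ← Real.mul_rpow (by positivity) hT0.le]
          refine Real.rpow_le_rpow_of_nonpos ht0 ?_ (by
            have : (0 : ℝ) ≤ d := Nat.cast_nonneg d
            linarith)
          linarith [ht.2]
        gcongr
      · have e : |X - t * β| = β * (t - T) := by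
          rw [← hβT, abs_sub_comm, abs_of_nonneg (by nlinarith [ht.1])]; ring
        rw [e]
        have h1 : β * (t - T) ≤ β * l := by gcongr; linarith [ht.2]
        have h2 : β * l = √T := by rw [hl]; field_simp
        have h3 : √T ≤ √t := Real.sqrt_le_sqrt ht.1
        linarith [Real.sqrt_nonneg t])
  have hEl : T ^ (-(d : ℝ) / 2) * l = E := by
    rw [hl, hE, show (3 - (d : ℝ)) / 2 = -d / 2 + 1 / 2 + 1 by ring, Real.rpow_add hT0,
      Real.rpow_add hT0, ← Real.sqrt_eq_rpow, Real.rpow_one, hT]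
    field_simp
  have h5 : ε * ∫ t in Set.Ioi (0 : ℝ), profile d (a - 1 / 2) X β t ≤ c₁ * κ / 2 * E := by
    calc _ ≤ ε * (C * E) := by gcongr; exact hw.2
      _ = _ := by rw [hε]; field_simp
  have h6 : c₁ * (κ * T ^ (-(d : ℝ) / 2)) * (T + l - T) = c₁ * κ * E := by
    rw [← hEl]; ring
  rw [h6] at hwin
  linarith

theorem DiffusiveWave.integral_diffusive (d : ℕ) {a c₀ C₁ C₂ K η B : ℝ} (hd : 3 ≤ d)
    (ha : 2 ≤ a) (had : -1 ≤ a - d) (hc : 0 < c₀) (hC₁ : 0 < C₁) (hC₂ : 0 < C₂) (hK : 0 < K)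
    (hη : 0 < η) (hB : 0 < B) :
    ∃ R c C, 0 < R ∧ 0 < c ∧ 0 < C ∧ ∀ X β P, R ≤ X → 0 < β → β ≤ B → β * X ≤ 1 →
      DiffusiveWave d a c₀ C₁ C₂ K η X β P →
        c * X ^ (2 - (d : ℝ)) ≤ ∫ t in Set.Ioi (0 : ℝ), P t ∧
        ∫ t in Set.Ioi (0 : ℝ), P t ≤ C * X ^ (2 - (d : ℝ)) := by
  obtain ⟨C, hC, hCw⟩ := integral_profile_diffusive d (α := a - 1 / 2) hd (by linarith)
    (by linarith)
  set c₁ := c₀ * Real.exp (-(1 / K)) with hc₁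
  have hc₁0 : 0 < c₁ := by positivity
  set κ := (2 : ℝ) ^ (-(d : ℝ) / 2) with hκ
  have hκ0 : 0 < κ := by positivity
  set ε := c₁ * κ / (2 * C) with hε
  have hε0 : 0 < ε := by positivity
  obtain ⟨R, hR, hlow⟩ := DiffusiveWave.pointwise_lower d hc hC₁ hC₂ hK hη hB
    (by linarith : 1 / 2 ≤ a) hε0
  refine ⟨R + 2, c₁ * κ / 2, C₁ * C, by positivity, by positivity, by positivity,
    fun X β P hX hβ hβB hβX h => ?_⟩
  have hX0 : 0 < X := by linarith
  have hw := hCw X β (by linarith) hβ hβX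
  refine ⟨?_, (h.integral_le hC₁ hw).trans (le_of_eq (by ring))⟩
  have hpt := hlow X β P (by linarith) hβB h
  -- On [X², 2X²] one has X ≤ √t and tβ ≤ 2X, so the point stays within two diffusive lengths of the
  -- centre.
  have hwin := integral_ge_of_window (ε := ε) (b := c₁ * (κ * (X ^ 2) ^ (-(d : ℝ) / 2)))
    (T₁ := X ^ 2) (T₂ := 2 * X ^ 2) h.integrable hw.1 (fun t ht => (hpt t ht).1) (by positivity)
    (by nlinarith) (fun t ht => by
      have ht0 : 0 < t := lt_of_lt_of_le (by positivity) ht.1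
      refine le_trans ?_ ((hpt t ht0).2 ?_)
      · have h1 : κ * (X ^ 2) ^ (-(d : ℝ) / 2) ≤ t ^ (-(d : ℝ) / 2) := by
          rw [hκ, ← Real.mul_rpow (by positivity) (by positivity)]
          refine Real.rpow_le_rpow_of_nonpos ht0 ht.2 (by
            have : (0 : ℝ) ≤ d := Nat.cast_nonneg d
            linarith)
        gcongr
      · have h1 : X ≤ √t := Real.le_sqrt_of_sq_le ht.1
        have h2 : t * β ≤ 2 * X := by
          calc t * β ≤ 2 * X ^ 2 * β := by gcongr; exact ht.2
            _ = 2 * X * (β * X) := by ring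
            _ ≤ 2 * X * 1 := by gcongr
            _ = _ := mul_one _
        have h3 : 0 < t * β := by positivity
        rw [abs_le]
        constructor <;> linarith)
  have hEl : (X ^ 2) ^ (-(d : ℝ) / 2) * X ^ 2 = X ^ (2 - (d : ℝ)) := by
    rw [← Real.rpow_natCast, ← Real.rpow_mul hX0.le, ← Real.rpow_add hX0]
    congr 1; push_cast; ring
  have h5 : ε * ∫ t in Set.Ioi (0 : ℝ), profile d (a - 1 / 2) X β t
      ≤ c₁ * κ / 2 * X ^ (2 - (d : ℝ)) := by
    calc _ ≤ ε * (C * X ^ (2 - (d : ℝ))) := by gcongr; exact hw.2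
      _ = _ := by rw [hε]; field_simp
  have h6 : c₁ * (κ * (X ^ 2) ^ (-(d : ℝ) / 2)) * (2 * X ^ 2 - X ^ 2)
      = c₁ * κ * X ^ (2 - (d : ℝ)) := by
    rw [← hEl]; ring
  rw [h6] at hwin
  linarith

/-! ### The crossover estimate -/

theorem normS_zero {d : ℕ} [NeZero d] {S : ZSpace d → ℝ} (h : DecayAssumption S) :
    normS S 0 = 0 := by
  rw [normS_eq_of_isMaxOn S 0 0 (subset_closure h.zero_mem) (by simp)]; simp

/-- The reduction of the crossover estimate to time integrals of diffusive waves. -/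
theorem exists_diffusiveWave (d : ℕ) [NeZero d] {M K ζ : ℝ} (hM : 0 < M) (hK : 0 < K)
    (hζ : 0 < ζ) :
    ∃ κ c₀ C₁ C₂, 1 ≤ κ ∧ 0 < c₀ ∧ 0 < C₁ ∧ 0 < C₂ ∧
      ∀ S J g : ZSpace d → ℝ, CrossoverHypotheses M K ζ S J g →
        0 < mass S ∧ ∀ x : ZSpace d, 0 < normS S (latticeVec x) → ∃ X β P,
          DiffusiveWave d (decayOrder d) c₀ C₁ C₂ K (min ζ 1) X β P ∧ 0 < X ∧ 0 < β ∧ β ≤ M ∧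
          X ≤ κ * normS S (latticeVec x) ∧ normS S (latticeVec x) ≤ κ * X ∧
          β ≤ κ * mass S ∧ mass S ≤ κ * β ∧
          S x = (∫ t in Set.Ioi (0 : ℝ), P t)
            * Real.exp (-(mass S * normS S (latticeVec x))) := by
  have hη : 0 < min ζ 1 := lt_min hζ one_pos
  have hd : (0 : ℝ) < d := by exact_mod_cast Nat.pos_of_ne_zero (NeZero.ne d)
  obtain ⟨C₁, hC₁, h1⟩ := sourceKernel_bound d (a := decayOrder d) hM hK hη (one_le_highExp d)
    highExp_condition (le_two_mul_decayOrder d)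
  obtain ⟨c₀, C₂, hc₀, hC₂, h2⟩ := re_sourceKernel_ge d (p := highExp d) (a := decayOrder d)
    hM hK hη (min_le_right ζ 1)
  -- One constant for all comparisons: `d` relates |x| to |x|_S, `2 * M * d` bounds the speed by the
  -- mass, and `d / (2 * K)` bounds the mass by the speed.
  refine ⟨1 + d + 2 * M * d + d / (2 * K), c₀, C₁, C₂, ?_, hc₀, hC₁, hC₂,
    fun S J g h => ⟨h.decay.mass_pos, fun x hx => ?_⟩⟩
  · have : 0 < d / (2 * K) := by positivity
    have : 0 < 2 * M * d := by positivity
    linarith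
  have hm := h.decay.mass_pos
  have hx0 : latticeVec x ≠ 0 := fun h0 => by rw [h0, normS_zero h.decay] at hx; exact hx.false
  obtain ⟨μ, hμ, he, hb1, hb2, hb3, hb4⟩ := h.exists_dual_tilt hM hK hζ hx0
  obtain ⟨hn1, hn2⟩ := h.decay.normS_bounds hx0
  have hμc := (h.decay.mem_frontier_iff.mp hμ).1
  have hQ := h.kernelClass hM hζ hμc
  have hg := h.sourceClass hM hζ hμc
  obtain ⟨hint, hrep⟩ := h.mul_exp_eq_integral hM hK hζ hμ x
  have hX0 : 0 < ‖latticeVec x‖ := norm_pos_iff.mpr hx0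
  have hβ0 : 0 < ‖drift (tilt μ J)‖ := lt_of_lt_of_le (by positivity) hb1
  have q1 : 0 < d / (2 * K) := by positivity
  have q2 : 0 < 2 * M * d := by positivity
  refine ⟨‖latticeVec x‖, ‖drift (tilt μ J)‖, fun t => (sourceKernel (tilt μ J) (tilt μ g) t x).re,
    ⟨hint, fun t ht => ?_, fun t ht => ?_⟩, hX0, hβ0, hb3, ?_, ?_, ?_, ?_, ?_⟩
  · refine (Complex.abs_re_le_norm _).trans ((h1 _ _ hQ hg t ht x).trans (le_of_eq ?_))
    rw [hb4 t, profile, mul_assoc]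
  · have := h2 _ _ hQ hg (h.g_lower μ hμ) t ht x
    rwa [hb4 t] at this
  · refine hn2.trans ?_
    gcongr; linarith
  · refine hn1.trans ?_
    gcongr; linarith
  · refine hb2.trans ?_
    gcongr; linarith
  · calc mass S = d / (2 * K) * (2 * K / d * mass S) := by field_simp
      _ ≤ d / (2 * K) * ‖drift (tilt μ J)‖ := by gcongr
      _ ≤ _ := by gcongr; linarith
  · rw [← hrep, he, mul_assoc, ← Real.exp_add]; simp

theorem rpow_le_of_comparable {u v κ : ℝ} (r : ℝ) (hu : 0 < u) (hv : 0 < v) (hκ : 0 < κ)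
    (h1 : u ≤ κ * v) (h2 : v ≤ κ * u) : u ^ r ≤ κ ^ |r| * v ^ r := by
  rcases le_total 0 r with hr | hr
  · rw [abs_of_nonneg hr, ← Real.mul_rpow hκ.le hv.le]
    exact Real.rpow_le_rpow hu.le h1 hr
  · rw [abs_of_nonpos hr, Real.rpow_neg hκ.le, ← Real.inv_rpow hκ.le,
      ← Real.mul_rpow (by positivity) hv.le]
    refine Real.rpow_le_rpow_of_nonpos (by positivity) ?_ hr
    rw [inv_mul_le_iff₀ hκ]; exact h2

theorem mul_rpow_le_of_comparable {u u' v v' κ : ℝ} (r q : ℝ) (hu : 0 < u) (hu' : 0 < u')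
    (hv : 0 < v) (hv' : 0 < v') (hκ : 0 < κ) (h1 : u ≤ κ * v) (h2 : v ≤ κ * u)
    (h3 : u' ≤ κ * v') (h4 : v' ≤ κ * u') :
    u ^ r * u' ^ q ≤ κ ^ (|r| + |q|) * (v ^ r * v' ^ q) := by
  rw [Real.rpow_add hκ]
  calc _ ≤ (κ ^ |r| * v ^ r) * (κ ^ |q| * v' ^ q) := by
        gcongr ?_ * ?_
        · exact rpow_le_of_comparable r hu hv hκ h1 h2
        · exact rpow_le_of_comparable q hu' hv' hκ h3 h4
    _ = _ := by ring

theorem max_one_mul_le {κ u u' v v' : ℝ} (hκ : 1 ≤ κ) (hu' : 0 ≤ u') (hv : 0 ≤ v)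
    (h1 : u ≤ κ * v) (h2 : u' ≤ κ * v') : max 1 (u * u') ≤ κ ^ 2 * max 1 (v * v') := by
  have hκ2 : 1 ≤ κ ^ 2 := one_le_pow₀ hκ
  refine max_le ?_ ?_
  · nlinarith [le_max_left 1 (v * v')]
  · calc u * u' ≤ (κ * v) * (κ * v') := by gcongr
      _ = κ ^ 2 * (v * v') := by ring
      _ ≤ _ := by gcongr; exact le_max_right _ _

theorem sandwich_of_comparable {c C Γ A G I e : ℝ} (hΓ : 0 < Γ) (hc : 0 < c) (hC : 0 < C)
    (he : 0 ≤ e) (h1 : A ≤ Γ * G) (h2 : G ≤ Γ * A) (h3 : c * A ≤ I) (h4 : I ≤ C * A) :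
    c / Γ * (G * e) ≤ I * e ∧ I * e ≤ C * Γ * (G * e) := by
  rw [← mul_assoc, ← mul_assoc]
  constructor
  · gcongr
    refine le_trans ?_ h3
    rw [div_mul_eq_mul_div, div_le_iff₀ hΓ]
    calc c * G ≤ c * (Γ * A) := by gcongr
      _ = _ := by ring
  · gcongr
    refine h4.trans ?_
    calc C * A ≤ C * (Γ * G) := by gcongr
      _ = _ := by ring

theorem decayOrder_sub_ge (d : ℕ) : -1 ≤ (decayOrder d : ℝ) - d := by
  have : d ≤ decayOrder d + 1 := by unfold decayOrder; omega
  have : (d : ℝ) ≤ decayOrder d + 1 := by exact_mod_cast this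
  linarith

theorem two_le_decayOrder (d : ℕ) : (2 : ℝ) ≤ decayOrder d := by
  exact_mod_cast le_max_left 2 (d - 1)

theorem ballistic_rpow {X β : ℝ} (d : ℕ) (hX : 0 < X) (hβ : 0 < β) :
    (X / β) ^ ((3 - (d : ℝ)) / 2) / X
      = β ^ (-((3 - (d : ℝ)) / 2)) * X ^ (-(((d : ℝ) - 1) / 2)) := by
  rw [Real.div_rpow hX.le hβ.le, Real.rpow_neg hβ.le, show -(((d : ℝ) - 1) / 2)
    = (3 - d) / 2 - 1 by ring, Real.rpow_sub_one hX.ne']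
  field_simp

/-- The regimes meet at βX = 1, where both formulas equal X^{2-d}; the maximum in the statement
selects the correct one on each side. -/
theorem DiffusiveWave.integral_crossover (d : ℕ) {a c₀ C₁ C₂ K η B : ℝ} (hd : 3 ≤ d)
    (ha : 2 ≤ a) (had : -1 ≤ a - d) (hc : 0 < c₀) (hC₁ : 0 < C₁) (hC₂ : 0 < C₂) (hK : 0 < K)
    (hη : 0 < η) (hB : 0 < B) :
    ∃ R c C, 0 < R ∧ 0 < c ∧ 0 < C ∧ ∀ X β P, R ≤ X → 0 < β → β ≤ B →
      DiffusiveWave d a c₀ C₁ C₂ K η X β P →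
        c * (max 1 (β * X) ^ (((d : ℝ) - 3) / 2) * X ^ (-((d : ℝ) - 2)))
          ≤ ∫ t in Set.Ioi (0 : ℝ), P t ∧
        ∫ t in Set.Ioi (0 : ℝ), P t
          ≤ C * (max 1 (β * X) ^ (((d : ℝ) - 3) / 2) * X ^ (-((d : ℝ) - 2))) := by
  obtain ⟨R₁, c₁, C₁', hR₁, hc₁, hC₁', h1⟩ := DiffusiveWave.integral_ballistic d (by omega) ha had
    hc hC₁ hC₂ hK hη hB one_pos
  obtain ⟨R₂, c₂, C₂', hR₂, hc₂, hC₂', h2⟩ := DiffusiveWave.integral_diffusive d hd ha had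
    hc hC₁ hC₂ hK hη hB
  refine ⟨max R₁ R₂, min c₁ c₂, max C₁' C₂', lt_max_of_lt_left hR₁, lt_min hc₁ hc₂,
    lt_max_of_lt_left hC₁', fun X β P hX hβ hβB h => ?_⟩
  have hX0 : 0 < X := hR₁.trans_le ((le_max_left _ _).trans hX)
  rcases le_total 1 (β * X) with hβX | hβX
  · have e : max 1 (β * X) ^ (((d : ℝ) - 3) / 2) * X ^ (-((d : ℝ) - 2))
        = (X / β) ^ ((3 - (d : ℝ)) / 2) / X := by
      rw [ballistic_rpow d hX0 hβ, max_eq_right hβX, Real.mul_rpow hβ.le hX0.le, mul_assoc,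
        ← Real.rpow_add hX0]
      congr 2 <;> ring
    rw [e]
    obtain ⟨h3, h4⟩ := h1 X β P ((le_max_left _ _).trans hX) hβ hβB hβX h
    exact ⟨le_trans (by gcongr; exact min_le_left _ _) h3,
      h4.trans (by gcongr; exact le_max_left _ _)⟩
  · have e : max 1 (β * X) ^ (((d : ℝ) - 3) / 2) * X ^ (-((d : ℝ) - 2)) = X ^ (2 - (d : ℝ)) := by
      rw [max_eq_left hβX, Real.one_rpow, one_mul]; congr 1; ring
    rw [e]
    obtain ⟨h3, h4⟩ := h2 X β P ((le_max_right _ _).trans hX) hβ hβB hβX h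
    exact ⟨le_trans (by gcongr; exact min_le_right _ _) h3,
      h4.trans (by gcongr; exact le_max_right _ _)⟩

end

theorem corollary1p6 (d : ℕ) [NeZero d] (M K ζ : ℝ) (hM : 0 < M) (hK : 0 < K) (hζ : 0 < ζ) :
    (2 < d →
      ∃ R c C : ℝ, 0 < R ∧ 0 < c ∧ 0 < C ∧
        ∀ S J g : ZSpace d → ℝ, CrossoverHypotheses M K ζ S J g →
          ∀ x : ZSpace d, R ≤ normS S (latticeVec x) →
            c * (max 1 (mass S * normS S (latticeVec x)) ^ (((d : ℝ) - 3) / 2)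
                  / normS S (latticeVec x) ^ ((d : ℝ) - 2)
                  * Real.exp (-(mass S * normS S (latticeVec x)))) ≤ S x ∧
            S x ≤ C * (max 1 (mass S * normS S (latticeVec x)) ^ (((d : ℝ) - 3) / 2)
                  / normS S (latticeVec x) ^ ((d : ℝ) - 2)
                  * Real.exp (-(mass S * normS S (latticeVec x))))) ∧
    (d ≤ 2 →
      ∀ s₀ : ℝ, 0 < s₀ →
        ∃ R c C : ℝ, 0 < R ∧ 0 < c ∧ 0 < C ∧
          ∀ S J g : ZSpace d → ℝ, CrossoverHypotheses M K ζ S J g →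
            ∀ x : ZSpace d, max R (s₀ / mass S) ≤ normS S (latticeVec x) →
              c * (1 / (mass S ^ ((3 - (d : ℝ)) / 2)
                      * normS S (latticeVec x) ^ (((d : ℝ) - 1) / 2))
                    * Real.exp (-(mass S * normS S (latticeVec x)))) ≤ S x ∧
              S x ≤ C * (1 / (mass S ^ ((3 - (d : ℝ)) / 2)
                      * normS S (latticeVec x) ^ (((d : ℝ) - 1) / 2))
                    * Real.exp (-(mass S * normS S (latticeVec x))))) := by
  obtain ⟨κ, c₀, C₁, C₂, hκ, hc₀, hC₁, hC₂, hwave⟩ := exists_diffusiveWave d hM hK hζ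
  have hκ0 : 0 < κ := by linarith
  have hη : 0 < min ζ 1 := lt_min hζ one_pos
  refine ⟨fun hd => ?_, fun hd s₀ hs₀ => ?_⟩
  · obtain ⟨R, c, C, hR, hc, hC, hest⟩ := DiffusiveWave.integral_crossover d hd
      (two_le_decayOrder d) (decayOrder_sub_ge d) hc₀ hC₁ hC₂ hK hη hM
    -- Replacing the product βX by m_S|x|_S costs κ twice, so κ² is used for both factors.
    set Γ := (κ ^ 2) ^ (|((d : ℝ) - 3) / 2| + |-((d : ℝ) - 2)|) with hΓ
    have hΓ0 : 0 < Γ := by positivity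
    refine ⟨κ * R, c / Γ, C * Γ, by positivity, by positivity, by positivity,
      fun S J g h x hx => ?_⟩
    obtain ⟨hm, hwave'⟩ := hwave S J g h
    have hn : 0 < normS S (latticeVec x) := lt_of_lt_of_le (by positivity) hx
    obtain ⟨X, β, P, hP, hX, hβ, hβM, hXn, hnX, hβm, hmβ, hS⟩ := hwave' x hn
    set n := normS S (latticeVec x) with hn_def
    set m := mass S with hm_def
    obtain ⟨h3, h4⟩ := hest X β P (le_of_mul_le_mul_left (hx.trans hnX) hκ0) hβ hβM hP
    have hκ2 : κ ≤ κ ^ 2 := by nlinarith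
    have e1 : X ≤ κ ^ 2 * n := hXn.trans (by gcongr)
    have e2 : n ≤ κ ^ 2 * X := hnX.trans (by gcongr)
    have e3 : max 1 (β * X) ≤ κ ^ 2 * max 1 (m * n) := max_one_mul_le hκ hX.le hm.le hβm hXn
    have e4 : max 1 (m * n) ≤ κ ^ 2 * max 1 (β * X) := max_one_mul_le hκ hn.le hβ.le hmβ hnX
    have p1 : 0 < max 1 (β * X) := lt_max_of_lt_left one_pos
    have p2 : 0 < max 1 (m * n) := lt_max_of_lt_left one_pos
    rw [hS, div_eq_mul_inv _ (n ^ ((d : ℝ) - 2)), ← Real.rpow_neg hn.le]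
    exact sandwich_of_comparable hΓ0 hc hC (Real.exp_pos _).le
      (mul_rpow_le_of_comparable _ _ p1 hX p2 hn (by positivity) e3 e4 e1 e2)
      (mul_rpow_le_of_comparable _ _ p2 hn p1 hX (by positivity) e4 e3 e2 e1) h3 h4
  · have hs : 0 < s₀ / κ ^ 2 := by positivity
    obtain ⟨R, c, C, hR, hc, hC, hest⟩ := DiffusiveWave.integral_ballistic d
      (Nat.one_le_iff_ne_zero.mpr (NeZero.ne d)) (two_le_decayOrder d) (decayOrder_sub_ge d)
      hc₀ hC₁ hC₂ hK hη hM hs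
    set Γ := κ ^ (|-((3 - (d : ℝ)) / 2)| + |-(((d : ℝ) - 1) / 2)|) with hΓ
    have hΓ0 : 0 < Γ := by positivity
    refine ⟨κ * R, c / Γ, C * Γ, by positivity, by positivity, by positivity,
      fun S J g h x hx => ?_⟩
    obtain ⟨hm, hwave'⟩ := hwave S J g h
    have hn : 0 < normS S (latticeVec x) :=
      lt_of_lt_of_le (by positivity) ((le_max_left _ _).trans hx)
    obtain ⟨X, β, P, hP, hX, hβ, hβM, hXn, hnX, hβm, hmβ, hS⟩ := hwave' x hn
    set n := normS S (latticeVec x) with hn_def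
    set m := mass S with hm_def
    have hmn : s₀ ≤ m * n := by
      have := (le_max_right _ _).trans hx
      rwa [div_le_iff₀ hm, mul_comm] at this
    have hβX : s₀ / κ ^ 2 ≤ β * X := by
      rw [div_le_iff₀ (by positivity)]
      calc s₀ ≤ m * n := hmn
        _ ≤ (κ * β) * (κ * X) := by gcongr
        _ = _ := by ring
    obtain ⟨h3, h4⟩ := hest X β P
      (le_of_mul_le_mul_left (((le_max_left _ _).trans hx).trans hnX) hκ0) hβ hβM hβX hP
    rw [ballistic_rpow d hX hβ] at h3 h4
    rw [hS, one_div, mul_inv, ← Real.rpow_neg hm.le, ← Real.rpow_neg hn.le]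
    exact sandwich_of_comparable hΓ0 hc hC (Real.exp_pos _).le
      (mul_rpow_le_of_comparable _ _ hβ hX hm hn hκ0 hβm hmβ hXn hnX)
      (mul_rpow_le_of_comparable _ _ hm hn hβ hX hκ0 hmβ hβm hnX hXn) h3 h4
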